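/- **Notation.** Let $k\ge 1$, write $|a|=a_1+\dots+a_k$, and let $\alpha\in\mathbb R^k$ with $\alpha_i>0$ for all $i$ and $|\alpha|=1$ (so $\alpha$ is in the interior of the standard simplex $\Delta^{k-1}$, identified with $\mathscr P([k])$). Put $\Lambda^+_\alpha=\{a\in\alpha+\mathbb Z^k: |a|>0\}$, $H_\alpha=\{a\in\Lambda^+_\alpha: a_i>0\ \forall i\}$ and $M_{\alpha,\ell}=\{a\in\Lambda_\alpha^+:|a|=\ell\}$ (isoplethic layers). For $a\in\Lambda^+_\alpha$ let $$\Phi[a;s]=\sum_{m\in\mathbb N_0^k}\frac{(a)_m\,s^m}{(|a|)_{|m|}\,m!},\qquad f_a(s,u,t)=\Phi[a;s]\,u^a\,t^{|a|}$$ as functions on $\mathbb C^k\times(\mathbb C\setminus(-\infty,0])^{k+1}$, where $(a)_m=\prod_i (a_i)_{m_i}$ with rising factorials and powers are principal; $\mathcal O_A$ is the linear span of $\{f_a\}_{a\in A}$ and $\mathcal O_a=\mathcal O_{\{a\}}$. Let $$E_i=u_it\big(s_i\partial_{s_i}+u_i\partial_{u_i}-(s\cdot\nabla^s)\partial_{s_i}\big),\quad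 E_{-i}=(u_it)^{-1}(s_i-s\cdot\nabla^s-t\partial_t+1),$$ $$E_{i,-j}=u_iu_j^{-1}\big((s_i-s_j)\partial_{s_i}+u_i\partial_{u_i}\big)\ (i\ne j),\quad J_i=t\partial_t+u_i\partial_{u_i}-1 .$$ Index the rows and columns of matrices in $\mathfrak l=\mathfrak{sl}_{k+1}(\mathbb C)$ by $0,\dots,k$; let $\mathbf E_{p,q}$ be the matrix units and, for $i\in[k]$, $e_{0,i}=\mathbf E_{0,i}$, $f_{i,0}=\mathbf E_{i,0}$, $h_{0,i}=\mathbf E_{0,0}-\mathbf E_{i,i}$. Let $\mathfrak h$ be the diagonal matrices in $\mathfrak l$, $\mathfrak f\cong\mathfrak{sl}_k(\mathbb C)$ the matrices in $\mathfrak l$ with vanishing row and column $0$, and $\mathfrak r^+=\mathrm{span}\{e_{0,j}\}_{j\in[k]}$; $\mathfrak U(\cdot)$ denotes the universal enveloping algebra. Let $\mathrm{Dir}_\alpha$ be the Dirichlet distribution, and for $p\in\mathbb N_0^k$ let $\mathrm{Dir}_\alpha^p$ be the conditional law of $Y\sim\mathrm{Dir}_\alpha$ given that among $|p|$ samples, which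 given $Y$ are independent and take the value $i$ with probability $Y_i$, each $i\in[k]$ occurs exactly $p_i$ times. Write $\widehat\mu(s)=\int e^{\mathrm i s\cdot y}\,d\mu(y)$, $s\in\mathbb R^k$. **Theorem 1.2.** The functions $f_a$, $a\in\Lambda^+_\alpha$, are linearly independent, and there is a unique Lie algebra representation $\rho$ of $\mathfrak l$ on $\mathcal O_{\Lambda^+_\alpha}$ under which $e_{0,i}$, $h_{0,i}$, $f_{i,0}$ and $\mathbf E_{j,i}$ $(i\neq j$ in $[k])$ act on the functions $f_a$ as $E_i$, $J_i$, $E_{-i}$ and $-E_{i,-j}$, respectively, with the convention that $E_{-i}$ acts as $0$ on $f_a$ when $|a|=1$. It is faithful, its image is the complex Lie algebra generated by the raising and lowering operators $E_{\pm1},\dots,E_{\pm k}$, and the real Lie algebra generated by them is isomorphic to $\mathfrak{sl}_{k+1}(\mathbb R)$. Moreover: 1. $\mathcal O_{\Lambda^+_\alpha}$ is a weight $\mathfrak l$-module: it is the direct sum of its $\mathfrak h$-weight spaces, which are finite-dimensional. For $a\in\Lambda_\alpha^+$ the line $\mathcal O_a$ is the weight space of the weight $\lambda_a\in\mathfrak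 h^*$ with $\lambda_a(h_{0,i})=|a|-1+a_i$. The action extends uniquely to $\mathfrak U(\mathfrak l)$. 2. $\mathfrak U(\mathfrak f)$ maps $\mathcal O_{M_{\alpha,\ell}}$ into itself for every integer $\ell\ge1$. One has $H_\alpha=\{\alpha+p:p\in\mathbb N_0^k\}$, and $\mathfrak U(\mathfrak h)$, $\mathfrak U(\mathfrak r^+)$ and $\mathfrak U(\mathfrak h)\oplus\mathfrak U(\mathfrak r^+)$, where $(v,w)$ acts as $v+w$, map $\mathcal O_{H_\alpha}$ into itself. 3. For every $p\in\mathbb N_0^k$ one has $f_{\alpha+p}(\mathrm i s,\mathbf 1,1)=\widehat{\mathrm{Dir}_\alpha^p}(s)$ for $s\in\mathbb R^k$, and $F\mapsto F(\mathrm i\,\cdot,\mathbf 1,1)$ maps the line $\mathcal O_{\alpha+p}$ bijectively onto $\mathbb C\,\widehat{\mathrm{Dir}_\alpha^p}$. There is a unique $v=v(p)\in\mathfrak U(\mathfrak r^+)$ with $v.f_\alpha=f_{\alpha+p}$, and an element $v'\in\mathfrak U(\mathfrak r^+)$ satisfies $v'.\mathcal O_\alpha=\mathcal O_{\alpha+p}$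 if and only if $v'=c\,v$ for some $c\in\mathbb C\setminus\{0\}$. 4. Let $W\subset GL(\mathfrak h^*)$ be the Weyl group of $(\mathfrak l,\mathfrak h)$ and, for $j\in[k]$, let $\beta_j\in\mathfrak h^*$ be the root of $e_{0,j}$. There is a unique subgroup $G\le W$ that is isomorphic to $\mathfrak S_k$ and each of whose elements permutes $\{\beta_1,\dots,\beta_k\}$. There is an isomorphism $\varphi:\mathfrak S_k\to G$ with $\varphi(\pi)\beta_j=\beta_{\pi(j)}$, and it corresponds to the canonical action of $\mathfrak S_k$ on $\mathscr P([k])$ by push-forward: the map $\mathscr P([k])\to\mathfrak h^*$, $a\mapsto\lambda_a$, is injective and $\varphi(\pi)\lambda_a=\lambda_{\pi_*a}$, where $(\pi_*a)_i=a_{\pi^{-1}(i)}$. -/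

import Mathlib

open MeasureTheory

attribute [local instance 100] LieRing.ofAssociativeRing

noncomputable section

namespace DirichletHumbert

/-! ### The functions `f_a` -/

/-- The confluent Lauricella (second Humbert) function with `c = |a|`:
`Φ[a; s] = ∑_m (a)_m s^m / ((|a|)_{|m|} m!)`, summed over multi-indices `m`. -/
def humbertPhi {k : ℕ} (a s : Fin k → ℂ) : ℂ :=
  ∑' m : Fin k → ℕ,
    (∏ i, (ascPochhammer ℂ (m i)).eval (a i) * s i ^ m i / ((m i).factorial : ℂ)) /
      (ascPochhammer ℂ (∑ i, m i)).eval (∑ i, a i)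

/-- Points `(s, u, t)`. -/
abbrev Pt (k : ℕ) := (Fin k → ℂ) × (Fin k → ℂ) × ℂ

/-- The domain `ℂ^k × (ℂ ∖ (-∞, 0])^(k+1)`. -/
def humbertDom (k : ℕ) : Set (Pt k) :=
  {x | (∀ i, x.2.1 i ∈ Complex.slitPlane) ∧ x.2.2 ∈ Complex.slitPlane}

/-- `f_a(s, u, t) = Φ[a; s] u^a t^|a|` on the domain `humbertDom k` (principal branches).
Functions on the domain are represented by their extension by zero. -/
def humbertFun {k : ℕ} (a : Fin k → ℝ) : Pt k → ℂ :=
  (humbertDom k).indicator fun x =>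
    humbertPhi (fun i => (a i : ℂ)) x.1 * (∏ i, x.2.1 i ^ (a i : ℂ)) *
      x.2.2 ^ (((∑ i, a i : ℝ)) : ℂ)

/-- `O_A`, the linear span of the functions `f_a`, `a ∈ A`. -/
def OSpan {k : ℕ} (A : Set (Fin k → ℝ)) : Submodule ℂ (Pt k → ℂ) :=
  Submodule.span ℂ (humbertFun '' A)

/-- `Λ_α = α + ℤ^k`. -/
def lattice {k : ℕ} (α : Fin k → ℝ) : Set (Fin k → ℝ) :=
  {a | ∃ n : Fin k → ℤ, ∀ i, a i = α i + n i}

/-- `Λ⁺_α`, the points of `Λ_α` of positive length. -/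
def posLattice {k : ℕ} (α : Fin k → ℝ) : Set (Fin k → ℝ) :=
  {a | a ∈ lattice α ∧ 0 < ∑ i, a i}

/-- `H_α`, the points of `Λ⁺_α` with positive coordinates. -/
def octant {k : ℕ} (α : Fin k → ℝ) : Set (Fin k → ℝ) :=
  {a | a ∈ posLattice α ∧ ∀ i, 0 < a i}

/-- `M_{α,ℓ}`, the isoplethic layer of points of `Λ⁺_α` of length `ℓ`. -/
def layer {k : ℕ} (α : Fin k → ℝ) (l : ℝ) : Set (Fin k → ℝ) :=
  {a | a ∈ posLattice α ∧ ∑ i, a i = l}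

/-! ### The differential operators -/

/-- `∂/∂s_i`. -/
def dS {k : ℕ} (i : Fin k) (F : Pt k → ℂ) : Pt k → ℂ := fun x =>
  deriv (fun z => F (Function.update x.1 i z, x.2.1, x.2.2)) (x.1 i)

/-- `∂/∂u_i`. -/
def dU {k : ℕ} (i : Fin k) (F : Pt k → ℂ) : Pt k → ℂ := fun x =>
  deriv (fun z => F (x.1, Function.update x.2.1 i z, x.2.2)) (x.2.1 i)

/-- `∂/∂t`. -/
def dT {k : ℕ} (F : Pt k → ℂ) : Pt k → ℂ := fun x =>
  deriv (fun z => F (x.1, x.2.1, z)) x.2.2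

/-- The raising operator `E_i = u_i t (s_i ∂_{s_i} + u_i ∂_{u_i} - (s · ∇ˢ) ∂_{s_i})`. -/
def raiseOp {k : ℕ} (i : Fin k) (F : Pt k → ℂ) : Pt k → ℂ := fun x =>
  x.2.1 i * x.2.2 *
    (x.1 i * dS i F x + x.2.1 i * dU i F x - ∑ j, x.1 j * dS j (dS i F) x)

/-- The lowering operator `E_{-i} = (u_i t)⁻¹ (s_i - s · ∇ˢ - t ∂_t + 1)`. -/
def lowerOp {k : ℕ} (i : Fin k) (F : Pt k → ℂ) : Pt k → ℂ := fun x =>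
  (x.2.1 i * x.2.2)⁻¹ *
    (x.1 i * F x - ∑ j, x.1 j * dS j F x - x.2.2 * dT F x + F x)

/-- The operator `E_{i,-j} = u_i u_j⁻¹ ((s_i - s_j) ∂_{s_i} + u_i ∂_{u_i})`. -/
def shiftOp {k : ℕ} (i j : Fin k) (F : Pt k → ℂ) : Pt k → ℂ := fun x =>
  x.2.1 i * (x.2.1 j)⁻¹ * ((x.1 i - x.1 j) * dS i F x + x.2.1 i * dU i F x)

/-- The operator `J_i = t ∂_t + u_i ∂_{u_i} - 1`. -/
def cartanOp {k : ℕ} (i : Fin k) (F : Pt k → ℂ) : Pt k → ℂ := fun x =>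
  x.2.2 * dT F x + x.2.1 i * dU i F x - F x

/-! ### The Lie algebra `𝔩 = sl_{k+1}(ℂ)` and its subalgebras; matrix indices are `0, …, k` -/

/-- `𝔩 = sl_{k+1}(ℂ)`. -/
abbrev SL (k : ℕ) : LieSubalgebra ℂ (Matrix (Fin (k + 1)) (Fin (k + 1)) ℂ) :=
  LieAlgebra.SpecialLinear.sl (Fin (k + 1)) ℂ

/-- `e_{0,i}`. -/
def e0 {k : ℕ} (i : Fin k) : SL k :=
  LieAlgebra.SpecialLinear.single 0 i.succ (Fin.succ_ne_zero i).symm 1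

/-- `f_{i,0}`. -/
def f0 {k : ℕ} (i : Fin k) : SL k :=
  LieAlgebra.SpecialLinear.single i.succ 0 (Fin.succ_ne_zero i) 1

/-- `h_{0,i}`. -/
def h0 {k : ℕ} (i : Fin k) : SL k :=
  LieAlgebra.SpecialLinear.singleSubSingle 0 i.succ 1

/-- The matrix unit with a one in row `i` and column `j`, where `1 ≤ i, j ≤ k` and `i ≠ j`. -/
def eij {k : ℕ} (i j : Fin k) (h : i ≠ j) : SL k :=
  LieAlgebra.SpecialLinear.single i.succ j.succ (fun h' => h (Fin.succ_injective _ h')) 1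

/-- `𝔥`, the diagonal traceless matrices. -/
def cartan (k : ℕ) : LieSubalgebra ℂ (SL k) where
  carrier := {x | ∀ i j, i ≠ j → x.val i j = 0}
  add_mem' {x y} hx hy i j h := by simp [hx i j h, hy i j h]
  zero_mem' := by simp
  smul_mem' c x hx i j h := by simp [hx i j h]
  lie_mem' {x y} hx hy i j h := by
    rw [LieAlgebra.SpecialLinear.sl_bracket, Matrix.sub_apply, Matrix.mul_apply, Matrix.mul_apply,
      Finset.sum_eq_zero, Finset.sum_eq_zero, sub_zero]
    · intro l _
      by_cases hl : i = l
      · subst hl; rw [hx i j h, mul_zero]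
      · rw [hy i l hl, zero_mul]
    · intro l _
      by_cases hl : i = l
      · subst hl; rw [hy i j h, mul_zero]
      · rw [hx i l hl, zero_mul]

/-- `𝔣`, the traceless matrices whose row `0` and column `0` vanish. -/
def subF (k : ℕ) : LieSubalgebra ℂ (SL k) where
  carrier := {x | ∀ i, x.val 0 i = 0 ∧ x.val i 0 = 0}
  add_mem' {x y} hx hy i := by simp [hx i, hy i]
  zero_mem' := by simp
  smul_mem' c x hx i := by simp [hx i]
  lie_mem' {x y} hx hy i := by
    rw [LieAlgebra.SpecialLinear.sl_bracket]
    constructor <;>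
      simp [Matrix.mul_apply, fun l => (hx l).1, fun l => (hx l).2, fun l => (hy l).1,
        fun l => (hy l).2]

/-- `𝔯⁺`, the span of the `e_{0,j}`: matrices supported on row `0`, columns `1, …, k`. -/
def radPlus (k : ℕ) : LieSubalgebra ℂ (SL k) where
  carrier := {x | ∀ i j, i ≠ 0 ∨ j = 0 → x.val i j = 0}
  add_mem' {x y} hx hy i j h := by simp [hx i j h, hy i j h]
  zero_mem' := by simp
  smul_mem' c x hx i j h := by simp [hx i j h]
  lie_mem' {x y} hx hy i j _ := by
    rw [LieAlgebra.SpecialLinear.sl_bracket, Matrix.sub_apply, Matrix.mul_apply, Matrix.mul_apply,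
      Finset.sum_eq_zero, Finset.sum_eq_zero, sub_zero]
    · intro l _
      by_cases hl : l = 0
      · rw [hy i l (Or.inr hl), zero_mul]
      · rw [hx l j (Or.inl hl), mul_zero]
    · intro l _
      by_cases hl : l = 0
      · rw [hx i l (Or.inr hl), zero_mul]
      · rw [hy l j (Or.inl hl), mul_zero]

/-! ### The action of `𝔩` by the differential operators -/

/-- The Lie algebra representation `ρ` of `𝔩` on `O_{Λ⁺_α}` is given on the functions `f_a` by the
differential operators: `e_{0,i} ↦ E_i`, `h_{0,i} ↦ J_i`, `f_{i,0} ↦ E_{-i}` and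
`e_{j,i} ↦ -E_{i,-j}`, with the convention `E_{-i} f_a = (1 - |a|) f_{a - e_i} = 0` for
`|a| = 1`. -/
structure IsHumbertRep {k : ℕ} (α : Fin k → ℝ)
    (ρ : SL k →ₗ⁅ℂ⁆ Module.End ℂ (OSpan (posLattice α))) : Prop where
  raise : ∀ i, ∀ a ∈ posLattice α, ∀ F : OSpan (posLattice α), F.val = humbertFun a →
    Set.EqOn (ρ (e0 i) F).val (raiseOp i (humbertFun a)) (humbertDom k)
  cartan : ∀ i, ∀ a ∈ posLattice α, ∀ F : OSpan (posLattice α), F.val = humbertFun a →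
    Set.EqOn (ρ (h0 i) F).val (cartanOp i (humbertFun a)) (humbertDom k)
  lower : ∀ i, ∀ a ∈ posLattice α, ∑ j, a j ≠ 1 → ∀ F : OSpan (posLattice α), F.val = humbertFun a →
    Set.EqOn (ρ (f0 i) F).val (lowerOp i (humbertFun a)) (humbertDom k)
  lower_one : ∀ i, ∀ a ∈ posLattice α, ∑ j, a j = 1 → ∀ F : OSpan (posLattice α),
    F.val = humbertFun a → ρ (f0 i) F = 0
  shift : ∀ i j, ∀ h : j ≠ i, ∀ a ∈ posLattice α, ∀ F : OSpan (posLattice α), F.val = humbertFun a →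
    Set.EqOn (ρ (eij j i h) F).val (-shiftOp i j (humbertFun a)) (humbertDom k)

/-- The action of `U(S)` for a Lie subalgebra `S` of `𝔩` that comes from a representation `ρ`
of `𝔩`. -/
def envAct {k : ℕ} {V : Type} [AddCommGroup V] [Module ℂ V]
    (ρ : SL k →ₗ⁅ℂ⁆ Module.End ℂ V) (S : LieSubalgebra ℂ (SL k)) :
    UniversalEnvelopingAlgebra ℂ S →ₐ[ℂ] Module.End ℂ V :=
  UniversalEnvelopingAlgebra.lift ℂ (ρ.comp S.incl)

/-- The image `v.B` of a subspace `B` of functions under an endomorphism `T` of the space of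
functions `O`. -/
def imageUnder {k : ℕ} {O : Submodule ℂ (Pt k → ℂ)} (T : Module.End ℂ O)
    (B : Submodule ℂ (Pt k → ℂ)) : Submodule ℂ (Pt k → ℂ) :=
  ((B.comap O.subtype).map T).map O.subtype

/-- `T` maps the subspace `B` of `O` to itself. -/
def Preserves {k : ℕ} {O : Submodule ℂ (Pt k → ℂ)} (T : Module.End ℂ O)
    (B : Submodule ℂ (Pt k → ℂ)) : Prop :=
  ∀ F : O, F.val ∈ B → (T F).val ∈ B

/-- The weight space of weight `χ ∈ 𝔥*`. -/
def wtSpace {k : ℕ} {V : Type} [AddCommGroup V] [Module ℂ V]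
    (ρ : SL k →ₗ⁅ℂ⁆ Module.End ℂ V) (χ : Module.Dual ℂ (cartan k)) : Submodule ℂ V where
  carrier := {v | ∀ H : cartan k, ρ H.val v = χ H • v}
  add_mem' {v w} hv hw H := by rw [map_add, hv H, hw H, smul_add]
  zero_mem' := by simp
  smul_mem' c v hv H := by rw [map_smul, hv H, smul_comm]

/-- A weight module: the direct sum of its weight spaces, which are finite-dimensional. -/
def IsWeightModule {k : ℕ} {V : Type} [AddCommGroup V] [Module ℂ V]
    (ρ : SL k →ₗ⁅ℂ⁆ Module.End ℂ V) : Prop :=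
  iSupIndep (wtSpace ρ) ∧ ⨆ χ, wtSpace ρ χ = ⊤ ∧ ∀ χ, FiniteDimensional ℂ (wtSpace ρ χ)

/-- The functional `λ_a ∈ 𝔥*` with `λ_a(h_{0,i}) = |a| - 1 + a_i`. -/
def wt {k : ℕ} (a : Fin k → ℝ) : Module.Dual ℂ (cartan k) where
  toFun H := -∑ i : Fin k, (((∑ j, a j) - 1 + a i : ℝ) : ℂ) * H.val.val i.succ i.succ
  map_add' H K := by simp [mul_add, Finset.sum_add_distrib]; ring
  map_smul' c H := by simp [Finset.mul_sum, mul_left_comm]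

/-! ### The Weyl group -/

/-- The root space of `χ`. -/
def IsRootVector {k : ℕ} (χ : Module.Dual ℂ (cartan k)) (x : SL k) : Prop :=
  ∀ H : cartan k, ⁅H.val, x⁆ = χ H • x

/-- The Weyl group of `𝔩` with respect to `𝔥`, acting on `𝔥*`: it is generated by the reflections
`w : μ ↦ μ - μ(H) χ`, where `χ` is a root and `H ∈ [𝔩_χ, 𝔩_{-χ}]` with `χ(H) = 2` its coroot. -/
def weylGroup (k : ℕ) :
    Subgroup (Module.Dual ℂ (cartan k) ≃ₗ[ℂ] Module.Dual ℂ (cartan k)) :=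
  Subgroup.closure {w | ∃ (χ : Module.Dual ℂ (cartan k)) (H : cartan k) (x y : SL k),
    IsRootVector χ x ∧ IsRootVector (-χ) y ∧ ⁅x, y⁆ = H.val ∧ χ H = 2 ∧
    ∀ μ, w μ = μ - μ H • χ}

/-- The root `H ↦ H_{00} - H_{jj}` of the basis element `e_{0,j}` of `𝔯⁺`. -/
def rootPlus {k : ℕ} (j : Fin k) : Module.Dual ℂ (cartan k) where
  toFun H := H.val.val 0 0 - H.val.val j.succ j.succ
  map_add' H K := by simp; ring
  map_smul' c H := by simp [mul_sub]

/-! ### Dirichlet distributions and their posteriors -/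

/-- The corner simplex `{z ∈ ℝ^(k-1) | z ≥ 0, |z| ≤ 1}`. -/
def cornerSimplex (k : ℕ) : Set (Fin (k - 1) → ℝ) :=
  {z | (∀ i, 0 ≤ z i) ∧ ∑ i, z i ≤ 1}

/-- The point `(z_1, …, z_{k-1}, 1 - |z|)` of `ℝ^k`. -/
def cornerMap (k : ℕ) (z : Fin (k - 1) → ℝ) : Fin k → ℝ :=
  fun i => if h : i.val < k - 1 then z ⟨i.val, h⟩ else 1 - ∑ j, z j

/-- The multivariate Beta function. -/
def multiBeta {k : ℕ} (a : Fin k → ℝ) : ℝ :=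
  (∏ i, Real.Gamma (a i)) / Real.Gamma (∑ i, a i)

/-- The Dirichlet distribution with parameter `a`: density `y^(a-1) / B(a)` on the standard
simplex, which is parametrized by the corner simplex. -/
def dirichlet {k : ℕ} (a : Fin k → ℝ) : Measure (Fin k → ℝ) :=
  (((volume : Measure (Fin (k - 1) → ℝ)).restrict (cornerSimplex k)).withDensity fun z =>
    ENNReal.ofReal ((∏ i, cornerMap k z i ^ (a i - 1)) / multiBeta a)).map (cornerMap k)

/-- The joint law of `(Y, W)` where `Y` has law `μ` on the simplex and, given `Y`, the entries of
`W = (W_1, …, W_r)` are independent with `P(W_j = i) = Y_i`; that is,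
`P(Y ∈ B, W = w) = ∫_B ∏_j y_{w_j} dμ(y)`. -/
def sampleLaw {k : ℕ} (μ : Measure (Fin k → ℝ)) (r : ℕ) :
    Measure ((Fin k → ℝ) × (Fin r → Fin k)) :=
  ∑ w : Fin r → Fin k,
    (μ.withDensity fun y => ∏ j, ENNReal.ofReal (y (w j))).map fun y => (y, w)

/-- The posterior distribution of `μ` given atoms of mass `p_i` at the points `i`: the conditional
law of `Y` given that, among `r = |p|` samples, each `i` occurs exactly `p_i` times. -/
def posterior {k : ℕ} (μ : Measure (Fin k → ℝ)) (p : Fin k → ℕ) : Measure (Fin k → ℝ) :=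
  (ProbabilityTheory.cond (sampleLaw μ (∑ i, p i))
    {x | ∀ i, (Finset.univ.filter fun j => x.2 j = i).card = p i}).map Prod.fst

/-- The Fourier transform `s ↦ ∫ exp(i s · y) dμ(y)` on `ℝ^k`. -/
def charFT {k : ℕ} (μ : Measure (Fin k → ℝ)) (s : Fin k → ℝ) : ℂ :=
  ∫ y, Complex.exp (Complex.I * ((∑ i, s i * y i : ℝ) : ℂ)) ∂μ

/-- The evaluation `F ↦ (s ↦ F(i s, 1, 1))`. -/
def evalAt {k : ℕ} (F : Pt k → ℂ) (s : Fin k → ℝ) : ℂ :=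
  F (fun i => Complex.I * (s i : ℂ), fun _ => 1, 1)

/-- The vector `α + p`. -/
def shiftBy {k : ℕ} (α : Fin k → ℝ) (p : Fin k → ℕ) : Fin k → ℝ := fun i => α i + p i

end DirichletHumbert

end

open MeasureTheory DirichletHumbert

/-!
In the homogeneous coordinates `b = (1 - |a|, a_1, …, a_k)` and with the signs
`σ = (-1, 1, …, 1)` and `e_0 = 0`, all the operators become instances of one formula: a traceless
matrix `X` acts by
`f_a ↦ -∑_{p,q} X_{pq} σ_p σ_q b_q f_{a + e_q - e_p}` (`matAct`).
That the differential operators act in this way is a set of contiguous relations for the Humbert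
function, which hold coefficient by coefficient in its everywhere absolutely convergent power
series (`humbertPhi_raise`, `humbertPhi_lower`, `humbertPhi_shift`). The length `|a|` is a positive
integer on `Λ⁺_α`, so a step can leave `Λ⁺_α` only from `|a| = 1`, where the coefficient `b_0`
vanishes (`mem_or_hcoord_eq_zero`); hence the formula respects commutators (`matAct_lie`).

At `s = 0`, `t = 1` and `u = exp y` the functions `f_a` are pairwise distinct characters of the
additive group `ℝ^k`, hence linearly independent (`linearIndependent_humbertFun`). So they form a
basis of `O_{Λ⁺_α}`, and statements about the representation are read off from the coordinates.
It is unique and its image is generated by the raising and lowering operators, over `ℂ` and over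
`ℝ`, because every traceless matrix is a combination of the `e_{0,i}`, the `f_{i,0}` and their
brackets (`sl_decomp`). It is faithful because all the `b_q` are nonzero at `a = α + e_i`
(`matRep_injective`), and a weight module because the weights `λ_a` are pairwise distinct
(`wt_injective`). The algebra `𝔯⁺` is abelian, so its enveloping algebra is a quotient of a
polynomial ring; monomials map `f_α` to nonzero multiples of the pairwise distinct `f_{α+p}`, which
gives existence and uniqueness of the element that maps `f_α` to `f_{α+p}`
(`envAct_radPlus_surj`, `envAct_radPlus_injective`).

For the Dirichlet distributions, the multivariate Beta integral is the product of Gamma integrals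
in the coordinates `(z, |x|)`, with Tonelli's theorem and a scaling (`lintegral_simplexKer_one`). It
makes the posterior of `Dir_α` the distribution `Dir_{α+p}` (`posterior_dirichlet`), and it gives
the moments, which are the coefficients of the Humbert function (`charFT_dirichlet`).

For the Weyl group, `𝔖_k` acts on `𝔥*` by permuting the diagonal entries `1, …, k`; a transposition
acts as a reflection (`permDual_swap_mem`). Since the roots `β_j` span `𝔥*`, an automorphism that
permutes them is one of these, and a subgroup of these of order `k!` is the whole group
(`existsUnique_subgroup`).
-/

noncomputable section

namespace DirichletHumbert

/-! ### Power series in several variables with entire absolute convergence -/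

/-- A family of coefficients, indexed by multi-indices, whose power series converges absolutely
on all of `ℂ^k`. -/
def AbsEntire {k : ℕ} (g : (Fin k → ℕ) → ℂ) : Prop :=
  ∀ r : ℝ, 0 ≤ r → Summable fun m => ‖g m‖ * r ^ (∑ i, m i)

/-- The monomial `s^m`. -/
def mon {k : ℕ} (s : Fin k → ℂ) (m : Fin k → ℕ) : ℂ := ∏ i, s i ^ m i

lemma norm_mon_le {k : ℕ} (s : Fin k → ℂ) (m : Fin k → ℕ) {r : ℝ} (hr : ∀ i, ‖s i‖ ≤ r) :
    ‖mon s m‖ ≤ r ^ ∑ i, m i := by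
  rw [mon, norm_prod, ← Finset.prod_pow_eq_pow_sum]
  refine Finset.prod_le_prod (fun _ _ => norm_nonneg _) fun i _ => ?_
  rw [norm_pow]
  exact pow_le_pow_left₀ (norm_nonneg _) (hr i) _

lemma norm_le_sum_norm {k : ℕ} (s : Fin k → ℂ) (i : Fin k) : ‖s i‖ ≤ ∑ j, ‖s j‖ :=
  Finset.single_le_sum (f := fun j => ‖s j‖) (fun _ _ => norm_nonneg _) (Finset.mem_univ i)

lemma AbsEntire.summable {k : ℕ} {g : (Fin k → ℕ) → ℂ} (hg : AbsEntire g) (s : Fin k → ℂ) :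
    Summable fun m => g m * mon s m := by
  have hr : 0 ≤ ∑ i, ‖s i‖ := Finset.sum_nonneg fun _ _ => norm_nonneg _
  refine Summable.of_norm_bounded (hg _ hr) fun m => ?_
  rw [norm_mul]
  exact mul_le_mul_of_nonneg_left
    (norm_mon_le s m (norm_le_sum_norm s)) (norm_nonneg _)

lemma AbsEntire.smul_degree {k : ℕ} {g h : (Fin k → ℕ) → ℂ} (hg : AbsEntire g)
    (hh : ∀ m, ‖h m‖ ≤ ‖g m‖ * ∑ i, (m i : ℝ)) : AbsEntire h := by
  intro r hr
  refine Summable.of_nonneg_of_le (fun m => by positivity) (fun m => ?_)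
    (hg (2 * r) (by positivity))
  rw [mul_pow, ← mul_assoc]
  refine mul_le_mul_of_nonneg_right ((hh m).trans ?_) (by positivity)
  refine mul_le_mul_of_nonneg_left ?_ (norm_nonneg _)
  have := (Nat.lt_two_pow_self (n := ∑ i, m i)).le
  calc (∑ i, (m i : ℝ)) = ((∑ i, m i : ℕ) : ℝ) := by push_cast; rfl
    _ ≤ ((2 ^ ∑ i, m i : ℕ) : ℝ) := by exact_mod_cast this
    _ = _ := by push_cast; rfl

/-- Adding one to the `i`-th entry of a multi-index. -/
def bump {k : ℕ} (i : Fin k) (m : Fin k → ℕ) : Fin k → ℕ := m + Pi.single i 1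

lemma bump_injective {k : ℕ} (i : Fin k) : Function.Injective (bump i) :=
  add_left_injective _

@[simp] lemma bump_same {k : ℕ} (i : Fin k) (m : Fin k → ℕ) : bump i m i = m i + 1 := by
  simp [bump]

@[simp] lemma bump_of_ne {k : ℕ} {i j : Fin k} (h : j ≠ i) (m : Fin k → ℕ) :
    bump i m j = m j := by
  simp [bump, h]

lemma sum_bump {k : ℕ} (i : Fin k) (m : Fin k → ℕ) : ∑ j, bump i m j = ∑ j, m j + 1 := by
  simp [bump, Finset.sum_add_distrib]

lemma prod_split {k : ℕ} (i : Fin k) (f : Fin k → ℂ) :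
    ∏ j, f j = f i * ∏ j ∈ Finset.univ.erase i, f j :=
  (Finset.mul_prod_erase _ _ (Finset.mem_univ i)).symm

lemma mon_bump {k : ℕ} (i : Fin k) (s : Fin k → ℂ) (m : Fin k → ℕ) :
    mon s (bump i m) = s i * mon s m := by
  rw [mon, mon, prod_split i, prod_split i (fun j => s j ^ m j), bump_same, pow_succ',
    mul_assoc, Finset.prod_congr rfl fun j hj => by rw [bump_of_ne (Finset.ne_of_mem_erase hj)]]

lemma mem_range_bump {k : ℕ} {i : Fin k} {m : Fin k → ℕ} (h : m i ≠ 0) :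
    m ∈ Set.range (bump i) := by
  refine ⟨m - Pi.single i 1, funext fun j => ?_⟩
  by_cases hj : j = i
  · subst hj; simp [bump]; omega
  · simp [bump, hj]

/-- Multiplication of a power series by `s_i` shifts its coefficients. -/
lemma mul_tsum_eq {k : ℕ} (i : Fin k) (s : Fin k → ℂ) {g h : (Fin k → ℕ) → ℂ}
    (h0 : ∀ m, m i = 0 → h m = 0) (h1 : ∀ m, h (bump i m) = g m) :
    s i * ∑' m, g m * mon s m = ∑' m, h m * mon s m := by
  rw [← tsum_mul_left, ← (bump_injective i).tsum_eq (f := fun m => h m * mon s m)]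
  · refine tsum_congr fun m => ?_
    rw [h1, mon_bump]; ring
  · intro m hm
    refine mem_range_bump fun hi => hm ?_
    simp only [h0 m hi, zero_mul]

/-- Termwise differentiation of an entire power series in one of the variables. -/
lemma AbsEntire.hasDerivAt {k : ℕ} {g : (Fin k → ℕ) → ℂ} (hg : AbsEntire g) (s : Fin k → ℂ)
    (i : Fin k) :
    HasDerivAt (fun z => ∑' m, g m * mon (Function.update s i z) m)
      (∑' m, ((m i + 1 : ℂ) * g (bump i m)) * mon s m) (s i) := by
  set r : ℝ := ∑ j, ‖s j‖ + 1 with hr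
  have hr0 : 0 ≤ ∑ j, ‖s j‖ := Finset.sum_nonneg fun _ _ => norm_nonneg _
  have hr1 : 1 ≤ r := by linarith
  have hsr : ∀ j, ‖s j‖ ≤ r := fun j => (norm_le_sum_norm s j).trans (by linarith)
  have hmon : ∀ z m, mon (Function.update s i z) m =
      z ^ m i * ∏ j ∈ Finset.univ.erase i, s j ^ m j := fun z m => by
    rw [mon, prod_split i, Function.update_self]
    congr 1
    exact Finset.prod_congr rfl fun j hj => by
      rw [Function.update_of_ne (Finset.ne_of_mem_erase hj)]
  have hdeg : AbsEntire fun m => g m * ∑ i, (m i : ℂ) := hg.smul_degree fun m => by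
    rw [norm_mul]
    refine mul_le_mul_of_nonneg_left ((norm_sum_le _ _).trans ?_) (norm_nonneg _)
    simp
  have key := hasDerivAt_tsum_of_isPreconnected (𝕜 := ℂ) (F := ℂ)
    (g := fun m z => g m * mon (Function.update s i z) m)
    (g' := fun m z => g m * ((m i : ℂ) * z ^ (m i - 1) * ∏ j ∈ Finset.univ.erase i, s j ^ m j))
    (hdeg r (by linarith)) (Metric.isOpen_ball (x := (0 : ℂ)) (ε := r))
    (convex_ball _ _).isPreconnected (fun m y _ => by
      simp only [hmon]
      exact ((hasDerivAt_pow (m i) y).mul_const _).const_mul _)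
    (fun m y hy => by
      have hy' : ‖y‖ ≤ r := (mem_ball_zero_iff.1 hy).le
      rw [norm_mul, norm_mul (g m), mul_assoc (‖g m‖)]
      refine mul_le_mul_of_nonneg_left ?_ (norm_nonneg _)
      rw [mul_assoc, norm_mul]
      have e1 : ‖(m i : ℂ)‖ ≤ ‖∑ i, (m i : ℂ)‖ := by
        rw [← Nat.cast_sum, Complex.norm_natCast, Complex.norm_natCast]
        exact_mod_cast Finset.single_le_sum (f := fun i => m i) (fun _ _ => Nat.zero_le _)
          (Finset.mem_univ i)
      refine mul_le_mul e1 ?_ (norm_nonneg _) (norm_nonneg _)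
      rw [norm_mul, norm_prod, norm_pow, ← Finset.add_sum_erase _ _ (Finset.mem_univ i), pow_add,
        ← Finset.prod_pow_eq_pow_sum]
      refine mul_le_mul ?_ (Finset.prod_le_prod (fun _ _ => norm_nonneg _) fun j _ => ?_)
        (Finset.prod_nonneg fun _ _ => norm_nonneg _) (by positivity)
      · exact (pow_le_pow_left₀ (norm_nonneg _) hy' _).trans
          (pow_le_pow_right₀ hr1 (Nat.sub_le _ _))
      · rw [norm_pow]; exact pow_le_pow_left₀ (norm_nonneg _) (hsr j) _)
    (y₀ := s i) (y := s i)
    (by rw [mem_ball_zero_iff]; linarith [norm_le_sum_norm s i])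
    (hg.summable _) (by rw [mem_ball_zero_iff]; linarith [norm_le_sum_norm s i])
  refine key.congr_deriv ?_
  rw [← (bump_injective i).tsum_eq]
  · refine tsum_congr fun m => ?_
    rw [bump_same, mon, prod_split i, Nat.add_sub_cancel, Nat.cast_add, Nat.cast_one,
      Finset.prod_congr rfl fun j hj => by rw [bump_of_ne (Finset.ne_of_mem_erase hj) m]]
    ring
  · intro m hm
    refine mem_range_bump fun h => hm ?_
    simp [h]

/-! ### The Humbert function and its contiguous relations -/

lemma poch_succ_left (z : ℂ) (n : ℕ) :
    (ascPochhammer ℂ (n + 1)).eval z = z * (ascPochhammer ℂ n).eval (z + 1) := by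
  simp [ascPochhammer_succ_left, Polynomial.eval_comp]

lemma poch_add_one (z : ℂ) (n : ℕ) :
    (ascPochhammer ℂ n).eval z * (z + n) = z * (ascPochhammer ℂ n).eval (z + 1) := by
  rw [← ascPochhammer_succ_eval, poch_succ_left]

lemma norm_poch_le (z : ℂ) (n : ℕ) :
    ‖(ascPochhammer ℂ n).eval z‖ ≤ n.factorial * (1 + ‖z‖) ^ n := by
  induction n with
  | zero => simp
  | succ n ih =>
    rw [ascPochhammer_succ_eval, norm_mul, Nat.factorial_succ, pow_succ]
    have h : ‖z + n‖ ≤ (n + 1) * (1 + ‖z‖) := by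
      refine (norm_add_le _ _).trans ?_
      rw [Complex.norm_natCast]
      nlinarith [norm_nonneg z, (Nat.cast_nonneg n : (0 : ℝ) ≤ n)]
    push_cast
    calc _ ≤ (n.factorial * (1 + ‖z‖) ^ n) * ((n + 1) * (1 + ‖z‖)) :=
          mul_le_mul ih h (norm_nonneg _) (by positivity)
      _ = _ := by ring

lemma factorial_le_norm_poch {z : ℂ} (hz : 1 ≤ z.re) (n : ℕ) :
    (n.factorial : ℝ) ≤ ‖(ascPochhammer ℂ n).eval z‖ := by
  induction n with
  | zero => simp
  | succ n ih =>
    rw [ascPochhammer_succ_eval, norm_mul, Nat.factorial_succ, mul_comm, Nat.cast_mul]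
    refine mul_le_mul ih ?_ (by positivity) (norm_nonneg _)
    refine le_trans ?_ (Complex.re_le_norm _)
    simp only [Complex.add_re, Complex.natCast_re]
    push_cast; linarith

lemma poch_ne_zero {z : ℂ} (hz : 1 ≤ z.re) (n : ℕ) : (ascPochhammer ℂ n).eval z ≠ 0 := by
  have := factorial_le_norm_poch hz n
  rw [← norm_pos_iff]
  exact lt_of_lt_of_le (by exact_mod_cast n.factorial_pos) this

/-- A sum of products over multi-indices of summable nonnegative families is summable. -/
lemma summable_prod_pi {k : ℕ} (f : Fin k → ℕ → ℝ) (h0 : ∀ i n, 0 ≤ f i n)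
    (h : ∀ i, Summable (f i)) : Summable fun m : Fin k → ℕ => ∏ i, f i (m i) := by
  induction k with
  | zero => exact Summable.of_finite
  | succ k ih =>
    rw [← (Fin.consEquiv fun _ : Fin (k + 1) => ℕ).summable_iff]
    have := Summable.mul_of_nonneg (h 0) (ih (fun i => f i.succ) (fun i => h0 _) fun i => h _)
      (h0 0) (fun m => Finset.prod_nonneg fun i _ => h0 _ _)
    refine this.congr fun x => ?_
    simp [Fin.prod_univ_succ, Fin.consEquiv]

/-- The coefficient `(a)_m / ((|a|)_{|m|} m!)` of the Humbert function. -/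
def humbertCoef {k : ℕ} (a : Fin k → ℂ) (m : Fin k → ℕ) : ℂ :=
  (∏ i, (ascPochhammer ℂ (m i)).eval (a i) / ((m i).factorial : ℂ)) /
    (ascPochhammer ℂ (∑ i, m i)).eval (∑ i, a i)

lemma humbertPhi_eq {k : ℕ} (a s : Fin k → ℂ) :
    humbertPhi a s = ∑' m, humbertCoef a m * mon s m := by
  refine tsum_congr fun m => ?_
  rw [humbertCoef, mon, div_mul_eq_mul_div, ← Finset.prod_mul_distrib]
  congr 1
  exact Finset.prod_congr rfl fun i _ => by ring

lemma absEntire_humbertCoef {k : ℕ} {a : Fin k → ℂ} (ha : 1 ≤ (∑ i, a i).re) :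
    AbsEntire (humbertCoef a) := by
  intro r hr
  refine Summable.of_nonneg_of_le (fun m => by positivity) (fun m => ?_)
    (summable_prod_pi (fun i n => ((1 + ‖a i‖) * r) ^ n / n.factorial) (fun i n => by positivity)
      fun i => Real.summable_pow_div_factorial _)
  have hden : (∏ i, ((m i).factorial : ℝ)) ≤ ‖(ascPochhammer ℂ (∑ i, m i)).eval (∑ i, a i)‖ := by
    refine le_trans ?_ (factorial_le_norm_poch ha _)
    exact_mod_cast Nat.le_of_dvd (Nat.factorial_pos _) (Nat.prod_factorial_dvd_factorial_sum _ _)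
  rw [humbertCoef, norm_div, norm_prod, ← Finset.prod_pow_eq_pow_sum, div_mul_eq_mul_div,
    ← Finset.prod_mul_distrib, Finset.prod_div_distrib]
  refine div_le_div₀ (Finset.prod_nonneg fun _ _ => by positivity)
    (Finset.prod_le_prod (fun _ _ => by positivity) fun i _ => ?_)
    (Finset.prod_pos fun i _ => by exact_mod_cast (m i).factorial_pos) hden
  rw [mul_pow, norm_div, Complex.norm_natCast]
  refine mul_le_mul_of_nonneg_right ?_ (by positivity)
  rw [div_le_iff₀ (by exact_mod_cast (m i).factorial_pos), mul_comm]
  exact norm_poch_le _ _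

/-- The standard unit vector of `ℂ^k`. -/
abbrev cvec {k : ℕ} (i : Fin k) : Fin k → ℂ := Pi.single i 1

lemma sum_add_cvec {k : ℕ} (a : Fin k → ℂ) (i : Fin k) :
    ∑ j, (a + cvec i) j = ∑ j, a j + 1 := by
  simp [Finset.sum_add_distrib]

lemma sum_sub_cvec {k : ℕ} (a : Fin k → ℂ) (i : Fin k) :
    ∑ j, (a - cvec i) j = ∑ j, a j - 1 := by
  simp [Finset.sum_sub_distrib]

lemma prod_poch_congr {k : ℕ} {i : Fin k} {a b : Fin k → ℂ} {m n : Fin k → ℕ}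
    (hab : ∀ j, j ≠ i → a j = b j) (hmn : ∀ j, j ≠ i → m j = n j) :
    (∏ j ∈ Finset.univ.erase i, (ascPochhammer ℂ (m j)).eval (a j) / ((m j).factorial : ℂ)) =
    ∏ j ∈ Finset.univ.erase i, (ascPochhammer ℂ (n j)).eval (b j) / ((n j).factorial : ℂ) :=
  Finset.prod_congr rfl fun j hj => by
    rw [hab j (Finset.ne_of_mem_erase hj), hmn j (Finset.ne_of_mem_erase hj)]

lemma add_cvec_of_ne {k : ℕ} (a : Fin k → ℂ) {i j : Fin k} (h : j ≠ i) :
    (a + cvec i) j = a j := by simp [h]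

lemma sub_cvec_of_ne {k : ℕ} (a : Fin k → ℂ) {i j : Fin k} (h : j ≠ i) :
    (a - cvec i) j = a j := by simp [h]

lemma ne_zero_of_one_le_re {z : ℂ} (h : 1 ≤ z.re) : z ≠ 0 := by
  rintro rfl; simp at h; linarith

/-- The recursion of the coefficients that underlies `∂_i Φ[a] = (a_i / |a|) Φ[a + e_i]`. -/
lemma humbertCoef_bump {k : ℕ} {a : Fin k → ℂ} (ha : 1 ≤ (∑ i, a i).re) (i : Fin k)
    (m : Fin k → ℕ) :
    (m i + 1 : ℂ) * humbertCoef a (bump i m) =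
      a i / (∑ j, a j) * humbertCoef (a + cvec i) m := by
  have hA := ne_zero_of_one_le_re ha
  have hP := poch_ne_zero (z := ∑ j, a j + 1)
    (by simp only [Complex.add_re, Complex.one_re]; linarith) (∑ j, m j)
  have hf : ((m i).factorial : ℂ) ≠ 0 := by exact_mod_cast (m i).factorial_ne_zero
  have hm : (m i + 1 : ℂ) ≠ 0 := by exact_mod_cast (m i).succ_ne_zero
  rw [humbertCoef, humbertCoef, prod_split i, prod_split i (fun j => _ / _),
    prod_poch_congr (fun j hj => (add_cvec_of_ne a hj).symm) (fun j hj => bump_of_ne hj m),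
    sum_bump, sum_add_cvec, bump_same, poch_succ_left, poch_succ_left, Nat.factorial_succ]
  simp only [Pi.add_apply, Pi.single_eq_same, Nat.cast_mul, Nat.cast_add, Nat.cast_one]
  field_simp

lemma humbertCoef_raise {k : ℕ} {a : Fin k → ℂ} (ha : 1 ≤ (∑ i, a i).re) (i : Fin k)
    (m : Fin k → ℕ) :
    (a i + m i) * humbertCoef a m =
      a i / (∑ j, a j) * (∑ j, a j + ∑ j, (m j : ℂ)) * humbertCoef (a + cvec i) m := by
  have hA := ne_zero_of_one_le_re ha
  have hP := poch_ne_zero ha (∑ j, m j)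
  have hP' := poch_ne_zero (z := ∑ j, a j + 1)
    (by simp only [Complex.add_re, Complex.one_re]; linarith) (∑ j, m j)
  have hf : ((m i).factorial : ℂ) ≠ 0 := by exact_mod_cast (m i).factorial_ne_zero
  rw [humbertCoef, humbertCoef, prod_split i, prod_split i (fun j => _ / _),
    prod_poch_congr (fun j hj => (add_cvec_of_ne a hj).symm) (fun j hj => rfl), sum_add_cvec]
  set P : ℂ := ∏ j ∈ Finset.univ.erase i,
    (ascPochhammer ℂ (m j)).eval ((a + cvec i) j) / ((m j).factorial : ℂ)
  clear_value P
  simp only [Pi.add_apply, Pi.single_eq_same]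
  have e1 := poch_add_one (a i) (m i)
  have e2 := poch_add_one (∑ j, a j) (∑ j, m j)
  push_cast at e2
  field_simp
  linear_combination P * (∑ j, a j) * (ascPochhammer ℂ (∑ j, m j)).eval (∑ j, a j + 1) * e1 -
    P * a i * (ascPochhammer ℂ (m i)).eval (a i + 1) * e2

lemma humbertCoef_lower_zero {k : ℕ} {a : Fin k → ℂ} (ha : 2 ≤ (∑ i, a i).re) {i : Fin k}
    {m : Fin k → ℕ} (hm : m i = 0) :
    -((∑ j, a j - 1 + ∑ j, (m j : ℂ)) * humbertCoef a m) =
      (1 - ∑ j, a j) * humbertCoef (a - cvec i) m := by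
  have hP := poch_ne_zero (z := ∑ j, a j) (by linarith) (∑ j, m j)
  have hP' := poch_ne_zero (z := ∑ j, a j - 1)
    (by simp only [Complex.sub_re, Complex.one_re]; linarith) (∑ j, m j)
  rw [humbertCoef, humbertCoef, prod_split i, prod_split i (fun j => _ / _),
    prod_poch_congr (fun j hj => (sub_cvec_of_ne a hj).symm) (fun j hj => rfl), sum_sub_cvec, hm]
  set P : ℂ := ∏ j ∈ Finset.univ.erase i,
    (ascPochhammer ℂ (m j)).eval ((a - cvec i) j) / ((m j).factorial : ℂ)
  clear_value P
  have e2 := poch_add_one (∑ j, a j - 1) (∑ j, m j)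
  rw [sub_add_cancel] at e2
  push_cast at e2
  simp only [ascPochhammer_zero, Polynomial.eval_one]
  field_simp
  linear_combination - P * e2

lemma humbertCoef_lower_bump {k : ℕ} {a : Fin k → ℂ} (ha : 2 ≤ (∑ i, a i).re) (i : Fin k)
    (m : Fin k → ℕ) :
    humbertCoef a m - (∑ j, a j - 1 + ∑ j, (bump i m j : ℂ)) * humbertCoef a (bump i m) =
      (1 - ∑ j, a j) * humbertCoef (a - cvec i) (bump i m) := by
  have hP := poch_ne_zero (z := ∑ j, a j) (by linarith) (∑ j, m j)
  have hA : (∑ j, a j - 1) ≠ 0 := ne_zero_of_one_le_re (by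
    simp only [Complex.sub_re, Complex.one_re]; linarith)
  have hf : ((m i).factorial : ℂ) ≠ 0 := by exact_mod_cast (m i).factorial_ne_zero
  have hm : (m i + 1 : ℂ) ≠ 0 := by exact_mod_cast (m i).succ_ne_zero
  have hAm : (∑ j, a j + (∑ j, m j : ℕ)) ≠ 0 := ne_zero_of_one_le_re (by
    simp only [Complex.add_re, Complex.natCast_re]
    linarith [(Nat.cast_nonneg (∑ j, m j) : (0 : ℝ) ≤ _)])
  have e3 : (∑ j, (bump i m j : ℂ)) = ((∑ j, m j : ℕ) : ℂ) + 1 := by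
    rw [← Nat.cast_sum, sum_bump]; push_cast; ring
  rw [e3, humbertCoef, humbertCoef, humbertCoef, prod_split i,
    prod_split i (fun j => (ascPochhammer ℂ (bump i m j)).eval (a j) / _),
    prod_split i (fun j => (ascPochhammer ℂ (bump i m j)).eval ((a - cvec i) j) / _),
    prod_poch_congr (i := i) (a := a) (m := bump i m) (fun j hj => rfl)
      (fun j hj => bump_of_ne hj m),
    prod_poch_congr (i := i) (a := a - cvec i) (m := bump i m)
      (fun j hj => sub_cvec_of_ne a hj) (fun j hj => bump_of_ne hj m),
    sum_sub_cvec, bump_same, sum_bump, poch_succ_left (∑ j, a j - 1), sub_add_cancel,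
    ascPochhammer_succ_eval _ (∑ j, a j), ascPochhammer_succ_eval _ (a i), Nat.factorial_succ]
  set P : ℂ := ∏ j ∈ Finset.univ.erase i,
    (ascPochhammer ℂ (m j)).eval (a j) / ((m j).factorial : ℂ)
  clear_value P
  simp only [Pi.sub_apply, Pi.single_eq_same, poch_succ_left, sub_add_cancel, Nat.cast_mul,
    Nat.cast_add, Nat.cast_one]
  field_simp
  ring

/-- Differentiating the series shifts its coefficients, which amounts to raising the parameter:
`∂_i Φ[a] = (a_i / |a|) Φ[a + e_i]`. -/
lemma hasDerivAt_humbertPhi {k : ℕ} {a : Fin k → ℂ} (ha : 1 ≤ (∑ i, a i).re) (s : Fin k → ℂ)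
    (i : Fin k) :
    HasDerivAt (fun z => humbertPhi a (Function.update s i z))
      (a i / (∑ j, a j) * humbertPhi (a + cvec i) s) (s i) := by
  simp only [humbertPhi_eq]
  refine ((absEntire_humbertCoef ha).hasDerivAt s i).congr_deriv ?_
  symm
  rw [← tsum_mul_left]
  refine tsum_congr fun m => ?_
  rw [humbertCoef_bump ha, mul_assoc]

/-- The Euler operator `s_i ∂_i` multiplies the `m`-th coefficient by `m_i`. -/
lemma euler_humbertPhi {k : ℕ} {a : Fin k → ℂ} (ha : 1 ≤ (∑ i, a i).re) (s : Fin k → ℂ)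
    (i : Fin k) :
    s i * (a i / (∑ j, a j) * humbertPhi (a + cvec i) s) =
      ∑' m, (m i * humbertCoef a m) * mon s m := by
  rw [humbertPhi_eq, ← tsum_mul_left]
  simp only [← mul_assoc (_ / _)]
  refine mul_tsum_eq i s (fun m hm => by simp [hm]) fun m => ?_
  rw [bump_same, ← humbertCoef_bump ha, Nat.cast_add, Nat.cast_one]

lemma absEntire_mul_humbertCoef {k : ℕ} {a : Fin k → ℂ} (ha : 1 ≤ (∑ i, a i).re) (i : Fin k) :
    AbsEntire fun m => (m i : ℂ) * humbertCoef a m := by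
  refine (absEntire_humbertCoef ha).smul_degree fun m => ?_
  rw [norm_mul, mul_comm, Complex.norm_natCast]
  exact mul_le_mul_of_nonneg_left
    (Finset.single_le_sum (f := fun i => (m i : ℝ)) (fun _ _ => Nat.cast_nonneg _)
      (Finset.mem_univ i)) (norm_nonneg _)

lemma euler_sum_humbertPhi {k : ℕ} {a : Fin k → ℂ} (ha : 1 ≤ (∑ i, a i).re) (s : Fin k → ℂ) :
    ∑ i, s i * (a i / (∑ j, a j) * humbertPhi (a + cvec i) s) =
      ∑' m, ((∑ j, (m j : ℂ)) * humbertCoef a m) * mon s m := by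
  simp only [euler_humbertPhi ha]
  rw [← Summable.tsum_finsetSum fun i _ => (absEntire_mul_humbertCoef ha i).summable s]
  refine tsum_congr fun m => ?_
  simp only [Finset.sum_mul]

lemma absEntire_sum_mul_humbertCoef {k : ℕ} {a : Fin k → ℂ} (ha : 1 ≤ (∑ i, a i).re) :
    AbsEntire fun m => (∑ j, (m j : ℂ)) * humbertCoef a m := by
  refine (absEntire_humbertCoef ha).smul_degree fun m => ?_
  rw [norm_mul, mul_comm, ← Nat.cast_sum, Complex.norm_natCast]
  push_cast; rfl

/-- The contiguous relation behind the raising operators. Its left-hand side is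
`(s_i ∂_i + a_i - (s · ∇) ∂_i) Φ[a]`. -/
lemma humbertPhi_raise {k : ℕ} {a : Fin k → ℂ} (ha : 1 ≤ (∑ i, a i).re) (s : Fin k → ℂ)
    (i : Fin k) :
    s i * (a i / (∑ j, a j) * humbertPhi (a + cvec i) s) + a i * humbertPhi a s -
      a i / (∑ j, a j) * ∑ l, s l * ((a + cvec i) l / (∑ j, (a + cvec i) j) *
        humbertPhi (a + cvec i + cvec l) s) = a i * humbertPhi (a + cvec i) s := by
  have ha' : 1 ≤ (∑ j, (a + cvec i) j).re := by
    rw [sum_add_cvec]; simp only [Complex.add_re, Complex.one_re]; linarith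
  have hA := ne_zero_of_one_le_re ha
  rw [euler_humbertPhi ha, euler_sum_humbertPhi ha', humbertPhi_eq a, humbertPhi_eq (a + cvec i),
    ← tsum_mul_left, ← tsum_mul_left, ← tsum_mul_left, ← Summable.tsum_add, ← Summable.tsum_sub]
  · refine tsum_congr fun m => ?_
    have := humbertCoef_raise ha i m
    have h2 : a i * humbertCoef (a + cvec i) m =
        a i / (∑ j, a j) * (∑ j, a j) * humbertCoef (a + cvec i) m := by
      rw [div_mul_cancel₀ _ hA]
    linear_combination mon s m * (this - h2)
  · exact (((absEntire_mul_humbertCoef ha i).summable s).add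
      (((absEntire_humbertCoef ha).summable s).mul_left _))
  · exact ((absEntire_sum_mul_humbertCoef ha').summable s).mul_left _
  · exact (absEntire_mul_humbertCoef ha i).summable s
  · exact ((absEntire_humbertCoef ha).summable s).mul_left _

/-- The contiguous relation behind the lowering operators. Its left-hand side is
`(s_i - s · ∇ - |a| + 1) Φ[a]`. -/
lemma humbertPhi_lower {k : ℕ} {a : Fin k → ℂ} (ha : 2 ≤ (∑ i, a i).re) (s : Fin k → ℂ)
    (i : Fin k) :
    s i * humbertPhi a s - ∑ l, s l * (a l / (∑ j, a j) * humbertPhi (a + cvec l) s) -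
      (∑ j, a j) * humbertPhi a s + humbertPhi a s =
      (1 - ∑ j, a j) * humbertPhi (a - cvec i) s := by
  have ha1 : 1 ≤ (∑ j, a j).re := by linarith
  have ha' : 1 ≤ (∑ j, (a - cvec i) j).re := by
    rw [sum_sub_cvec]; simp only [Complex.sub_re, Complex.one_re]; linarith
  -- the coefficients of `s_i Φ[a]`, read off from the relation itself
  set h : (Fin k → ℕ) → ℂ := fun m =>
    (1 - ∑ j, a j) * humbertCoef (a - cvec i) m +
      (∑ j, a j - 1 + ∑ j, (m j : ℂ)) * humbertCoef a m with hh
  have key : s i * humbertPhi a s = ∑' m, h m * mon s m := by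
    rw [humbertPhi_eq]
    refine mul_tsum_eq i s (fun m hm => ?_) fun m => ?_
    · rw [hh]; dsimp only; rw [← humbertCoef_lower_zero ha hm]; ring
    · rw [hh]; dsimp only; rw [← humbertCoef_lower_bump ha i m]; ring
  have s1 := ((absEntire_humbertCoef ha').summable s).mul_left (1 - ∑ j, a j)
  have s2 := ((absEntire_humbertCoef ha1).summable s).mul_left (∑ j, a j - 1)
  have s3 := (absEntire_sum_mul_humbertCoef ha1).summable s
  have e : ∑' m, h m * mon s m = (1 - ∑ j, a j) * humbertPhi (a - cvec i) s +
      (∑ j, a j - 1) * humbertPhi a s +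
      ∑' m, ((∑ j, (m j : ℂ)) * humbertCoef a m) * mon s m := by
    rw [humbertPhi_eq, humbertPhi_eq, ← tsum_mul_left, ← tsum_mul_left, ← s1.tsum_add s2,
      ← (s1.add s2).tsum_add s3]
    refine tsum_congr fun m => ?_
    simp only [hh]; ring
  rw [key, e, euler_sum_humbertPhi ha1]
  ring

/-- The contiguous relation behind the operators `E_{i,-j}`: it follows from raising at `i` and
from lowering `Φ[a + e_i]` at `j`. -/
lemma humbertPhi_shift {k : ℕ} {a : Fin k → ℂ} (ha : 1 ≤ (∑ i, a i).re) (s : Fin k → ℂ)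
    (i j : Fin k) :
    (s i - s j) * (a i / (∑ l, a l) * humbertPhi (a + cvec i) s) + a i * humbertPhi a s =
      a i * humbertPhi (a + cvec i - cvec j) s := by
  have hA := ne_zero_of_one_le_re ha
  have h1 := humbertPhi_raise ha s i
  have h2 := humbertPhi_lower (a := a + cvec i) (by
    rw [sum_add_cvec]; simp only [Complex.add_re, Complex.one_re]; linarith) s j
  have h3 : a i / (∑ l, a l) * (∑ l, a l) = a i := div_mul_cancel₀ _ hA
  rw [sum_add_cvec] at h1 h2
  linear_combination h1 - a i / (∑ l, a l) * h2 +
    (humbertPhi (a + cvec i - cvec j) s - humbertPhi (a + cvec i) s) * h3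

lemma humbertPhi_zero {k : ℕ} (a : Fin k → ℂ) : humbertPhi a 0 = 1 := by
  rw [humbertPhi_eq, tsum_eq_single 0]
  · simp [humbertCoef, mon]
  · intro m hm
    obtain ⟨i, hi⟩ := Function.ne_iff.1 hm
    rw [mon, Finset.prod_eq_zero (Finset.mem_univ i), mul_zero]
    simpa using hi

/-! ### The differential operators on the functions `f_a` -/

/-- The vector of complex numbers with the given real entries. -/
abbrev castVec {k : ℕ} (a : Fin k → ℝ) : Fin k → ℂ := fun i => (a i : ℂ)

/-- The standard unit vector of `ℝ^k`. -/
abbrev rvec {k : ℕ} (i : Fin k) : Fin k → ℝ := Pi.single i 1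

lemma castVec_add_rvec {k : ℕ} (a : Fin k → ℝ) (i : Fin k) :
    castVec (a + rvec i) = castVec a + cvec i := by
  funext j
  by_cases h : j = i
  · subst h; simp [castVec]
  · simp [castVec, h]

lemma castVec_sub_rvec {k : ℕ} (a : Fin k → ℝ) (i : Fin k) :
    castVec (a - rvec i) = castVec a - cvec i := by
  funext j
  by_cases h : j = i
  · subst h; simp [castVec]
  · simp [castVec, h]

lemma sum_add_rvec {k : ℕ} (a : Fin k → ℝ) (i : Fin k) :
    ∑ j, (a + rvec i) j = ∑ j, a j + 1 := by
  simp [Finset.sum_add_distrib]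

lemma sum_sub_rvec {k : ℕ} (a : Fin k → ℝ) (i : Fin k) :
    ∑ j, (a - rvec i) j = ∑ j, a j - 1 := by
  simp [Finset.sum_sub_distrib]

lemma re_sum_castVec {k : ℕ} (a : Fin k → ℝ) : (∑ i, castVec a i).re = ∑ i, a i := by
  simp [castVec]

lemma sum_castVec {k : ℕ} (a : Fin k → ℝ) : ∑ i, castVec a i = ((∑ i, a i : ℝ) : ℂ) := by
  simp [castVec]

/-- The factor `u^a t^|a|`. -/
def powFactor {k : ℕ} (a : Fin k → ℝ) (x : Pt k) : ℂ :=
  (∏ i, x.2.1 i ^ (a i : ℂ)) * x.2.2 ^ (((∑ i, a i : ℝ)) : ℂ)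

lemma humbertFun_apply {k : ℕ} (a : Fin k → ℝ) {x : Pt k} (hx : x ∈ humbertDom k) :
    humbertFun a x = humbertPhi (castVec a) x.1 * powFactor a x := by
  rw [humbertFun, Set.indicator_of_mem hx, powFactor, mul_assoc]

lemma humbertFun_of_notMem {k : ℕ} (a : Fin k → ℝ) {x : Pt k} (hx : x ∉ humbertDom k) :
    humbertFun a x = 0 := Set.indicator_of_notMem hx _

lemma powFactor_add {k : ℕ} (a : Fin k → ℝ) (i : Fin k) {x : Pt k} (hx : x ∈ humbertDom k) :
    powFactor (a + rvec i) x = x.2.1 i * x.2.2 * powFactor a x := by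
  rw [powFactor, powFactor, prod_split i, prod_split i (fun j => x.2.1 j ^ (a j : ℂ)),
    sum_add_rvec, Finset.prod_congr rfl fun j hj => by
      rw [show (a + rvec i) j = a j by simp [Finset.ne_of_mem_erase hj]]]
  simp only [Pi.add_apply, Pi.single_eq_same, Complex.ofReal_add, Complex.ofReal_one]
  rw [Complex.cpow_add _ _ (Complex.slitPlane_ne_zero (hx.1 i)),
    Complex.cpow_add _ _ (Complex.slitPlane_ne_zero hx.2), Complex.cpow_one, Complex.cpow_one]
  ring

lemma powFactor_sub {k : ℕ} (a : Fin k → ℝ) (i : Fin k) {x : Pt k} (hx : x ∈ humbertDom k) :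
    powFactor (a - rvec i) x = (x.2.1 i * x.2.2)⁻¹ * powFactor a x := by
  have := powFactor_add (a - rvec i) i hx
  rw [sub_add_cancel] at this
  rw [this, inv_mul_cancel_left₀]
  exact mul_ne_zero (Complex.slitPlane_ne_zero (hx.1 i)) (Complex.slitPlane_ne_zero hx.2)

lemma dS_mul_powFactor {k : ℕ} {F : Pt k → ℂ} {Ψ : (Fin k → ℂ) → ℂ} {a : Fin k → ℝ} {x : Pt k}
    {d : ℂ} (i : Fin k) (hF : ∀ s, F (s, x.2) = Ψ s * powFactor a x)
    (hΨ : HasDerivAt (fun z => Ψ (Function.update x.1 i z)) d (x.1 i)) :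
    dS i F x = d * powFactor a x := by
  rw [dS, ← (hΨ.mul_const (powFactor a x)).deriv]
  exact congrArg (fun f => deriv f (x.1 i)) (funext fun z => hF _)

lemma dS_humbertFun {k : ℕ} {a : Fin k → ℝ} (ha : 1 ≤ ∑ i, a i) (i : Fin k) {x : Pt k}
    (hx : x ∈ humbertDom k) :
    dS i (humbertFun a) x =
      castVec a i / (∑ j, castVec a j) * humbertPhi (castVec a + cvec i) x.1 * powFactor a x :=
  dS_mul_powFactor i (fun _ => humbertFun_apply a (x := (_, x.2)) hx)
    (hasDerivAt_humbertPhi (by rwa [re_sum_castVec]) _ _)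

lemma dS_dS_humbertFun {k : ℕ} {a : Fin k → ℝ} (ha : 1 ≤ ∑ i, a i) (i l : Fin k) {x : Pt k}
    (hx : x ∈ humbertDom k) :
    dS l (dS i (humbertFun a)) x =
      castVec a i / (∑ j, castVec a j) * ((castVec a + cvec i) l / (∑ j, (castVec a + cvec i) j) *
        humbertPhi (castVec a + cvec i + cvec l) x.1) * powFactor a x := by
  refine dS_mul_powFactor (Ψ := fun s => castVec a i / (∑ j, castVec a j) *
    humbertPhi (castVec a + cvec i) s) l (fun s => dS_humbertFun ha i (x := (s, x.2)) hx) ?_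
  refine (hasDerivAt_humbertPhi ?_ _ _).const_mul _
  rw [← castVec_add_rvec, re_sum_castVec, sum_add_rvec]; linarith

lemma mul_dU_humbertFun {k : ℕ} (a : Fin k → ℝ) (i : Fin k) {x : Pt k} (hx : x ∈ humbertDom k) :
    x.2.1 i * dU i (humbertFun a) x = a i * humbertFun a x := by
  have h0 := Complex.slitPlane_ne_zero (hx.1 i)
  set R : ℂ := humbertPhi (castVec a) x.1 * (∏ j ∈ Finset.univ.erase i, x.2.1 j ^ (a j : ℂ)) *
    x.2.2 ^ (((∑ i, a i : ℝ)) : ℂ) with hR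
  have hev : ∀ z ∈ Complex.slitPlane,
      humbertFun a (x.1, Function.update x.2.1 i z, x.2.2) = R * z ^ (a i : ℂ) := fun z hz => by
    rw [humbertFun_apply, powFactor, prod_split i]
    · simp only [Function.update_self]
      rw [Finset.prod_congr rfl fun j hj => by
        rw [Function.update_of_ne (Finset.ne_of_mem_erase hj)], hR]
      ring
    · refine ⟨fun j => ?_, hx.2⟩
      by_cases h : j = i
      · subst h; simpa using hz
      · simpa [h] using hx.1 j
  have hd : HasDerivAt (fun z => humbertFun a (x.1, Function.update x.2.1 i z, x.2.2))
      (R * (a i * x.2.1 i ^ ((a i : ℂ) - 1))) (x.2.1 i) :=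
    ((hasDerivAt_id _).cpow_const (hx.1 i) |>.const_mul R).congr_deriv (by simp)
      |>.congr_of_eventuallyEq
      (Filter.eventually_of_mem (Complex.isOpen_slitPlane.mem_nhds (hx.1 i)) hev)
  rw [dU, hd.deriv, Complex.cpow_sub _ _ h0, Complex.cpow_one]
  have := hev _ (hx.1 i)
  rw [Function.update_eq_self] at this
  rw [show humbertFun a x = _ from this]
  field_simp

lemma mul_dT_humbertFun {k : ℕ} (a : Fin k → ℝ) {x : Pt k} (hx : x ∈ humbertDom k) :
    x.2.2 * dT (humbertFun a) x = ((∑ i, a i : ℝ) : ℂ) * humbertFun a x := by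
  have h0 := Complex.slitPlane_ne_zero hx.2
  set R : ℂ := humbertPhi (castVec a) x.1 * (∏ j, x.2.1 j ^ (a j : ℂ)) with hR
  have hev : ∀ z ∈ Complex.slitPlane,
      humbertFun a (x.1, x.2.1, z) = R * z ^ (((∑ i, a i : ℝ)) : ℂ) := fun z hz => by
    rw [humbertFun_apply _ (x := (x.1, x.2.1, z)) ⟨hx.1, hz⟩, powFactor, hR]; ring
  have hd : HasDerivAt (fun z => humbertFun a (x.1, x.2.1, z))
      (R * (((∑ i, a i : ℝ) : ℂ) * x.2.2 ^ (((∑ i, a i : ℝ) : ℂ) - 1))) x.2.2 :=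
    ((hasDerivAt_id _).cpow_const hx.2 |>.const_mul R).congr_deriv (by simp)
      |>.congr_of_eventuallyEq
      (Filter.eventually_of_mem (Complex.isOpen_slitPlane.mem_nhds hx.2) hev)
  rw [dT, hd.deriv, Complex.cpow_sub _ _ h0, Complex.cpow_one,
    show humbertFun a x = _ from hev _ hx.2]
  field_simp

lemma raiseOp_humbertFun {k : ℕ} {a : Fin k → ℝ} (ha : 1 ≤ ∑ i, a i) (i : Fin k) {x : Pt k}
    (hx : x ∈ humbertDom k) :
    raiseOp i (humbertFun a) x = a i * humbertFun (a + rvec i) x := by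
  have key := humbertPhi_raise (a := castVec a) (by rwa [re_sum_castVec]) x.1 i
  rw [Finset.mul_sum] at key
  simp only [raiseOp, dS_dS_humbertFun ha _ _ hx, dS_humbertFun ha _ hx, mul_dU_humbertFun a i hx,
    humbertFun_apply _ hx, powFactor_add a i hx, castVec_add_rvec]
  have hs : ∀ f : Fin k → ℂ, ∑ l, x.1 l * (castVec a i / (∑ j, castVec a j) * f l * powFactor a x) =
      (∑ l, castVec a i / (∑ j, castVec a j) * (x.1 l * f l)) * powFactor a x := fun f => by
    rw [Finset.sum_mul]; exact Finset.sum_congr rfl fun l _ => by ring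
  rw [hs]
  linear_combination x.2.1 i * x.2.2 * powFactor a x * key

lemma lowerOp_humbertFun {k : ℕ} {a : Fin k → ℝ} (ha : 2 ≤ ∑ i, a i) (i : Fin k) {x : Pt k}
    (hx : x ∈ humbertDom k) :
    lowerOp i (humbertFun a) x = (1 - (∑ j, a j : ℝ)) * humbertFun (a - rvec i) x := by
  have key := humbertPhi_lower (a := castVec a) (by rwa [re_sum_castVec]) x.1 i
  simp only [lowerOp, mul_dT_humbertFun a hx, dS_humbertFun (by linarith : 1 ≤ ∑ i, a i) _ hx,
    humbertFun_apply _ hx, powFactor_sub a i hx, castVec_sub_rvec]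
  simp only [← mul_assoc (x.1 _), ← Finset.sum_mul] at key ⊢
  rw [sum_castVec] at key ⊢
  linear_combination (x.2.1 i * x.2.2)⁻¹ * powFactor a x * key

lemma shiftOp_humbertFun {k : ℕ} {a : Fin k → ℝ} (ha : 1 ≤ ∑ i, a i) (i j : Fin k) {x : Pt k}
    (hx : x ∈ humbertDom k) :
    shiftOp i j (humbertFun a) x = a i * humbertFun (a + rvec i - rvec j) x := by
  have key := humbertPhi_shift (a := castVec a) (by rwa [re_sum_castVec]) x.1 i j
  have h0 := Complex.slitPlane_ne_zero hx.2
  simp only [shiftOp, dS_humbertFun ha _ hx, mul_dU_humbertFun a i hx,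
    humbertFun_apply _ hx, powFactor_sub _ _ hx, powFactor_add _ _ hx, castVec_sub_rvec,
    castVec_add_rvec]
  have h1 : x.2.2⁻¹ * x.2.2 = 1 := inv_mul_cancel₀ h0
  rw [mul_inv]
  linear_combination (x.2.1 i * (x.2.1 j)⁻¹) * powFactor a x * key -
    (x.2.1 i * (x.2.1 j)⁻¹) * powFactor a x * (castVec a i *
    humbertPhi (castVec a + cvec i - cvec j) x.1) * h1

lemma cartanOp_humbertFun {k : ℕ} (a : Fin k → ℝ) (i : Fin k) {x : Pt k}
    (hx : x ∈ humbertDom k) :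
    cartanOp i (humbertFun a) x = ((∑ j, a j : ℝ) + a i - 1) * humbertFun a x := by
  rw [cartanOp, mul_dT_humbertFun a hx, mul_dU_humbertFun a i hx]; ring

/-! ### Linear independence -/

/-- The character `y ↦ exp (a · y)` of the additive group `ℝ^k`. -/
def expChar {k : ℕ} (a : Fin k → ℝ) : Multiplicative (Fin k → ℝ) →* ℂ where
  toFun y := Complex.exp ((∑ i, a i * y.toAdd i : ℝ) : ℂ)
  map_one' := by simp
  map_mul' x y := by
    rw [← Complex.exp_add, ← Complex.ofReal_add, ← Finset.sum_add_distrib]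
    simp [mul_add]

lemma expChar_injective {k : ℕ} : Function.Injective (expChar (k := k)) := by
  intro a b h
  have key : ∀ (c : Fin k → ℝ) i,
      expChar c (Multiplicative.ofAdd (rvec i)) = ((Real.exp (c i) : ℝ) : ℂ) := fun c i => by
    simp only [expChar, MonoidHom.coe_mk, OneHom.coe_mk, toAdd_ofAdd, Pi.single_apply,
      mul_ite, mul_one, mul_zero, Finset.sum_ite_eq', Finset.mem_univ, if_true,
      Complex.ofReal_exp]
  funext i
  have := key a i
  rw [h, key b i] at this
  exact Real.exp_injective (Complex.ofReal_injective this.symm)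

/-- At `s = 0`, `u = exp y`, `t = 1`, the function `f_a` is the character `exp (a · y)`; the
characters of a group are linearly independent. -/
lemma linearIndependent_humbertFun {k : ℕ} :
    LinearIndependent ℂ (humbertFun (k := k)) := by
  let L : (Pt k → ℂ) →ₗ[ℂ] (Multiplicative (Fin k → ℝ) → ℂ) :=
    LinearMap.funLeft ℂ ℂ fun y => ((0, fun i => ((Real.exp (y.toAdd i) : ℝ) : ℂ), 1) : Pt k)
  refine LinearIndependent.of_comp L ?_
  have := (linearIndependent_monoidHom (Multiplicative (Fin k → ℝ)) ℂ).comp _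
    (expChar_injective (k := k))
  suffices h : L ∘ humbertFun = (fun f : Multiplicative (Fin k → ℝ) →* ℂ => (f : _ → ℂ)) ∘
      expChar by rw [h]; exact this
  funext a y
  have hx : ((0, fun i => ((Real.exp (y.toAdd i) : ℝ) : ℂ), 1) : Pt k) ∈ humbertDom k :=
    ⟨fun i => Complex.ofReal_mem_slitPlane.2 (Real.exp_pos _), Complex.one_mem_slitPlane⟩
  simp only [Function.comp_apply, L, LinearMap.funLeft_apply]
  rw [humbertFun_apply a hx, humbertPhi_zero, powFactor, Complex.one_cpow]
  simp only [expChar, MonoidHom.coe_mk, OneHom.coe_mk]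
  rw [one_mul, mul_one, Complex.ofReal_sum, Complex.exp_sum]
  refine Finset.prod_congr rfl fun i _ => ?_
  rw [Complex.cpow_def_of_ne_zero (by simp), Complex.ofReal_exp, ← Complex.ofReal_exp,
    ← Complex.ofReal_log (Real.exp_pos _).le, Real.log_exp]
  push_cast
  rw [mul_comm]

/-! ### The representation in coordinates -/

/-- The basis `(f_a)`, `a ∈ A`, of `O_A`. -/
def humbertBasis {k : ℕ} (A : Set (Fin k → ℝ)) : Module.Basis A ℂ (OSpan A) :=
  (Module.Basis.span (linearIndependent_humbertFun.comp ((↑) : A → Fin k → ℝ)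
    Subtype.val_injective)).map (LinearEquiv.ofEq _ _ (by
      rw [Set.range_comp, Subtype.range_coe, OSpan]))

lemma humbertBasis_val {k : ℕ} (A : Set (Fin k → ℝ)) (a : A) :
    (humbertBasis A a).val = humbertFun a.val := by
  simp [humbertBasis, Module.Basis.span_apply]

/-- The element `f_a` of a space with a basis `(f_a)`, `a ∈ Λ⁺_α`; its value is `0` when `a` is not
in `Λ⁺_α`. -/
def fVec {k : ℕ} {α : Fin k → ℝ} {V : Type} [AddCommGroup V] [Module ℂ V]
    (B : Module.Basis (posLattice α) ℂ V) (a : Fin k → ℝ) : V :=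
  open Classical in if h : a ∈ posLattice α then B ⟨a, h⟩ else 0

section Coordinates

variable {k : ℕ} {α : Fin k → ℝ} {V : Type} [AddCommGroup V] [Module ℂ V]
  (B : Module.Basis (posLattice α) ℂ V)

lemma fVec_of_mem {a : Fin k → ℝ} (h : a ∈ posLattice α) : fVec B a = B ⟨a, h⟩ := dif_pos h

lemma fVec_ne_zero {a : Fin k → ℝ} (h : a ∈ posLattice α) : fVec B a ≠ 0 := by
  rw [fVec_of_mem B h]; exact B.ne_zero _

lemma hom_ext_fVec {M : Type*} [AddCommGroup M] [Module ℂ M] {S T : V →ₗ[ℂ] M}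
    (h : ∀ a ∈ posLattice α, S (fVec B a) = T (fVec B a)) : S = T :=
  B.ext fun a => by rw [← fVec_of_mem B a.2]; exact h _ a.2

open Classical in
lemma coord_fVec {d : Fin k → ℝ} (hd : d ∈ posLattice α) (a : Fin k → ℝ) :
    B.coord ⟨d, hd⟩ (fVec B a) = if a = d then 1 else 0 := by
  by_cases ha : a ∈ posLattice α
  · rw [fVec_of_mem B ha, Module.Basis.coord_apply, Module.Basis.repr_self,
      Finsupp.single_apply]
    simp only [Subtype.mk.injEq]
  · rw [fVec, dif_neg ha, map_zero, if_neg]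
    rintro rfl; exact ha hd

end Coordinates

/-- The step of the lattice that belongs to the matrix index `p`: zero for `p = 0`, and the unit
vector `e_i` for `p = i`. -/
def stepVec {k : ℕ} : Fin (k + 1) → Fin k → ℝ := Fin.cons 0 rvec

@[simp] lemma stepVec_zero {k : ℕ} : stepVec (0 : Fin (k + 1)) = 0 := rfl

@[simp] lemma stepVec_succ {k : ℕ} (i : Fin k) : stepVec i.succ = rvec i := rfl

/-- The homogeneous coordinates `(1 - |a|, a_1, …, a_k)` of `a`. -/
def hcoord {k : ℕ} (a : Fin k → ℝ) : Fin (k + 1) → ℝ := Fin.cons (1 - ∑ i, a i) a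

@[simp] lemma hcoord_zero {k : ℕ} (a : Fin k → ℝ) : hcoord a 0 = 1 - ∑ i, a i := rfl

@[simp] lemma hcoord_succ {k : ℕ} (a : Fin k → ℝ) (i : Fin k) : hcoord a i.succ = a i := rfl

/-- The signs `(-1, 1, …, 1)`. -/
def hsign {k : ℕ} : Fin (k + 1) → ℂ := Fin.cons (-1) fun _ => 1

@[simp] lemma hsign_zero {k : ℕ} : hsign (0 : Fin (k + 1)) = -1 := rfl

@[simp] lemma hsign_succ {k : ℕ} (i : Fin k) : hsign i.succ = 1 := rfl

lemma hsign_mul_self {k : ℕ} (p : Fin (k + 1)) : hsign p * hsign p = 1 := by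
  cases p using Fin.cases <;> simp

lemma hsign_ne_zero {k : ℕ} (p : Fin (k + 1)) : hsign p ≠ 0 := by
  cases p using Fin.cases <;> simp

lemma hcoord_add_sub {k : ℕ} (a : Fin k → ℝ) (r s q : Fin (k + 1)) :
    hcoord (a + stepVec s - stepVec r) q =
      hcoord a q + (if s = q then 1 else 0) - (if r = q then 1 else 0) := by
  cases q using Fin.cases with
  | zero =>
    cases r using Fin.cases <;> cases s using Fin.cases <;>
      simp [Finset.sum_add_distrib, Finset.sum_sub_distrib, Fin.succ_ne_zero]
    ring
  | succ i =>
    cases r using Fin.cases <;> cases s using Fin.cases <;>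
      simp [(Fin.succ_ne_zero _).symm, Pi.single_apply, eq_comm]

lemma sum_add_sub {k : ℕ} (a : Fin k → ℝ) (r s : Fin (k + 1)) :
    ∑ j, (a + stepVec s - stepVec r) j =
      ∑ j, a j - (if s = 0 then 1 else 0) + (if r = 0 then 1 else 0) := by
  have := hcoord_add_sub a r s 0
  rw [hcoord_zero, hcoord_zero] at this
  linarith

lemma lattice_add_sub {k : ℕ} {α a : Fin k → ℝ} (ha : a ∈ lattice α) (r s : Fin (k + 1)) :
    a + stepVec s - stepVec r ∈ lattice α := by
  have hs : ∀ p : Fin (k + 1), ∃ n : Fin k → ℤ, ∀ i, stepVec p i = n i := fun p => by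
    cases p using Fin.cases with
    | zero => exact ⟨0, by simp⟩
    | succ i => exact ⟨Pi.single i 1, fun j => by
        by_cases h : j = i
        · subst h; simp
        · simp [h]⟩
  obtain ⟨n, hn⟩ := ha
  obtain ⟨m1, h1⟩ := hs s
  obtain ⟨m2, h2⟩ := hs r
  exact ⟨n + m1 - m2, fun i => by simp [hn i, h1 i, h2 i]; ring⟩

/-- On `Λ⁺_α` the length is a positive integer, hence at least one. -/
lemma exists_sum_eq {k : ℕ} {α a : Fin k → ℝ} (hsum : ∑ i, α i = 1) (ha : a ∈ posLattice α) :
    ∃ n : ℕ, ∑ i, a i = n + 1 := by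
  obtain ⟨⟨n, hn⟩, h⟩ := ha
  simp only [hn, Finset.sum_add_distrib, hsum] at h ⊢
  have h2 : (0 : ℤ) < 1 + ∑ i, n i := by exact_mod_cast h
  obtain ⟨m, hm⟩ := Int.eq_ofNat_of_zero_le (show 0 ≤ ∑ i, n i by omega)
  refine ⟨m, ?_⟩
  rw [← Int.cast_sum, hm]; push_cast; ring

lemma one_le_sum {k : ℕ} {α a : Fin k → ℝ} (hsum : ∑ i, α i = 1) (ha : a ∈ posLattice α) :
    1 ≤ ∑ i, a i := by
  obtain ⟨n, hn⟩ := exists_sum_eq hsum ha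
  rw [hn]; linarith [(Nat.cast_nonneg n : (0 : ℝ) ≤ n)]

lemma two_le_sum {k : ℕ} {α a : Fin k → ℝ} (hsum : ∑ i, α i = 1) (ha : a ∈ posLattice α)
    (h1 : ∑ i, a i ≠ 1) : 2 ≤ ∑ i, a i := by
  obtain ⟨n, hn⟩ := exists_sum_eq hsum ha
  rcases n with _ | n
  · simp at hn; exact absurd hn h1
  · rw [hn]; push_cast; linarith [(Nat.cast_nonneg n : (0 : ℝ) ≤ n)]

/-- A step can lead out of `Λ⁺_α` only from the layer of length one, where the coefficient
`1 - |a|` vanishes. -/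
lemma mem_or_hcoord_eq_zero {k : ℕ} {α a : Fin k → ℝ} (hsum : ∑ i, α i = 1)
    (ha : a ∈ posLattice α) (r s : Fin (k + 1)) :
    a + stepVec s - stepVec r ∈ posLattice α ∨ hcoord a s = 0 := by
  by_cases hs : s = 0
  · subst hs
    by_cases h1 : ∑ i, a i = 1
    · right; simp [h1]
    · left
      refine ⟨lattice_add_sub ha.1 r 0, ?_⟩
      rw [sum_add_sub]
      have := two_le_sum hsum ha h1
      split_ifs <;> linarith
  · left
    refine ⟨lattice_add_sub ha.1 r s, ?_⟩
    rw [sum_add_sub, if_neg hs]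
    have := one_le_sum hsum ha
    split_ifs <;> linarith

section MatrixAction

variable {k : ℕ} {α : Fin k → ℝ} {V : Type} [AddCommGroup V] [Module ℂ V]
  (B : Module.Basis (posLattice α) ℂ V)

/-- The action of a matrix `X`:
`f_a ↦ -∑_{p,q} X_{pq} σ_p σ_q b_q f_{a + e_q - e_p}`, where `b = (1 - |a|, a_1, …, a_k)`,
`σ = (-1, 1, …, 1)` and `e_0 = 0`. -/
def matAct :
    Matrix (Fin (k + 1)) (Fin (k + 1)) ℂ →ₗ[ℂ] Module.End ℂ V where
  toFun X := B.constr ℂ fun a =>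
    -∑ p, ∑ q, (X p q * (hsign p * hsign q * hcoord a.val q)) •
      fVec B (a.val + stepVec q - stepVec p)
  map_add' X Y := B.ext fun a => by
    simp only [LinearMap.add_apply, Module.Basis.constr_basis, Matrix.add_apply, add_mul, add_smul,
      Finset.sum_add_distrib, neg_add]
  map_smul' c X := B.ext fun a => by
    simp only [LinearMap.smul_apply, Module.Basis.constr_basis, Matrix.smul_apply, smul_neg,
      Finset.smul_sum, smul_smul, smul_eq_mul, mul_assoc, RingHom.id_apply]

lemma matAct_fVec {a : Fin k → ℝ} (ha : a ∈ posLattice α)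
    (X : Matrix (Fin (k + 1)) (Fin (k + 1)) ℂ) :
    matAct B X (fVec B a) = -∑ p, ∑ q, (X p q * (hsign p * hsign q * hcoord a q)) •
      fVec B (a + stepVec q - stepVec p) := by
  rw [fVec_of_mem B ha]
  exact B.constr_basis ℂ _ _

lemma matAct_single {a : Fin k → ℝ} (ha : a ∈ posLattice α) (p q : Fin (k + 1)) (x : ℂ) :
    matAct B (Matrix.single p q x) (fVec B a) =
      -(x * (hsign p * hsign q * hcoord a q)) • fVec B (a + stepVec q - stepVec p) := by
  rw [matAct_fVec B ha, Finset.sum_eq_single p, Finset.sum_eq_single q, Matrix.single_apply_same]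
  · rw [← neg_smul]
  · intro q' _ h
    simp [Matrix.single, h.symm]
  · simp
  · intro p' _ h
    refine Finset.sum_eq_zero fun q' _ => ?_
    simp [Matrix.single, h.symm]
  · simp

lemma matAct_single_single {a : Fin k → ℝ} (hsum : ∑ i, α i = 1)
    (ha : a ∈ posLattice α) (p q r s : Fin (k + 1)) (x y : ℂ) :
    matAct B (Matrix.single p q x) (matAct B (Matrix.single r s y) (fVec B a)) =
      (x * y * (hsign p * hsign q * (hsign r * hsign s)) * hcoord a s *
        (hcoord a q + (if s = q then 1 else 0) - (if r = q then 1 else 0))) •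
          fVec B (a + stepVec s - stepVec r + stepVec q - stepVec p) := by
  rw [matAct_single B ha, map_smul]
  rcases mem_or_hcoord_eq_zero hsum ha r s with h | h
  · rw [matAct_single B h, smul_smul, hcoord_add_sub]
    congr 1
    split_ifs <;> push_cast <;> ring
  · simp [h]

/-- The action respects commutators. For matrix units the products of the coefficients differ only
by the terms `δ`, in which one step changes the coordinate that the other one reads. -/
lemma matAct_lie (hsum : ∑ i, α i = 1)
    (X Y : Matrix (Fin (k + 1)) (Fin (k + 1)) ℂ) :
    matAct B (X * Y - Y * X) = matAct B X * matAct B Y - matAct B Y * matAct B X := by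
  induction X using Matrix.induction_on' with
  | h_zero => simp
  | h_add X X' h h' => simp only [add_mul, mul_add, add_sub_add_comm, map_add, h, h']
  | h_std_basis p q x =>
    induction Y using Matrix.induction_on' with
    | h_zero => simp
    | h_add Y Y' h h' => simp only [add_mul, mul_add, add_sub_add_comm, map_add, h, h']
    | h_std_basis r s y =>
      refine hom_ext_fVec B fun a ha => ?_
      rw [LinearMap.sub_apply, Module.End.mul_apply, Module.End.mul_apply,
        matAct_single_single B hsum ha, matAct_single_single B hsum ha, map_sub,
        LinearMap.sub_apply]
      have e : a + stepVec q - stepVec p + stepVec s - stepVec r =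
        a + stepVec s - stepVec r + stepVec q - stepVec p := by abel
      rw [e, ← sub_smul]
      have h3 : ((x * y * (hsign p * hsign q * (hsign r * hsign s)) * hcoord a s *
          (hcoord a q + (if s = q then 1 else 0) - (if r = q then 1 else 0))) -
          y * x * (hsign r * hsign s * (hsign p * hsign q)) * hcoord a q *
          (hcoord a s + (if q = s then 1 else 0) - (if p = s then 1 else 0)) : ℂ) =
          x * y * (hsign p * hsign q * (hsign r * hsign s)) *
          ((if p = s then 1 else 0) * hcoord a q - (if r = q then 1 else 0) * hcoord a s) := by
        by_cases h : s = q
        · subst h; ring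
        · rw [if_neg h, if_neg (Ne.symm h)]; ring
      rw [h3]
      by_cases h1 : q = r
      · subst h1
        have e2 : a + stepVec s - stepVec q + stepVec q - stepVec p =
          a + stepVec s - stepVec p := by abel
        have hq := hsign_mul_self q
        rw [Matrix.single_mul_single_same, matAct_single B ha, e2, if_pos rfl]
        by_cases h2 : s = p
        · subst h2
          have hs := hsign_mul_self s
          rw [Matrix.single_mul_single_same, matAct_single B ha, if_pos rfl]
          simp only [add_sub_cancel_right, ← sub_smul]
          congr 1
          linear_combination (x * y * (hcoord a s * (hsign s * hsign s)) * hq) -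
            (x * y * (hcoord a q * (hsign q * hsign q)) * hs)
        · rw [Matrix.single_mul_single_of_ne _ _ _ _ h2, map_zero, LinearMap.zero_apply, sub_zero,
            if_neg (Ne.symm h2)]
          congr 1
          linear_combination x * y * hcoord a s * hsign p * hsign s * hq
      · rw [Matrix.single_mul_single_of_ne _ _ _ _ h1, map_zero, LinearMap.zero_apply, zero_sub,
          if_neg (Ne.symm h1)]
        by_cases h2 : s = p
        · subst h2
          have hs := hsign_mul_self s
          have e2 : a + stepVec s - stepVec r + stepVec q - stepVec s =
            a + stepVec q - stepVec r := by abel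
          rw [Matrix.single_mul_single_same, matAct_single B ha, e2, if_pos rfl, ← neg_smul]
          congr 1
          linear_combination -x * y * hcoord a q * hsign r * hsign q * hs
        · rw [Matrix.single_mul_single_of_ne _ _ _ _ h2, if_neg (Ne.symm h2)]
          simp

/-- The representation of `𝔩` on a space with basis `(f_a)`, `a ∈ Λ⁺_α`, given by `matAct`. -/
def matRep (hsum : ∑ i, α i = 1) :
    SL k →ₗ⁅ℂ⁆ Module.End ℂ V where
  toFun X := matAct B X.val
  map_add' X Y := by rw [← map_add]; rfl
  map_smul' c X := by rw [RingHom.id_apply, ← map_smul]; rfl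
  map_lie' {X Y} := by
    rw [LieAlgebra.SpecialLinear.sl_bracket, matAct_lie B hsum]; rfl

lemma matRep_apply (hsum : ∑ i, α i = 1) (X : SL k) :
    matRep B hsum X = matAct B X.val := rfl

end MatrixAction

/-! ### Generators of `𝔰𝔩_{k+1}` -/

/-- Every traceless matrix is a combination of the `e_{0,i}`, the `f_{i,0}` and their brackets,
since `[e_{0,i}, f_{j,0}] = δ_{ij} E_{00} - E_{ji}`. -/
lemma sl_decomp {k : ℕ} {R : Type*} [CommRing R] (X : LieAlgebra.SpecialLinear.sl (Fin (k + 1)) R) :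
    X = ∑ i : Fin k, X.val 0 i.succ •
        LieAlgebra.SpecialLinear.single 0 i.succ (Fin.succ_ne_zero i).symm (1 : R) +
      ∑ i : Fin k, X.val i.succ 0 •
        LieAlgebra.SpecialLinear.single i.succ 0 (Fin.succ_ne_zero i) (1 : R) -
      ∑ i : Fin k, ∑ j : Fin k, X.val j.succ i.succ •
        ⁅LieAlgebra.SpecialLinear.single 0 i.succ (Fin.succ_ne_zero i).symm (1 : R),
          LieAlgebra.SpecialLinear.single j.succ 0 (Fin.succ_ne_zero j) (1 : R)⁆ := by
  have htr : X.val 0 0 + ∑ i : Fin k, X.val i.succ i.succ = 0 := by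
    rw [← Fin.sum_univ_succ (fun p => X.val p p)]
    exact X.2
  have hbr : ∀ i j : Fin k,
      (⁅LieAlgebra.SpecialLinear.single 0 i.succ (Fin.succ_ne_zero i).symm (1 : R),
        LieAlgebra.SpecialLinear.single j.succ 0 (Fin.succ_ne_zero j) (1 : R)⁆).val =
      (if i = j then Matrix.single 0 0 1 else 0) - Matrix.single j.succ i.succ (1 : R) := by
    intro i j
    rw [LieAlgebra.SpecialLinear.sl_bracket, LieAlgebra.SpecialLinear.val_single,
      LieAlgebra.SpecialLinear.val_single, Matrix.single_mul_single_same, mul_one]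
    congr 1
    by_cases h : i = j
    · subst h; rw [Matrix.single_mul_single_same, mul_one, if_pos rfl]
    · rw [Matrix.single_mul_single_of_ne _ _ _ _ (fun h' => h (Fin.succ_injective _ h')),
        if_neg h]
  apply Subtype.ext
  simp only [AddSubgroupClass.coe_sub, AddMemClass.coe_add, SetLike.val_smul,
    AddSubmonoidClass.coe_finsetSum, hbr, LieAlgebra.SpecialLinear.val_single]
  ext p q
  simp only [Matrix.add_apply, Matrix.sub_apply, Matrix.sum_apply, Matrix.smul_apply, smul_eq_mul]
  cases p using Fin.cases with
  | zero =>
    cases q using Fin.cases with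
    | zero =>
      simp [Matrix.single, Matrix.ite_apply]
      linear_combination htr
    | succ j => simp [Matrix.single, Matrix.ite_apply, eq_comm]
  | succ i =>
    cases q using Fin.cases with
    | zero => simp [Matrix.single, Matrix.ite_apply, (Fin.succ_ne_zero _).symm]
    | succ j =>
      simp [Matrix.single, Matrix.ite_apply, ite_and, (Fin.succ_ne_zero _).symm]

lemma lieSpan_generators {k : ℕ} {R : Type*} [CommRing R] :
    LieSubalgebra.lieSpan R (LieAlgebra.SpecialLinear.sl (Fin (k + 1)) R)
      (Set.range (fun i : Fin k =>
          LieAlgebra.SpecialLinear.single 0 i.succ (Fin.succ_ne_zero i).symm (1 : R)) ∪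
        Set.range (fun i : Fin k =>
          LieAlgebra.SpecialLinear.single i.succ 0 (Fin.succ_ne_zero i) (1 : R))) = ⊤ := by
  refine eq_top_iff.2 fun X _ => ?_
  rw [sl_decomp X]
  set S := LieSubalgebra.lieSpan R (LieAlgebra.SpecialLinear.sl (Fin (k + 1)) R)
      (Set.range (fun i : Fin k =>
          LieAlgebra.SpecialLinear.single 0 i.succ (Fin.succ_ne_zero i).symm (1 : R)) ∪
        Set.range (fun i : Fin k =>
          LieAlgebra.SpecialLinear.single i.succ 0 (Fin.succ_ne_zero i) (1 : R)))
  have he : ∀ i : Fin k, LieAlgebra.SpecialLinear.single 0 i.succ (Fin.succ_ne_zero i).symm (1 : R)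
      ∈ S := fun i => LieSubalgebra.subset_lieSpan (Or.inl ⟨i, rfl⟩)
  have hf : ∀ i : Fin k, LieAlgebra.SpecialLinear.single i.succ 0 (Fin.succ_ne_zero i) (1 : R)
      ∈ S := fun i => LieSubalgebra.subset_lieSpan (Or.inr ⟨i, rfl⟩)
  exact S.sub_mem (S.add_mem (S.sum_mem fun i _ => S.smul_mem _ (he i))
    (S.sum_mem fun i _ => S.smul_mem _ (hf i)))
    (S.sum_mem fun i _ => S.sum_mem fun j _ => S.smul_mem _ (S.lie_mem (he i) (hf j)))

/-- Representations that agree on the raising and on the lowering operators are equal. -/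
lemma rep_ext {k : ℕ} {L : Type*} [LieRing L] [LieAlgebra ℂ L] {ρ ρ' : SL k →ₗ⁅ℂ⁆ L}
    (he : ∀ i, ρ (e0 i) = ρ' (e0 i)) (hf : ∀ i, ρ (f0 i) = ρ' (f0 i)) : ρ = ρ' := by
  refine LieHom.ext fun X => ?_
  have hX := sl_decomp X
  change X = ∑ i, X.val 0 i.succ • e0 i + ∑ i, X.val i.succ 0 • f0 i -
    ∑ i, ∑ j, X.val j.succ i.succ • ⁅e0 i, f0 j⁆ at hX
  rw [hX]
  simp only [map_sub, map_add, map_sum, map_smul, LieHom.map_lie, he, hf]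

lemma lieSpan_eq_range {k : ℕ} {L : Type*} [LieRing L] [LieAlgebra ℂ L] (ρ : SL k →ₗ⁅ℂ⁆ L) :
    LieSubalgebra.lieSpan ℂ L
      (Set.range (fun i => ρ (e0 i)) ∪ Set.range (fun i => ρ (f0 i))) = ρ.range := by
  rw [LieHom.range_eq_map, ← lieSpan_generators, LieSubalgebra.map_lieSpan, Set.image_union,
    ← Set.range_comp, ← Set.range_comp]
  rfl

/-- The extension of scalars of traceless matrices. -/
def complexify {k : ℕ} (X : LieAlgebra.SpecialLinear.sl (Fin (k + 1)) ℝ) : SL k :=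
  ⟨X.val.map Complex.ofRealHom, by
    have h : X.val.trace = 0 := X.2
    change (X.val.map Complex.ofRealHom).trace = 0
    rw [← AddMonoidHom.map_trace, h, map_zero]⟩

/-- The real form of a complex representation. -/
def realRep {k : ℕ} {V : Type*} [AddCommGroup V] [Module ℂ V] (ρ : SL k →ₗ⁅ℂ⁆ Module.End ℂ V) :
    LieAlgebra.SpecialLinear.sl (Fin (k + 1)) ℝ →ₗ⁅ℝ⁆ Module.End ℂ V where
  toFun X := ρ (complexify X)
  map_add' X Y := by
    rw [← map_add]; congr 1; apply Subtype.ext; ext i j; simp [complexify]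
  map_smul' c X := by
    have : complexify (c • X) = (c : ℂ) • complexify X := by
      apply Subtype.ext; ext i j; simp [complexify]
    rw [this, map_smul]; rfl
  map_lie' {X Y} := by
    have : complexify ⁅X, Y⁆ = ⁅complexify X, complexify Y⁆ := by
      apply Subtype.ext
      rw [LieAlgebra.SpecialLinear.sl_bracket]
      simp only [complexify, LieAlgebra.SpecialLinear.sl_bracket]
      rw [Matrix.map_sub _ (map_sub _), Matrix.map_mul, Matrix.map_mul]
    rw [this, LieHom.map_lie]

lemma realRep_injective {k : ℕ} {V : Type*} [AddCommGroup V] [Module ℂ V]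
    {ρ : SL k →ₗ⁅ℂ⁆ Module.End ℂ V} (h : Function.Injective ρ) :
    Function.Injective (realRep ρ) := by
  intro X Y hXY
  have h1 := congrArg Subtype.val (h hXY)
  apply Subtype.ext
  ext i j
  have := congrFun (congrFun h1 i) j
  simpa [complexify] using this

lemma lieSpan_real_eq_range {k : ℕ} {V : Type*} [AddCommGroup V] [Module ℂ V]
    (ρ : SL k →ₗ⁅ℂ⁆ Module.End ℂ V) :
    LieSubalgebra.lieSpan ℝ (Module.End ℂ V)
      (Set.range (fun i => ρ (e0 i)) ∪ Set.range (fun i => ρ (f0 i))) = (realRep ρ).range := by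
  rw [LieHom.range_eq_map, ← lieSpan_generators, LieSubalgebra.map_lieSpan, Set.image_union,
    ← Set.range_comp, ← Set.range_comp]
  have h1 : ∀ p q (h : p ≠ q), complexify (LieAlgebra.SpecialLinear.single p q h (1 : ℝ)) =
      (LieAlgebra.SpecialLinear.single p q h 1 : SL k) := fun p q h => by
    apply Subtype.ext
    simp [complexify]
  congr 2
  · congr 1; funext i; exact congrArg ρ (h1 _ _ _).symm
  · congr 1; funext i; exact congrArg ρ (h1 _ _ _).symm

/-! ### Faithfulness, weights and invariant subspaces -/

section Module

variable {k : ℕ} {α : Fin k → ℝ} {V : Type} [AddCommGroup V] [Module ℂ V]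
  (B : Module.Basis (posLattice α) ℂ V)

lemma add_stepVec_inj {a : Fin k → ℝ} {p q p' q' : Fin (k + 1)} (hpq : p ≠ q)
    (h : a + stepVec q' - stepVec p' = a + stepVec q - stepVec p) : p' = p ∧ q' = q := by
  have h1 := hcoord_add_sub a p' q' q
  have h2 := hcoord_add_sub a p' q' p
  rw [h, hcoord_add_sub] at h1 h2
  rw [if_pos rfl, if_neg hpq] at h1
  rw [if_pos rfl, if_neg hpq.symm] at h2
  constructor
  · by_contra hne
    rw [if_neg hne] at h2
    split_ifs at h2 <;> linarith
  · by_contra hne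
    rw [if_neg hne] at h1
    split_ifs at h1 <;> linarith

lemma coord_matAct_offDiag {a : Fin k → ℝ} (ha : a ∈ posLattice α) {p q : Fin (k + 1)}
    (hpq : p ≠ q) (hd : a + stepVec q - stepVec p ∈ posLattice α)
    (X : Matrix (Fin (k + 1)) (Fin (k + 1)) ℂ) :
    B.coord ⟨_, hd⟩ (matAct B X (fVec B a)) = -(X p q * (hsign p * hsign q * hcoord a q)) := by
  rw [matAct_fVec B ha, map_neg]
  simp only [map_sum, map_smul, coord_fVec, smul_eq_mul]
  rw [Finset.sum_eq_single p, Finset.sum_eq_single q, if_pos rfl, mul_one]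
  · intro q' _ h
    rw [if_neg (fun h' => h (add_stepVec_inj hpq h').2), mul_zero]
  · simp
  · intro p' _ h
    refine Finset.sum_eq_zero fun q' _ => ?_
    rw [if_neg (fun h' => h (add_stepVec_inj hpq h').1), mul_zero]
  · simp

lemma matAct_diag {a : Fin k → ℝ} (ha : a ∈ posLattice α)
    {X : Matrix (Fin (k + 1)) (Fin (k + 1)) ℂ} (hX : ∀ p q, p ≠ q → X p q = 0) :
    matAct B X (fVec B a) = (-∑ p, X p p * hcoord a p) • fVec B a := by
  rw [matAct_fVec B ha, neg_smul, Finset.sum_smul]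
  congr 1
  refine Finset.sum_congr rfl fun p _ => ?_
  rw [Finset.sum_eq_single p, add_sub_cancel_right]
  · rw [hsign_mul_self, one_mul]
  · intro q _ h
    rw [hX p q h.symm, zero_mul, zero_smul]
  · simp

lemma posLattice_self (hsum : ∑ i, α i = 1) : α ∈ posLattice α :=
  ⟨⟨0, by simp⟩, by rw [hsum]; exact one_pos⟩

lemma nonempty_of_sum_eq_one {k : ℕ} {α : Fin k → ℝ} (hsum : ∑ i, α i = 1) : Nonempty (Fin k) := by
  by_contra h
  rw [not_nonempty_iff] at h
  simp at hsum

lemma step_mem {a : Fin k → ℝ} (ha : a ∈ posLattice α) (h2 : 2 ≤ ∑ i, a i) (r s : Fin (k + 1)) :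
    a + stepVec s - stepVec r ∈ posLattice α := by
  refine ⟨lattice_add_sub ha.1 r s, ?_⟩
  rw [sum_add_sub]
  split_ifs <;> linarith

/-- Faithfulness: where all the homogeneous coordinates are nonzero, the off-diagonal entries of a
matrix are read off from its action; a diagonal matrix that acts as zero is scalar, since the
homogeneous coordinates of the lattice points separate the diagonal entries. -/
lemma matRep_injective (hpos : ∀ i, 0 < α i) (hsum : ∑ i, α i = 1) :
    Function.Injective (matRep B hsum) := by
  obtain ⟨i₀⟩ := nonempty_of_sum_eq_one hsum
  -- at this point all the homogeneous coordinates are nonzero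
  set a : Fin k → ℝ := α + rvec i₀ with ha_def
  have hs2 : ∑ i, a i = 2 := by rw [sum_add_rvec, hsum]; norm_num
  have ha : a ∈ posLattice α := by
    refine ⟨?_, by rw [hs2]; norm_num⟩
    simpa using lattice_add_sub (posLattice_self hsum).1 0 i₀.succ
  have hc : ∀ q, (hcoord a q : ℂ) ≠ 0 := fun q => by
    rw [Complex.ofReal_ne_zero]
    cases q using Fin.cases with
    | zero => rw [hcoord_zero, hs2]; norm_num
    | succ i =>
      rw [hcoord_succ]
      have h1 := hpos i
      have h2 : 0 ≤ rvec i₀ i := by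
        by_cases h : i = i₀
        · subst h; simp
        · simp [h]
      exact (add_pos_of_pos_of_nonneg h1 h2).ne'
  refine (injective_iff_map_eq_zero _).2 fun X hX => ?_
  rw [matRep_apply] at hX
  have hoff : ∀ p q, p ≠ q → X.val p q = 0 := fun p q hpq => by
    have h := coord_matAct_offDiag B ha hpq (step_mem ha hs2.ge p q) X.val
    rw [hX, LinearMap.zero_apply, map_zero, eq_comm, neg_eq_zero] at h
    exact (mul_eq_zero.1 h).resolve_right
      (mul_ne_zero (mul_ne_zero (hsign_ne_zero p) (hsign_ne_zero q)) (hc q))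
  have hdiag : ∀ d ∈ posLattice α, ∑ p, X.val p p * hcoord d p = 0 := fun d hd => by
    have h := matAct_diag B hd hoff
    rw [hX, LinearMap.zero_apply] at h
    exact neg_eq_zero.1 ((smul_eq_zero.1 h.symm).resolve_right (fVec_ne_zero B hd))
  have heq : ∀ q, X.val q q = X.val 0 0 := fun q => by
    have h1 := hdiag _ (step_mem ha hs2.ge 0 q)
    have h2 := hdiag _ ha
    simp only [hcoord_add_sub, Complex.ofReal_sub, Complex.ofReal_add, mul_add, mul_sub,
      Finset.sum_add_distrib, Finset.sum_sub_distrib, h2] at h1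
    simp [apply_ite ((↑) : ℝ → ℂ)] at h1
    exact sub_eq_zero.1 h1
  have htr : ∑ p, X.val p p = 0 := X.2
  simp only [heq, Finset.sum_const, Finset.card_univ, Fintype.card_fin, nsmul_eq_mul] at htr
  have h00 := (mul_eq_zero.1 htr).resolve_left (by exact_mod_cast k.succ_ne_zero)
  apply Subtype.ext
  ext p q
  by_cases h : p = q
  · subst h; rw [heq, h00]; rfl
  · rw [hoff p q h]; rfl

lemma cartan_trace (H : cartan k) :
    H.val.val 0 0 = -∑ i : Fin k, H.val.val i.succ i.succ := by
  have htr : ∑ p, H.val.val p p = 0 := H.val.2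
  rw [Fin.sum_univ_succ] at htr
  exact eq_neg_of_add_eq_zero_left htr

lemma matRep_cartan (hsum : ∑ i, α i = 1) {a : Fin k → ℝ} (ha : a ∈ posLattice α)
    (H : cartan k) : matRep B hsum H.val (fVec B a) = wt a H • fVec B a := by
  rw [matRep_apply, matAct_diag B ha H.2]
  congr 1
  change _ = -∑ i : Fin k, (((∑ j, a j) - 1 + a i : ℝ) : ℂ) * H.val.val i.succ i.succ
  rw [Fin.sum_univ_succ, cartan_trace H, hcoord_zero, neg_mul, Finset.sum_mul,
    ← Finset.sum_neg_distrib, ← Finset.sum_add_distrib]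
  congr 1
  refine Finset.sum_congr rfl fun i _ => ?_
  rw [hcoord_succ]
  push_cast
  ring

/-- `h_{0,i}` as an element of `𝔥`. -/
def cartanH (i : Fin k) : cartan k := ⟨h0 i, fun p q hpq => by
  simp only [h0, LieAlgebra.SpecialLinear.val_singleSubSingle, Matrix.sub_apply, Matrix.single,
    Matrix.of_apply]
  rw [if_neg (fun h => hpq (h.1.symm.trans h.2)), if_neg (fun h => hpq (h.1.symm.trans h.2)),
    sub_zero]⟩

lemma cartanH_succ (i j : Fin k) :
    (cartanH i).val.val j.succ j.succ = -(if i = j then 1 else 0) := by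
  simp [cartanH, h0, Matrix.single, (Fin.succ_ne_zero _).symm]

lemma wt_cartanH (a : Fin k → ℝ) (i : Fin k) :
    wt a (cartanH i) = (((∑ j, a j) - 1 + a i : ℝ) : ℂ) := by
  change -∑ j : Fin k, (((∑ j, a j) - 1 + a j : ℝ) : ℂ) * (cartanH i).val.val j.succ j.succ = _
  simp only [cartanH_succ]
  simp

/-- The weights `λ_a` are pairwise distinct: summing `|a| - 1 + a_i` over `i` recovers `|a|`. -/
lemma wt_injective : Function.Injective (wt (k := k)) := by
  intro a b h
  have h1 : ∀ i, (∑ j, a j) - 1 + a i = (∑ j, b j) - 1 + b i := fun i => by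
    have := LinearMap.congr_fun h (cartanH i)
    rw [wt_cartanH, wt_cartanH] at this
    exact_mod_cast this
  have h2 := Finset.sum_congr rfl fun i (_ : i ∈ Finset.univ) => h1 i
  simp only [Finset.sum_add_distrib, Finset.sum_const, Finset.card_univ, Fintype.card_fin,
    nsmul_eq_mul] at h2
  have h3 : (∑ j, a j - ∑ j, b j) * (k + 1 : ℝ) = 0 := by linear_combination h2
  have h4 := sub_eq_zero.1
    ((mul_eq_zero.1 h3).resolve_right (by exact_mod_cast k.succ_ne_zero))
  funext i
  have := h1 i
  rw [h4] at this
  linarith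

lemma coord_matRep_cartan (hsum : ∑ i, α i = 1) (d : posLattice α) (H : cartan k) (v : V) :
    B.coord d (matRep B hsum H.val v) = wt d.val H * B.coord d v := by
  suffices h : B.coord d ∘ₗ matRep B hsum H.val = wt d.val H • B.coord d from
    LinearMap.congr_fun h v
  refine hom_ext_fVec B fun a ha => ?_
  rw [LinearMap.comp_apply, matRep_cartan B hsum ha, map_smul, LinearMap.smul_apply,
    smul_eq_mul, smul_eq_mul, coord_fVec B d.2]
  split_ifs with h
  · rw [h]
  · simp

lemma eq_wt_of_coord_ne_zero (hsum : ∑ i, α i = 1) {χ : Module.Dual ℂ (cartan k)} {v : V}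
    (hv : v ∈ wtSpace (matRep B hsum) χ) {d : posLattice α} (hd : B.coord d v ≠ 0) :
    χ = wt d.val := by
  refine LinearMap.ext fun H => ?_
  have h := coord_matRep_cartan B hsum d H v
  rw [hv H, map_smul, smul_eq_mul] at h
  exact mul_right_cancel₀ hd h

lemma wtSpace_wt (hsum : ∑ i, α i = 1) {a : Fin k → ℝ} (ha : a ∈ posLattice α) :
    wtSpace (matRep B hsum) (wt a) = Submodule.span ℂ {fVec B a} := by
  refine le_antisymm (fun v hv => ?_) ?_
  · rw [Submodule.mem_span_singleton]
    refine ⟨B.coord ⟨a, ha⟩ v, B.ext_elem fun d => ?_⟩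
    rw [map_smul, Finsupp.smul_apply, ← Module.Basis.coord_apply, coord_fVec B d.2]
    by_cases h : a = d.val
    · subst h; simp
    · rw [if_neg h, smul_zero, eq_comm]
      by_contra hne
      exact h (wt_injective (eq_wt_of_coord_ne_zero B hsum hv hne))
  · rw [Submodule.span_singleton_le_iff_mem]
    exact fun H => matRep_cartan B hsum ha H

/-- The weight spaces are simultaneous eigenspaces of commuting operators, hence independent, and
the basis vectors are weight vectors of pairwise distinct weights. -/
lemma isWeightModule_matRep (hsum : ∑ i, α i = 1) : IsWeightModule (matRep B hsum) := by
  refine ⟨?_, ?_, fun χ => ?_⟩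
  · have hcomm : ∀ H K : cartan k, Commute (matRep B hsum H.val) (matRep B hsum K.val) :=
      fun H K => hom_ext_fVec B fun a ha => by
        rw [Module.End.mul_apply, Module.End.mul_apply, matRep_cartan B hsum ha,
          matRep_cartan B hsum ha, map_smul, map_smul, matRep_cartan B hsum ha,
          matRep_cartan B hsum ha, smul_comm]
    have := Module.End.independent_iInf_maxGenEigenspace_of_forall_mapsTo
      (fun H : cartan k => matRep B hsum H.val)
      (fun H K φ => Module.End.mapsTo_maxGenEigenspace_of_comm (hcomm K H) φ)
    refine (this.comp (f := fun χ : Module.Dual ℂ (cartan k) => (χ : cartan k → ℂ))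
      DFunLike.coe_injective).mono fun χ v hv => ?_
    refine (Submodule.mem_iInf _).2 fun H => ?_
    exact Module.End.mem_maxGenEigenspace _ _ _ |>.2 ⟨1, by
      rw [pow_one, LinearMap.sub_apply, hv H]; simp⟩
  · refine eq_top_iff.2 ?_
    rw [← B.span_eq, Submodule.span_le]
    rintro _ ⟨a, rfl⟩
    refine (le_iSup (wtSpace (matRep B hsum)) (wt a.val)) ?_
    rw [wtSpace_wt B hsum a.2, fVec_of_mem B a.2]
    exact Submodule.mem_span_singleton_self _
  · by_cases h : wtSpace (matRep B hsum) χ = ⊥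
    · rw [h]; infer_instance
    · obtain ⟨v, hv, hv0⟩ := Submodule.exists_mem_ne_zero_of_ne_bot h
      have : ∃ d, B.coord d v ≠ 0 := by
        by_contra hd
        push Not at hd
        exact hv0 (B.ext_elem fun d => by simpa using hd d)
      obtain ⟨d, hd⟩ := this
      rw [eq_wt_of_coord_ne_zero B hsum hv hd, wtSpace_wt B hsum d.2]
      infer_instance

/-- The universal enveloping algebra is generated by the Lie algebra. -/
lemma adjoin_range_ι {L : Type*} [LieRing L] [LieAlgebra ℂ L] :
    Algebra.adjoin ℂ (Set.range (UniversalEnvelopingAlgebra.ι ℂ (L := L))) = ⊤ := by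
  set A := Algebra.adjoin ℂ (Set.range (UniversalEnvelopingAlgebra.ι ℂ (L := L)))
  let f : L →ₗ⁅ℂ⁆ A :=
    { toFun x := ⟨UniversalEnvelopingAlgebra.ι ℂ x, Algebra.subset_adjoin ⟨x, rfl⟩⟩
      map_add' x y := Subtype.ext (map_add _ x y)
      map_smul' c x := Subtype.ext (map_smul _ c x)
      map_lie' {x y} := Subtype.ext (LieHom.map_lie _ x y) }
  have h : A.val.comp (UniversalEnvelopingAlgebra.lift ℂ f) = AlgHom.id ℂ _ := by
    refine UniversalEnvelopingAlgebra.hom_ext ℂ (LieHom.ext fun x => ?_)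
    change ((UniversalEnvelopingAlgebra.lift ℂ f (UniversalEnvelopingAlgebra.ι ℂ x) : A) :
      UniversalEnvelopingAlgebra ℂ L) = _
    rw [UniversalEnvelopingAlgebra.lift_ι_apply]
    rfl
  refine eq_top_iff.2 fun x _ => ?_
  rw [← show A.val (UniversalEnvelopingAlgebra.lift ℂ f x) = x from AlgHom.congr_fun h x]
  exact (UniversalEnvelopingAlgebra.lift ℂ f x).2

lemma envAct_ι {V : Type} [AddCommGroup V] [Module ℂ V] (ρ : SL k →ₗ⁅ℂ⁆ Module.End ℂ V)
    (S : LieSubalgebra ℂ (SL k)) (x : S) :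
    envAct ρ S (UniversalEnvelopingAlgebra.ι ℂ x) = ρ x.val :=
  UniversalEnvelopingAlgebra.lift_ι_apply ℂ _ x

lemma envAct_mem {V : Type} [AddCommGroup V] [Module ℂ V] (ρ : SL k →ₗ⁅ℂ⁆ Module.End ℂ V)
    (S : LieSubalgebra ℂ (SL k)) {N : Submodule ℂ V} (h : ∀ x ∈ S, ∀ v ∈ N, ρ x v ∈ N)
    (u : UniversalEnvelopingAlgebra ℂ S) : ∀ v ∈ N, envAct ρ S u v ∈ N := by
  have hu : u ∈ Algebra.adjoin ℂ (Set.range (UniversalEnvelopingAlgebra.ι ℂ (L := S))) := by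
    rw [adjoin_range_ι]; trivial
  induction hu using Algebra.adjoin_induction with
  | mem _ hx =>
    obtain ⟨x, rfl⟩ := hx
    intro v hv
    rw [envAct_ι]
    exact h x.val x.2 v hv
  | algebraMap c =>
    intro v hv
    rw [AlgHom.commutes, Module.algebraMap_end_apply]
    exact N.smul_mem c hv
  | add x y _ _ hx hy =>
    intro v hv
    rw [map_add, LinearMap.add_apply]
    exact N.add_mem (hx v hv) (hy v hv)
  | mul x y _ _ hx hy =>
    intro v hv
    rw [map_mul, Module.End.mul_apply]
    exact hx _ (hy v hv)

/-- A matrix maps the span of the `f_a`, `a ∈ A`, into itself if its nonzero entries correspond to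
steps that do not lead from `A` to the rest of `Λ⁺_α`. -/
lemma matAct_mem_span {A : Set (Fin k → ℝ)} (hA : A ⊆ posLattice α)
    {X : Matrix (Fin (k + 1)) (Fin (k + 1)) ℂ}
    (hX : ∀ a ∈ A, ∀ p q, X p q = 0 ∨ (a + stepVec q - stepVec p ∈ posLattice α →
      a + stepVec q - stepVec p ∈ A)) :
    ∀ v ∈ Submodule.span ℂ (fVec B '' A), matAct B X v ∈ Submodule.span ℂ (fVec B '' A) := by
  intro v hv
  induction hv using Submodule.span_induction with
  | mem _ hx =>
    obtain ⟨a, ha, rfl⟩ := hx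
    rw [matAct_fVec B (hA ha)]
    refine Submodule.neg_mem _ (Submodule.sum_mem _ fun p _ => Submodule.sum_mem _ fun q _ => ?_)
    rcases hX a ha p q with h | h
    · simp [h]
    · refine Submodule.smul_mem _ _ ?_
      by_cases hm : a + stepVec q - stepVec p ∈ posLattice α
      · exact Submodule.subset_span ⟨_, h hm, rfl⟩
      · rw [fVec, dif_neg hm]; exact Submodule.zero_mem _
  | zero => simp
  | add x y _ _ hx hy => rw [map_add]; exact Submodule.add_mem _ hx hy
  | smul c x _ hx => rw [map_smul]; exact Submodule.smul_mem _ _ hx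

lemma envAct_subF_mem (hsum : ∑ i, α i = 1) (l : ℝ) (u : UniversalEnvelopingAlgebra ℂ (subF k)) :
    ∀ v ∈ Submodule.span ℂ (fVec B '' layer α l),
      envAct (matRep B hsum) (subF k) u v ∈ Submodule.span ℂ (fVec B '' layer α l) := by
  refine envAct_mem _ _ (fun X hX => ?_) u
  refine matAct_mem_span B (fun a ha => ha.1) fun a ha p q => ?_
  by_cases hp : p = 0
  · subst hp; exact Or.inl (hX q).1
  by_cases hq : q = 0
  · subst hq; exact Or.inl (hX p).2
  refine Or.inr fun h => ⟨h, ?_⟩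
  rw [sum_add_sub, if_neg hp, if_neg hq, ha.2, sub_zero, add_zero]

lemma envAct_cartan_mem (hsum : ∑ i, α i = 1) (u : UniversalEnvelopingAlgebra ℂ (cartan k)) :
    ∀ v ∈ Submodule.span ℂ (fVec B '' octant α),
      envAct (matRep B hsum) (cartan k) u v ∈ Submodule.span ℂ (fVec B '' octant α) := by
  refine envAct_mem _ _ (fun X hX => ?_) u
  refine matAct_mem_span B (fun a ha => ha.1) fun a ha p q => ?_
  by_cases hpq : p = q
  · subst hpq; right; rw [add_sub_cancel_right]; exact fun _ => ha
  · exact Or.inl (hX p q hpq)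

lemma envAct_radPlus_mem (hsum : ∑ i, α i = 1) (u : UniversalEnvelopingAlgebra ℂ (radPlus k)) :
    ∀ v ∈ Submodule.span ℂ (fVec B '' octant α),
      envAct (matRep B hsum) (radPlus k) u v ∈ Submodule.span ℂ (fVec B '' octant α) := by
  refine envAct_mem _ _ (fun X hX => ?_) u
  refine matAct_mem_span B (fun a ha => ha.1) fun a ha p q => ?_
  by_cases hp : p = 0
  · subst hp
    cases q using Fin.cases with
    | zero => exact Or.inl (hX 0 0 (Or.inr rfl))
    | succ i =>
      refine Or.inr fun h => ⟨h, fun j => ?_⟩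
      have := ha.2 j
      by_cases hj : j = i
      · subst hj; simp; linarith
      · simpa [hj] using this
  · exact Or.inl (hX p q (Or.inl hp))

end Module

/-! ### The enveloping algebra of `𝔯⁺` -/

/-- `e_{0,i}` as an element of `𝔯⁺`. -/
def radE {k : ℕ} (i : Fin k) : radPlus k := ⟨e0 i, fun p q h => by
  simp only [e0, LieAlgebra.SpecialLinear.val_single, Matrix.single, Matrix.of_apply]
  refine if_neg fun h' => ?_
  rcases h with h | h
  · exact h h'.1.symm
  · exact Fin.succ_ne_zero i (h'.2.trans h)⟩

lemma radPlus_eq_sum {k : ℕ} (x : radPlus k) : x = ∑ i, x.val.val 0 i.succ • radE i := by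
  apply Subtype.ext
  apply Subtype.ext
  simp only [AddSubmonoidClass.coe_finsetSum, SetLike.val_smul, radE, e0,
    LieAlgebra.SpecialLinear.val_single]
  ext p q
  simp only [Matrix.sum_apply, Matrix.smul_apply, smul_eq_mul]
  by_cases hp : p = 0
  · subst hp
    cases q using Fin.cases with
    | zero => rw [x.2 0 0 (Or.inr rfl)]; simp [Matrix.single]
    | succ j => simp [Matrix.single]
  · rw [x.2 p q (Or.inl hp)]
    simp [Matrix.single, Ne.symm hp]

lemma radPlus_lie {k : ℕ} (x y : radPlus k) : ⁅x, y⁆ = 0 := by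
  have h : ∀ x y : radPlus k, x.val.val * y.val.val = 0 := fun x y => by
    ext p q
    rw [Matrix.mul_apply]
    refine Finset.sum_eq_zero fun l _ => ?_
    by_cases hl : l = 0
    · rw [x.2 p l (Or.inr hl), zero_mul]
    · rw [y.2 l q (Or.inl hl), mul_zero]
  apply Subtype.ext
  apply Subtype.ext
  change x.val.val * y.val.val - y.val.val * x.val.val = 0
  rw [h, h, sub_zero]

/-- As `𝔯⁺` is abelian with basis `e_{0,1}, …, e_{0,k}`, its enveloping algebra is a quotient of
the polynomial ring in `k` variables. -/
lemma exists_polynomial_surjection (k : ℕ) :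
    ∃ Ψ : MvPolynomial (Fin k) ℂ →ₐ[ℂ] UniversalEnvelopingAlgebra ℂ (radPlus k),
      Function.Surjective Ψ ∧
        ∀ i, Ψ (MvPolynomial.X i) = UniversalEnvelopingAlgebra.ι ℂ (radE i) := by
  set U := UniversalEnvelopingAlgebra ℂ (radPlus k)
  have hcomm : ∀ u v : U, u * v = v * u := by
    have hιι : ∀ x y : radPlus k, UniversalEnvelopingAlgebra.ι ℂ x *
        UniversalEnvelopingAlgebra.ι ℂ y = UniversalEnvelopingAlgebra.ι ℂ y *
        UniversalEnvelopingAlgebra.ι ℂ x := fun x y => by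
      have h := (UniversalEnvelopingAlgebra.ι ℂ).map_lie x y
      rw [radPlus_lie, map_zero, LieRing.of_associative_ring_bracket] at h
      exact sub_eq_zero.1 h.symm
    intro u v
    have hu : u ∈ Algebra.adjoin ℂ
        (Set.range (UniversalEnvelopingAlgebra.ι ℂ (L := radPlus k))) := by
      rw [adjoin_range_ι]; trivial
    have hv : v ∈ Algebra.adjoin ℂ
        (Set.range (UniversalEnvelopingAlgebra.ι ℂ (L := radPlus k))) := by
      rw [adjoin_range_ι]; trivial
    exact Algebra.commute_of_mem_adjoin_of_forall_mem_commute hu (fun _ ⟨x, hx⟩ =>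
      (Algebra.commute_of_mem_adjoin_of_forall_mem_commute hv (fun _ ⟨y, hy⟩ => by
        rw [← hx, ← hy]; exact hιι x y)).symm) |>.symm
  let : CommRing U := { (inferInstance : Ring U) with mul_comm := hcomm }
  let Ψ : MvPolynomial (Fin k) ℂ →ₐ[ℂ] U :=
    MvPolynomial.aeval fun i => (UniversalEnvelopingAlgebra.ι ℂ (radE i) : U)
  have hX : ∀ i, Ψ (MvPolynomial.X i) = UniversalEnvelopingAlgebra.ι ℂ (radE i) :=
    fun i => MvPolynomial.aeval_X _ _
  refine ⟨Ψ, fun u => ?_, hX⟩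
  have hu : u ∈ Algebra.adjoin ℂ (Set.range (UniversalEnvelopingAlgebra.ι ℂ (L := radPlus k))) := by
    rw [adjoin_range_ι]; trivial
  change u ∈ Ψ.range
  refine (Algebra.adjoin_le ?_ : _ ≤ Ψ.range) hu
  rintro _ ⟨x, rfl⟩
  rw [radPlus_eq_sum x, map_sum]
  refine Subalgebra.sum_mem _ fun i _ => ?_
  rw [map_smul]
  exact Subalgebra.smul_mem _ (AlgHom.mem_range _ |>.2 ⟨_, hX i⟩) _

section Module

variable {k : ℕ} {α : Fin k → ℝ} {V : Type} [AddCommGroup V] [Module ℂ V]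
  (B : Module.Basis (posLattice α) ℂ V)

lemma shiftBy_mem_posLattice (hsum : ∑ i, α i = 1) (p : Fin k → ℕ) :
    shiftBy α p ∈ posLattice α := by
  refine ⟨⟨fun i => p i, fun i => by simp [shiftBy]⟩, ?_⟩
  simp only [shiftBy, Finset.sum_add_distrib, hsum]
  positivity

lemma octant_eq_range (hpos : ∀ i, 0 < α i) (hsum : ∑ i, α i = 1) :
    octant α = Set.range (shiftBy α) := by
  refine Set.Subset.antisymm ?_ ?_
  · rintro a ⟨⟨⟨n, hn⟩, -⟩, ha⟩
    -- as `α_i ≤ 1`, positivity of `α_i + n_i` excludes negative integers `n_i`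
    have h : ∀ i, 0 ≤ n i := fun i => by
      have h1 : α i ≤ 1 := hsum ▸ Finset.single_le_sum (fun i _ => (hpos i).le) (Finset.mem_univ i)
      have h2 := ha i
      rw [hn i] at h2
      have h3 : (-1 : ℝ) < n i := by linarith
      have h4 : (-1 : ℤ) < n i := by exact_mod_cast h3
      omega
    refine ⟨fun i => (n i).toNat, funext fun i => ?_⟩
    rw [shiftBy, hn i]
    congr 1
    exact_mod_cast Int.toNat_of_nonneg (h i)
  · rintro _ ⟨p, rfl⟩
    exact ⟨shiftBy_mem_posLattice hsum p, fun i => add_pos_of_pos_of_nonneg (hpos i)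
      (Nat.cast_nonneg _)⟩

lemma matRep_e0 (hsum : ∑ i, α i = 1) {a : Fin k → ℝ} (ha : a ∈ posLattice α) (i : Fin k) :
    matRep B hsum (e0 i) (fVec B a) = (a i : ℂ) • fVec B (a + rvec i) := by
  rw [matRep_apply, e0, LieAlgebra.SpecialLinear.val_single, matAct_single B ha]
  simp

/-- A monomial in the `e_{0,i}` with exponent `n` maps `f_{α+p}` to a nonzero multiple of
`f_{α+p+n}`: the coefficients `α_i + p_i` that arise do not vanish. -/
lemma envAct_monomial (hpos : ∀ i, 0 < α i) (hsum : ∑ i, α i = 1)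
    {Ψ : MvPolynomial (Fin k) ℂ →ₐ[ℂ] UniversalEnvelopingAlgebra ℂ (radPlus k)}
    (hΨ : ∀ i, Ψ (MvPolynomial.X i) = UniversalEnvelopingAlgebra.ι ℂ (radE i)) (n : Fin k →₀ ℕ)
    (p : Fin k → ℕ) :
    ∃ c : ℂ, c ≠ 0 ∧ envAct (matRep B hsum) (radPlus k) (Ψ (MvPolynomial.monomial n 1))
      (fVec B (shiftBy α p)) = c • fVec B (shiftBy α (p + n)) := by
  have hadd : ∀ n m : Fin k →₀ ℕ,
      (∀ p, ∃ c : ℂ, c ≠ 0 ∧ envAct (matRep B hsum) (radPlus k) (Ψ (MvPolynomial.monomial n 1))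
        (fVec B (shiftBy α p)) = c • fVec B (shiftBy α (p + n))) →
      (∀ p, ∃ c : ℂ, c ≠ 0 ∧ envAct (matRep B hsum) (radPlus k) (Ψ (MvPolynomial.monomial m 1))
        (fVec B (shiftBy α p)) = c • fVec B (shiftBy α (p + m))) →
      ∀ p, ∃ c : ℂ, c ≠ 0 ∧
        envAct (matRep B hsum) (radPlus k) (Ψ (MvPolynomial.monomial (n + m) 1))
        (fVec B (shiftBy α p)) = c • fVec B (shiftBy α (p + ⇑(n + m))) := by
    intro n m hn hm p
    obtain ⟨c, hc, h1⟩ := hm p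
    obtain ⟨d, hd, h2⟩ := hn (p + m)
    refine ⟨c * d, mul_ne_zero hc hd, ?_⟩
    rw [show (MvPolynomial.monomial (n + m) (1 : ℂ)) =
      MvPolynomial.monomial n 1 * MvPolynomial.monomial m 1 by
        rw [MvPolynomial.monomial_mul, one_mul], map_mul, map_mul, Module.End.mul_apply, h1,
      map_smul, h2, smul_smul, Finsupp.coe_add, add_comm (⇑n), add_assoc]
  have hzero : ∀ p, ∃ c : ℂ, c ≠ 0 ∧
      envAct (matRep B hsum) (radPlus k) (Ψ (MvPolynomial.monomial 0 1))
      (fVec B (shiftBy α p)) = c • fVec B (shiftBy α (p + ⇑(0 : Fin k →₀ ℕ))) := fun p =>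
    ⟨1, one_ne_zero, by
      rw [show MvPolynomial.monomial (0 : Fin k →₀ ℕ) (1 : ℂ) = 1 from rfl, map_one, map_one,
        Module.End.one_apply, one_smul, Finsupp.coe_zero, add_zero]⟩
  induction n using Finsupp.induction_linear generalizing p with
  | zero => exact hzero p
  | add n m hn hm => exact hadd n m hn hm p
  | single i r =>
    induction r generalizing p with
    | zero => rw [Finsupp.single_zero]; exact hzero p
    | succ r ih =>
      rw [Finsupp.single_add]
      refine hadd _ _ ih (fun p => ⟨(shiftBy α p i : ℂ), ?_, ?_⟩) p
      · exact Complex.ofReal_ne_zero.2 (add_pos_of_pos_of_nonneg (hpos i) (Nat.cast_nonneg _)).ne'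
      · change envAct (matRep B hsum) (radPlus k) (Ψ (MvPolynomial.X i)) _ = _
        rw [hΨ, envAct_ι]
        refine (matRep_e0 B hsum (shiftBy_mem_posLattice hsum p) i).trans ?_
        congr 2
        funext j
        by_cases h : j = i
        · subst h; simp [shiftBy, add_assoc]
        · simp [shiftBy, h]

lemma shiftBy_injective (α : Fin k → ℝ) : Function.Injective (shiftBy α) := fun p q h =>
  funext fun i => by
    have := congrFun h i
    simpa [shiftBy] using this

lemma envAct_radPlus_surj (hpos : ∀ i, 0 < α i) (hsum : ∑ i, α i = 1) (p : Fin k → ℕ) :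
    ∃ v : UniversalEnvelopingAlgebra ℂ (radPlus k),
      envAct (matRep B hsum) (radPlus k) v (fVec B α) = fVec B (shiftBy α p) := by
  obtain ⟨Ψ, -, hX⟩ := exists_polynomial_surjection k
  obtain ⟨c, hc, h⟩ := envAct_monomial B hpos hsum hX (Finsupp.equivFunOnFinite.symm p) 0
  have h0 : shiftBy α 0 = α := by funext i; simp [shiftBy]
  rw [h0, zero_add] at h
  refine ⟨c⁻¹ • Ψ (MvPolynomial.monomial (Finsupp.equivFunOnFinite.symm p) 1), ?_⟩
  rw [map_smul, LinearMap.smul_apply, h, smul_smul, inv_mul_cancel₀ hc, one_smul]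
  rfl

/-- An element of the enveloping algebra of `𝔯⁺` is determined by its value at `f_α`: different
monomials lead to multiples of different basis vectors. -/
lemma envAct_radPlus_injective (hpos : ∀ i, 0 < α i) (hsum : ∑ i, α i = 1)
    {v w : UniversalEnvelopingAlgebra ℂ (radPlus k)}
    (h : envAct (matRep B hsum) (radPlus k) v (fVec B α) =
      envAct (matRep B hsum) (radPlus k) w (fVec B α)) : v = w := by
  rw [← sub_eq_zero]
  rw [← sub_eq_zero, ← LinearMap.sub_apply, ← map_sub] at h
  generalize v - w = u at h ⊢
  obtain ⟨Ψ, hsurj, hX⟩ := exists_polynomial_surjection k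
  obtain ⟨P, rfl⟩ := hsurj u
  suffices hP : P = 0 by rw [hP, map_zero]
  have h0 : shiftBy α 0 = α := by funext i; simp [shiftBy]
  have hmon : ∀ n : Fin k →₀ ℕ, ∃ c : ℂ, c ≠ 0 ∧
      envAct (matRep B hsum) (radPlus k) (Ψ (MvPolynomial.monomial n 1)) (fVec B α) =
        c • fVec B (shiftBy α n) := fun n => by
    simpa only [h0, zero_add] using envAct_monomial B hpos hsum hX n 0
  choose c hc hcn using hmon
  have hP : envAct (matRep B hsum) (radPlus k) (Ψ P) (fVec B α) =
      ∑ n ∈ P.support, (P.coeff n * c n) • fVec B (shiftBy α n) := by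
    conv_lhs => rw [P.as_sum, map_sum, map_sum, LinearMap.sum_apply]
    refine Finset.sum_congr rfl fun n _ => ?_
    rw [show MvPolynomial.monomial n (P.coeff n) = P.coeff n • MvPolynomial.monomial n (1 : ℂ) by
      rw [MvPolynomial.smul_monomial, smul_eq_mul, mul_one], map_smul, map_smul,
      LinearMap.smul_apply, hcn, smul_smul]
  rw [hP] at h
  ext n
  rw [MvPolynomial.coeff_zero]
  have hn := congrArg (B.coord ⟨_, shiftBy_mem_posLattice hsum n⟩) h
  simp only [map_sum, map_smul, coord_fVec, map_zero, smul_eq_mul] at hn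
  by_contra hne
  rw [Finset.sum_eq_single n, if_pos rfl, mul_one] at hn
  · exact mul_ne_zero hne (hc n) hn
  · intro m _ hm
    rw [if_neg (fun h' => hm (DFunLike.coe_injective (shiftBy_injective α h'))), mul_zero]
  · intro hn'
    exact absurd (MvPolynomial.notMem_support_iff.1 hn') hne

end Module

/-! ### The Weyl group -/

section Weyl

variable {k : ℕ}

lemma cartan_ext {H K : cartan k}
    (h : ∀ i : Fin k, H.val.val i.succ i.succ = K.val.val i.succ i.succ) : H = K := by
  apply Subtype.ext
  apply Subtype.ext
  ext p q
  by_cases hpq : p = q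
  · subst hpq
    cases p using Fin.cases with
    | zero => rw [cartan_trace, cartan_trace]; simp only [h]
    | succ i => exact h i
  · rw [H.2 p q hpq, K.2 p q hpq]

/-- The permutation of the matrix indices `0, …, k` that fixes `0` and acts as `π` on the others. -/
def extendPerm (π : Equiv.Perm (Fin k)) : Equiv.Perm (Fin (k + 1)) :=
  Equiv.Perm.decomposeFin.symm (0, π)

lemma extendPerm_zero (π : Equiv.Perm (Fin k)) : extendPerm π 0 = 0 := by
  simp [extendPerm]

lemma extendPerm_succ (π : Equiv.Perm (Fin k)) (i : Fin k) :
    extendPerm π i.succ = (π i).succ := by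
  simp [extendPerm]

/-- The permutation `H_{jj} ↦ H_{π(j) π(j)}` of the diagonal entries of the elements of `𝔥`. -/
def permCartan (π : Equiv.Perm (Fin k)) : cartan k →ₗ[ℂ] cartan k where
  toFun H := ⟨⟨H.val.val.submatrix (extendPerm π) (extendPerm π), by
    have h : ∑ p, H.val.val p p = 0 := H.val.2
    change ∑ p, H.val.val (extendPerm π p) (extendPerm π p) = 0
    rw [Equiv.sum_comp (extendPerm π) fun p => H.val.val p p, h]⟩,
    fun p q hpq => H.2 _ _ ((extendPerm π).injective.ne hpq)⟩
  map_add' H K := rfl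
  map_smul' c H := rfl

lemma permCartan_zero (π : Equiv.Perm (Fin k)) (H : cartan k) :
    (permCartan π H).val.val 0 0 = H.val.val 0 0 := by
  change H.val.val (extendPerm π 0) (extendPerm π 0) = _
  rw [extendPerm_zero]

lemma permCartan_succ (π : Equiv.Perm (Fin k)) (H : cartan k) (i : Fin k) :
    (permCartan π H).val.val i.succ i.succ = H.val.val (π i).succ (π i).succ := by
  change H.val.val (extendPerm π i.succ) (extendPerm π i.succ) = _
  rw [extendPerm_succ]

lemma permCartan_mul (π τ : Equiv.Perm (Fin k)) :
    permCartan (π * τ) = permCartan τ ∘ₗ permCartan π :=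
  LinearMap.ext fun H => cartan_ext fun i => by
    rw [LinearMap.comp_apply, permCartan_succ, permCartan_succ, permCartan_succ]; rfl

lemma permCartan_one : permCartan (1 : Equiv.Perm (Fin k)) = LinearMap.id :=
  LinearMap.ext fun H => cartan_ext fun i => by rw [permCartan_succ]; rfl

/-- The action of `𝔖_k` on `𝔥*` that is dual to the permutation of the diagonal entries. -/
def permDual : Equiv.Perm (Fin k) →*
    (Module.Dual ℂ (cartan k) ≃ₗ[ℂ] Module.Dual ℂ (cartan k)) where
  toFun π := LinearEquiv.ofLinearMap (permCartan π).dualMap (permCartan π⁻¹).dualMap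
    (by rw [LinearMap.dualMap_comp_dualMap, ← permCartan_mul, mul_inv_cancel, permCartan_one,
      LinearMap.dualMap_id])
    (by rw [LinearMap.dualMap_comp_dualMap, ← permCartan_mul, inv_mul_cancel, permCartan_one,
      LinearMap.dualMap_id])
  map_one' := by
    ext χ H
    change χ (permCartan 1 H) = χ H
    rw [permCartan_one, LinearMap.id_apply]
  map_mul' π τ := by
    ext χ H
    change χ (permCartan (π * τ) H) = χ (permCartan τ (permCartan π H))
    rw [permCartan_mul, LinearMap.comp_apply]

lemma permDual_apply (π : Equiv.Perm (Fin k)) (χ : Module.Dual ℂ (cartan k)) (H : cartan k) :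
    permDual π χ H = χ (permCartan π H) := rfl

lemma permDual_rootPlus (π : Equiv.Perm (Fin k)) (j : Fin k) :
    permDual π (rootPlus j) = rootPlus (π j) := by
  refine LinearMap.ext fun H => ?_
  rw [permDual_apply]
  change (permCartan π H).val.val 0 0 - (permCartan π H).val.val j.succ j.succ = _
  rw [permCartan_zero, permCartan_succ]
  rfl

lemma permDual_wt (π : Equiv.Perm (Fin k)) (a : Fin k → ℝ) :
    permDual π (wt a) = wt fun i => a (π.symm i) := by
  refine LinearMap.ext fun H => ?_
  rw [permDual_apply]
  change -∑ i : Fin k, (((∑ j, a j) - 1 + a i : ℝ) : ℂ) * (permCartan π H).val.val i.succ i.succ =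
    -∑ i : Fin k, (((∑ j, a (π.symm j)) - 1 + a (π.symm i) : ℝ) : ℂ) * H.val.val i.succ i.succ
  rw [Equiv.sum_comp π.symm a, ← Equiv.sum_comp π (fun i =>
    (((∑ j, a j) - 1 + a (π.symm i) : ℝ) : ℂ) * H.val.val i.succ i.succ)]
  simp only [permCartan_succ, Equiv.symm_apply_apply]

lemma rootPlus_cartanH (i j : Fin k) :
    rootPlus j (cartanH i) = 1 + if i = j then 1 else 0 := by
  change (cartanH i).val.val 0 0 - (cartanH i).val.val j.succ j.succ = _
  rw [cartanH_succ, cartan_trace]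
  simp only [cartanH_succ]
  simp

lemma rootPlus_injective : Function.Injective (rootPlus (k := k)) := by
  intro i j h
  by_contra hij
  have := LinearMap.congr_fun h (cartanH i)
  rw [rootPlus_cartanH, rootPlus_cartanH, if_pos rfl, if_neg hij] at this
  norm_num at this

lemma cartan_eq_sum (H : cartan k) : H = -∑ i : Fin k, H.val.val i.succ i.succ • cartanH i := by
  refine cartan_ext fun j => ?_
  simp only [NegMemClass.coe_neg, AddSubmonoidClass.coe_finsetSum, SetLike.val_smul,
    Matrix.neg_apply, Matrix.sum_apply, Matrix.smul_apply, cartanH_succ]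
  simp

/-- The roots `β_j` span `𝔥*`: their sum is `k + 1` times the functional `H ↦ H_{00}`. -/
lemma span_rootPlus : Submodule.span ℂ (Set.range (rootPlus (k := k))) = ⊤ := by
  refine eq_top_iff.2 fun μ _ => ?_
  have hk : (k + 1 : ℂ) ≠ 0 := by exact_mod_cast k.succ_ne_zero
  have h : μ = ∑ i, μ (cartanH i) • (rootPlus i - (k + 1 : ℂ)⁻¹ • ∑ j, rootPlus j) := by
    refine LinearMap.ext fun H => ?_
    have hsum : ∑ j : Fin k, rootPlus j H = (k + 1) * H.val.val 0 0 := by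
      change ∑ j : Fin k, (H.val.val 0 0 - H.val.val j.succ j.succ) = _
      rw [Finset.sum_sub_distrib, cartan_trace]
      simp
      ring
    conv_lhs => rw [cartan_eq_sum H, map_neg, map_sum]
    rw [LinearMap.sum_apply, ← Finset.sum_neg_distrib]
    refine Finset.sum_congr rfl fun i _ => ?_
    rw [LinearMap.smul_apply, LinearMap.sub_apply, LinearMap.smul_apply, LinearMap.sum_apply, hsum,
      map_smul, smul_eq_mul, smul_eq_mul, smul_eq_mul, inv_mul_cancel_left₀ hk]
    change _ = μ (cartanH i) * (H.val.val 0 0 - H.val.val i.succ i.succ - H.val.val 0 0)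
    ring
  have hβ : ∀ j, rootPlus j ∈ Submodule.span ℂ (Set.range (rootPlus (k := k))) :=
    fun j => Submodule.subset_span ⟨j, rfl⟩
  rw [h]
  exact Submodule.sum_mem _ fun i _ => Submodule.smul_mem _ _
    (Submodule.sub_mem _ (hβ i) (Submodule.smul_mem _ _ (Submodule.sum_mem _ fun j _ => hβ j)))

/-- The transposition of `i` and `j` acts as the reflection in the root `β_i - β_j`, which is
the root of the matrix unit `E_{ji}`. -/
lemma permDual_swap_mem {i j : Fin k} (hij : i ≠ j) :
    permDual (Equiv.swap i j) ∈ weylGroup k := by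
  have hroot : ∀ (l m : Fin k) (h : l ≠ m) (H : cartan k),
      ⁅H.val, eij l m h⁆ = (H.val.val l.succ l.succ - H.val.val m.succ m.succ) • eij l m h := by
    intro l m h H
    apply Subtype.ext
    rw [LieAlgebra.SpecialLinear.sl_bracket]
    ext p q
    simp only [eij, LieAlgebra.SpecialLinear.val_single, Matrix.sub_apply, SetLike.val_smul,
      Matrix.smul_apply, smul_eq_mul]
    rw [Matrix.mul_apply, Matrix.mul_apply, Finset.sum_eq_single l.succ,
      Finset.sum_eq_single m.succ]
    · by_cases hp : l.succ = p <;> by_cases hq : m.succ = q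
      · subst hp; subst hq; simp
      · subst hp
        simp [Matrix.single, hq, H.2 _ _ hq]
      · subst hq
        simp [Matrix.single, hp, H.2 _ _ (Ne.symm hp)]
      · simp [Matrix.single, hp, hq]
    · intro r _ hr; simp [Matrix.single, hr.symm]
    · simp
    · intro r _ hr; simp [Matrix.single, hr.symm]
    · simp
  refine Subgroup.subset_closure ⟨rootPlus i - rootPlus j, cartanH i - cartanH j,
    eij j i hij.symm, eij i j hij, fun H => ?_, fun H => ?_, ?_, ?_, fun μ => ?_⟩
  · rw [hroot]
    congr 1
    change _ = H.val.val 0 0 - H.val.val i.succ i.succ - (H.val.val 0 0 - H.val.val j.succ j.succ)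
    ring
  · rw [hroot]
    congr 1
    change _ = -(H.val.val 0 0 - H.val.val i.succ i.succ -
      (H.val.val 0 0 - H.val.val j.succ j.succ))
    ring
  · apply Subtype.ext
    rw [LieAlgebra.SpecialLinear.sl_bracket]
    change Matrix.single j.succ i.succ 1 * Matrix.single i.succ j.succ 1 -
      Matrix.single i.succ j.succ 1 * Matrix.single j.succ i.succ 1 =
      (Matrix.single 0 0 1 - Matrix.single i.succ i.succ 1) -
      (Matrix.single 0 0 1 - Matrix.single j.succ j.succ (1 : ℂ))
    rw [Matrix.single_mul_single_same, Matrix.single_mul_single_same, mul_one]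
    abel
  · rw [LinearMap.sub_apply, map_sub, map_sub, rootPlus_cartanH, rootPlus_cartanH,
      rootPlus_cartanH, rootPlus_cartanH, if_pos rfl, if_pos rfl, if_neg hij, if_neg hij.symm]
    norm_num
  · refine LinearMap.ext fun K => ?_
    have hK : permCartan (Equiv.swap i j) K =
        K - (rootPlus i - rootPlus j) K • (cartanH i - cartanH j) := by
      refine cartan_ext fun l => ?_
      rw [permCartan_succ]
      change _ = K.val.val l.succ l.succ - (K.val.val 0 0 - K.val.val i.succ i.succ -
        (K.val.val 0 0 - K.val.val j.succ j.succ)) *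
        ((cartanH i).val.val l.succ l.succ - (cartanH j).val.val l.succ l.succ)
      rw [cartanH_succ, cartanH_succ]
      by_cases hi : i = l
      · subst hi
        rw [Equiv.swap_apply_left, if_pos rfl, if_neg hij.symm]; ring
      · by_cases hj : j = l
        · subst hj
          rw [Equiv.swap_apply_right, if_pos rfl, if_neg hij]; ring
        · rw [Equiv.swap_apply_of_ne_of_ne (Ne.symm hi) (Ne.symm hj), if_neg hi, if_neg hj]; ring
    rw [permDual_apply, hK, map_sub, map_smul, smul_eq_mul, mul_comm]
    rfl

lemma permDual_mem (π : Equiv.Perm (Fin k)) : permDual π ∈ weylGroup k := by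
  induction π using Equiv.Perm.swap_induction_on with
  | one => rw [map_one]; exact Subgroup.one_mem _
  | swap_mul f x y hxy hf => rw [map_mul]; exact Subgroup.mul_mem _ (permDual_swap_mem hxy) hf

lemma permDual_injective : Function.Injective (permDual (k := k)) := fun π τ h =>
  Equiv.ext fun j => rootPlus_injective (by rw [← permDual_rootPlus, h, permDual_rootPlus])

lemma permDual_image (π : Equiv.Perm (Fin k)) :
    permDual π '' Set.range rootPlus = Set.range rootPlus := by
  rw [← Set.range_comp, show (permDual π ∘ rootPlus) = rootPlus ∘ π from
    funext fun j => permDual_rootPlus π j, π.surjective.range_comp]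

/-- A linear automorphism that permutes the roots `β_j` comes from a permutation. -/
lemma mem_range_permDual {w : Module.Dual ℂ (cartan k) ≃ₗ[ℂ] Module.Dual ℂ (cartan k)}
    (hw : w '' Set.range rootPlus = Set.range rootPlus) : w ∈ (permDual (k := k)).range := by
  have h : ∀ j, ∃ l, rootPlus l = w (rootPlus j) := fun j => by
    have : w (rootPlus j) ∈ Set.range (rootPlus (k := k)) := hw ▸ ⟨_, ⟨j, rfl⟩, rfl⟩
    exact this
  choose f hf using h
  have hinj : Function.Injective f := fun i j hij => rootPlus_injective (w.injective (by
    rw [← hf, ← hf, hij]))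
  refine ⟨Equiv.ofBijective f (Finite.injective_iff_bijective.1 hinj), ?_⟩
  apply LinearEquiv.toLinearMap_injective
  refine LinearMap.ext_on_range span_rootPlus fun j => ?_
  exact (permDual_rootPlus _ j).trans (hf j)

lemma existsUnique_subgroup :
    ∃ G : Subgroup (Module.Dual ℂ (cartan k) ≃ₗ[ℂ] Module.Dual ℂ (cartan k)),
      (∀ G', (G' ≤ weylGroup k ∧ Nonempty (G' ≃* Equiv.Perm (Fin k)) ∧
        ∀ w ∈ G', w '' Set.range rootPlus = Set.range rootPlus) ↔ G' = G) ∧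
      Set.InjOn (wt (k := k)) (stdSimplex ℝ (Fin k)) ∧
      ∃ φ : Equiv.Perm (Fin k) ≃* G,
        (∀ π j, (φ π).val (rootPlus j) = rootPlus (π j)) ∧
        (∀ π, ∀ a ∈ stdSimplex ℝ (Fin k), (φ π).val (wt a) = wt (fun i => a (π.symm i))) := by
  refine ⟨permDual.range, fun G' => ⟨?_, ?_⟩, wt_injective.injOn,
    MonoidHom.ofInjective permDual_injective, fun π j => permDual_rootPlus π j,
    fun π a _ => permDual_wt π a⟩
  · rintro ⟨-, ⟨e⟩, hG'⟩
    have hle : G' ≤ permDual.range := fun w hw => mem_range_permDual (hG' w hw)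
    have e' := MonoidHom.ofInjective (permDual_injective (k := k))
    have : Finite (permDual (k := k)).range := Finite.of_equiv _ e'.toEquiv
    refine Subgroup.eq_of_le_of_card_ge hle ?_
    rw [Nat.card_congr e.toEquiv, Nat.card_congr e'.toEquiv]
  · rintro rfl
    refine ⟨?_, ⟨(MonoidHom.ofInjective permDual_injective).symm⟩, ?_⟩
    · rintro _ ⟨π, rfl⟩
      exact permDual_mem π
    · rintro _ ⟨π, rfl⟩
      exact permDual_image π

end Weyl

/-! ### The multivariate Beta integral -/

/-- The function `x ↦ x^(c-1)` on `[0, ∞)`, extended by zero. -/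
def powKer (c x : ℝ) : ENNReal := if 0 ≤ x then ENNReal.ofReal (x ^ (c - 1)) else 0

lemma measurable_powKer (c : ℝ) : Measurable (powKer c) :=
  Measurable.ite measurableSet_Ici (by fun_prop) measurable_const

lemma powKer_mul {r : ℝ} (hr : 0 < r) (c x : ℝ) :
    powKer c (r * x) = ENNReal.ofReal (r ^ (c - 1)) * powKer c x := by
  by_cases hx : 0 ≤ x
  · rw [powKer, powKer, if_pos (mul_nonneg hr.le hx), if_pos hx, Real.mul_rpow hr.le hx,
      ENNReal.ofReal_mul (Real.rpow_nonneg hr.le _)]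
  · rw [powKer, powKer, if_neg (fun h => hx (nonneg_of_mul_nonneg_right h hr)), if_neg hx, mul_zero]

lemma lintegral_powKer_mul_exp {c : ℝ} (hc : 0 < c) :
    ∫⁻ x, powKer c x * ENNReal.ofReal (Real.exp (-x)) = ENNReal.ofReal (Real.Gamma c) := by
  rw [Real.Gamma_eq_integral hc,
    ofReal_integral_eq_lintegral_ofReal (Real.GammaIntegral_convergent hc),
    ← setLIntegral_congr Ioi_ae_eq_Ici.symm, ← lintegral_indicator measurableSet_Ici]
  · refine lintegral_congr fun x => ?_
    by_cases hx : 0 ≤ x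
    · rw [Set.indicator_of_mem (Set.mem_Ici.2 hx), powKer, if_pos hx, mul_comm (Real.exp _),
        ENNReal.ofReal_mul (Real.rpow_nonneg hx _)]
    · rw [Set.indicator_of_notMem (by simpa using hx), powKer, if_neg hx, zero_mul]
  · filter_upwards [ae_restrict_mem measurableSet_Ioi] with x hx
    have : 0 < x := hx
    positivity

lemma lintegral_prod_eq_prod {n : ℕ} (f : Fin n → ℝ → ENNReal) (hf : ∀ i, Measurable (f i)) :
    ∫⁻ x : Fin n → ℝ, ∏ i, f i (x i) = ∏ i, ∫⁻ x, f i x := by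
  induction n with
  | zero =>
    simp [volume_pi]
  | succ n ih =>
    have hmp := (volume_preserving_piFinSuccAbove (fun _ : Fin (n + 1) => ℝ) 0).symm
    rw [← hmp.lintegral_comp (by fun_prop), Fin.prod_univ_succ, ← ih _ fun i => hf i.succ]
    simp only [Fin.prod_univ_succ]
    rw [← lintegral_prod_mul (hf 0).aemeasurable (Finset.measurable_prod _ fun i _ =>
      (hf i.succ).comp (measurable_pi_apply i)).aemeasurable]
    rfl

lemma lintegral_eq_smul {n : ℕ} {r : ℝ} (hr : 0 < r) {g : (Fin n → ℝ) → ENNReal}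
    (hg : Measurable g) :
    ∫⁻ z, g z = ENNReal.ofReal (r ^ n) * ∫⁻ w, g (r • w) := by
  have h := lintegral_map (μ := (volume : Measure (Fin n → ℝ))) hg (measurable_const_smul r)
  rw [Measure.map_addHaar_smul _ hr.ne', lintegral_smul_measure, Module.finrank_fin_fun,
    abs_of_pos (by positivity)] at h
  rw [← h, smul_eq_mul, ← mul_assoc, ← ENNReal.ofReal_mul (by positivity),
    mul_inv_cancel₀ (by positivity), ENNReal.ofReal_one, one_mul]

/-- The integrand of the Dirichlet integral over the simplex of size `r`. -/
def simplexKer {n : ℕ} (a : Fin (n + 1) → ℝ) (r : ℝ) (z : Fin n → ℝ) : ENNReal :=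
  (∏ i, powKer (a i.castSucc) (z i)) * powKer (a (Fin.last n)) (r - ∑ i, z i)

lemma measurable_simplexKer {n : ℕ} (a : Fin (n + 1) → ℝ) :
    Measurable (Function.uncurry (simplexKer a)) := by
  have h : ∀ c, Measurable (powKer c) := measurable_powKer
  unfold simplexKer Function.uncurry
  fun_prop

lemma measurable_simplexKer_right {n : ℕ} (a : Fin (n + 1) → ℝ) (r : ℝ) :
    Measurable (simplexKer a r) :=
  (measurable_simplexKer a).comp measurable_prodMk_left

/-- Scaling: the integral over the simplex of size `r` is `r^(|a| - 1)` times that over the unit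
simplex. -/
lemma lintegral_simplexKer {n : ℕ} (a : Fin (n + 1) → ℝ) {r : ℝ} (hr : r ≠ 0) :
    ∫⁻ z, simplexKer a r z = powKer (∑ i, a i) r * ∫⁻ z, simplexKer a 1 z := by
  rcases lt_or_gt_of_ne hr with h | h
  · rw [powKer, if_neg (not_le.2 h), zero_mul,
      lintegral_eq_zero_iff (measurable_simplexKer_right a r)]
    refine Filter.Eventually.of_forall fun z => ?_
    rw [Pi.zero_apply, simplexKer, mul_eq_zero]
    by_cases hz : ∀ i, 0 ≤ z i
    · right
      rw [powKer, if_neg]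
      have := Finset.sum_nonneg fun i (_ : i ∈ Finset.univ) => hz i
      linarith
    · left
      push Not at hz
      obtain ⟨i, hi⟩ := hz
      refine Finset.prod_eq_zero (Finset.mem_univ i) ?_
      rw [powKer, if_neg (not_le.2 hi)]
  · have key : ∀ w : Fin n → ℝ, simplexKer a r (r • w) =
        ENNReal.ofReal (∏ i, r ^ (a i - 1)) * simplexKer a 1 w := fun w => by
      have e : r - ∑ i, (r • w) i = r * (1 - ∑ i, w i) := by
        simp only [Pi.smul_apply, smul_eq_mul, ← Finset.mul_sum]; ring
      rw [simplexKer, e, powKer_mul h, simplexKer, Fin.prod_univ_castSucc,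
        ENNReal.ofReal_mul (Finset.prod_nonneg fun i _ => Real.rpow_nonneg h.le _),
        ENNReal.ofReal_prod_of_nonneg fun i _ => Real.rpow_nonneg h.le _]
      simp only [Pi.smul_apply, smul_eq_mul, powKer_mul h, Finset.prod_mul_distrib]
      ring
    rw [lintegral_eq_smul h (measurable_simplexKer_right a r)]
    simp only [key]
    rw [lintegral_const_mul _ (measurable_simplexKer_right a 1), ← mul_assoc,
      ← ENNReal.ofReal_mul (by positivity), powKer, if_pos h.le]
    congr 2
    rw [← Real.rpow_sum_of_pos h, ← Real.rpow_natCast, ← Real.rpow_add h]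
    congr 1
    simp only [Finset.sum_sub_distrib, Finset.sum_const, Finset.card_univ, Fintype.card_fin,
      nsmul_eq_mul]
    push_cast
    ring

/-- The Dirichlet integral: the product of the Gamma integrals, written in the coordinates
`z_1, …, z_n` and `r = x_1 + … + x_{n+1}`, is `Γ(|a|)` times the integral over the simplex. -/
lemma lintegral_simplexKer_one {n : ℕ} {a : Fin (n + 1) → ℝ} (ha : ∀ i, 0 < a i) :
    ∫⁻ z, simplexKer a 1 z = ENNReal.ofReal (multiBeta a) := by
  have hpk : ∀ c, Measurable (powKer c) := measurable_powKer
  have hs : 0 < ∑ i, a i := Finset.sum_pos (fun i _ => ha i) Finset.univ_nonempty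
  have hG := Real.Gamma_pos_of_pos hs
  have h1 : ENNReal.ofReal (∏ i, Real.Gamma (a i)) =
      ∫⁻ z : Fin n → ℝ, ∫⁻ r : ℝ, simplexKer a r z * ENNReal.ofReal (Real.exp (-r)) := by
    rw [ENNReal.ofReal_prod_of_nonneg fun i _ => (Real.Gamma_pos_of_pos (ha i)).le,
      Fin.prod_univ_castSucc, ← lintegral_powKer_mul_exp (ha _),
      Finset.prod_congr rfl fun i _ => (lintegral_powKer_mul_exp (ha (Fin.castSucc i))).symm,
      ← lintegral_prod_eq_prod (fun i x => powKer (a i.castSucc) x * ENNReal.ofReal (Real.exp (-x)))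
        (fun i => by fun_prop), ← lintegral_mul_const _ (by fun_prop)]
    refine lintegral_congr fun z => ?_
    rw [← lintegral_const_mul _ (by fun_prop),
      ← lintegral_sub_right_eq_self (fun x => (∏ i, powKer (a i.castSucc) (z i) *
        ENNReal.ofReal (Real.exp (-z i))) * (powKer (a (Fin.last n)) x *
        ENNReal.ofReal (Real.exp (-x)))) (∑ i, z i)]
    refine lintegral_congr fun r => ?_
    have e : Real.exp (-r) = (∏ i, Real.exp (-z i)) * Real.exp (-(r - ∑ i, z i)) := by
      rw [← Real.exp_sum, ← Real.exp_add, Finset.sum_neg_distrib]; congr 1; ring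
    rw [simplexKer, e, ENNReal.ofReal_mul (Finset.prod_nonneg fun i _ => (Real.exp_pos _).le),
      ENNReal.ofReal_prod_of_nonneg fun i _ => (Real.exp_pos _).le, Finset.prod_mul_distrib]
    ring
  have h2 : ENNReal.ofReal (∏ i, Real.Gamma (a i)) =
      ENNReal.ofReal (Real.Gamma (∑ i, a i)) * ∫⁻ z, simplexKer a 1 z := by
    have hm := measurable_simplexKer a
    rw [h1, lintegral_lintegral_swap (f := fun z r => simplexKer a r z *
      ENNReal.ofReal (Real.exp (-r)))
      (((hm.comp measurable_swap).mul (by fun_prop)).aemeasurable), ← lintegral_powKer_mul_exp hs,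
      ← lintegral_mul_const _ (by fun_prop)]
    refine lintegral_congr_ae ?_
    filter_upwards [(measure_eq_zero_iff_ae_notMem.1 (measure_singleton (0 : ℝ)))] with r hr
    rw [lintegral_mul_const _ (measurable_simplexKer_right a r), lintegral_simplexKer a hr]
    ring
  rw [multiBeta, ENNReal.ofReal_div_of_pos hG, h2, mul_comm, ENNReal.mul_div_cancel_right]
  · exact (ENNReal.ofReal_pos.2 hG).ne'
  · exact ENNReal.ofReal_ne_top

/-! ### Dirichlet distributions and their posteriors -/

lemma cornerMap_castSucc {n : ℕ} (z : Fin n → ℝ) (i : Fin n) :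
    cornerMap (n + 1) z i.castSucc = z i := by
  rw [cornerMap, dif_pos (show (i.castSucc : Fin (n + 1)).val < n + 1 - 1 from i.2)]
  rfl

lemma cornerMap_last {n : ℕ} (z : Fin n → ℝ) :
    cornerMap (n + 1) z (Fin.last n) = 1 - ∑ i, z i := by
  rw [cornerMap, dif_neg (by simp)]
  rfl

lemma cornerMap_nonneg {n : ℕ} {z : Fin n → ℝ} (hz : z ∈ cornerSimplex (n + 1))
    (i : Fin (n + 1)) : 0 ≤ cornerMap (n + 1) z i := by
  cases i using Fin.lastCases with
  | last => rw [cornerMap_last]; exact sub_nonneg.2 hz.2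
  | cast i => rw [cornerMap_castSucc]; exact hz.1 i

lemma sum_cornerMap {n : ℕ} (z : Fin n → ℝ) : ∑ i, cornerMap (n + 1) z i = 1 := by
  rw [Fin.sum_univ_castSucc, cornerMap_last]
  simp [cornerMap_castSucc]

lemma measurable_cornerMap (n : ℕ) :
    Measurable (cornerMap (n + 1) : (Fin n → ℝ) → Fin (n + 1) → ℝ) := by
  refine measurable_pi_lambda _ fun i => ?_
  cases i using Fin.lastCases with
  | last => simp only [cornerMap_last]; fun_prop
  | cast i => simp only [cornerMap_castSucc]; fun_prop

lemma measurableSet_cornerSimplex (n : ℕ) :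
    MeasurableSet (cornerSimplex (n + 1) : Set (Fin n → ℝ)) := by
  have h : (cornerSimplex (n + 1) : Set (Fin n → ℝ)) =
      (⋂ i, {z | 0 ≤ z i}) ∩ {z | ∑ i, z i ≤ 1} := by
    ext z; simp [cornerSimplex]
  rw [h]
  refine (MeasurableSet.iInter fun i => ?_).inter ?_
  · exact measurableSet_le measurable_const (measurable_pi_apply i)
  · exact measurableSet_le (by fun_prop) measurable_const

lemma simplexKer_one {n : ℕ} (a : Fin (n + 1) → ℝ) :
    simplexKer a 1 = (cornerSimplex (n + 1)).indicator fun z =>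
      ENNReal.ofReal (∏ i, cornerMap (n + 1) z i ^ (a i - 1)) := by
  funext z
  by_cases hz : z ∈ cornerSimplex (n + 1)
  · rw [Set.indicator_of_mem hz, simplexKer, ENNReal.ofReal_prod_of_nonneg fun i _ =>
      Real.rpow_nonneg (cornerMap_nonneg hz i) _, Fin.prod_univ_castSucc, cornerMap_last, powKer,
      if_pos (show (0 : ℝ) ≤ 1 - ∑ i : Fin n, z i from sub_nonneg.2 hz.2)]
    congr 1
    refine Finset.prod_congr rfl fun i _ => ?_
    rw [cornerMap_castSucc, powKer, if_pos (hz.1 i)]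
  · rw [Set.indicator_of_notMem hz, simplexKer, mul_eq_zero]
    by_cases h : ∀ i, 0 ≤ z i
    · right
      rw [powKer, if_neg]
      exact fun h' => hz ⟨h, sub_nonneg.1 h'⟩
    · left
      push Not at h
      obtain ⟨i, hi⟩ := h
      refine Finset.prod_eq_zero (Finset.mem_univ i) ?_
      rw [powKer, if_neg (not_le.2 hi)]

lemma multiBeta_pos {n : ℕ} {a : Fin (n + 1) → ℝ} (ha : ∀ i, 0 < a i) : 0 < multiBeta a :=
  div_pos (Finset.prod_pos fun i _ => Real.Gamma_pos_of_pos (ha i))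
    (Real.Gamma_pos_of_pos (Finset.sum_pos (fun i _ => ha i) Finset.univ_nonempty))

lemma measurable_density {n : ℕ} (a : Fin (n + 1) → ℝ) :
    Measurable fun z : Fin n → ℝ =>
      ENNReal.ofReal ((∏ i, cornerMap (n + 1) z i ^ (a i - 1)) / multiBeta a) := by
  have h : ∀ i, Measurable fun z : Fin n → ℝ => cornerMap (n + 1) z i :=
    fun i => (measurable_pi_apply i).comp (measurable_cornerMap n)
  fun_prop

lemma lintegral_dirichlet {n : ℕ} (a : Fin (n + 1) → ℝ) {g : (Fin (n + 1) → ℝ) → ENNReal}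
    (hg : Measurable g) :
    ∫⁻ y, g y ∂dirichlet a = ∫⁻ z : Fin n → ℝ in (cornerSimplex (n + 1) : Set (Fin n → ℝ)),
      ENNReal.ofReal ((∏ i, cornerMap (n + 1) z i ^ (a i - 1)) / multiBeta a) *
        g (cornerMap (n + 1) z) := by
  rw [dirichlet, lintegral_map hg (measurable_cornerMap n)]
  exact lintegral_withDensity_eq_lintegral_mul _ (measurable_density a)
    (hg.comp (measurable_cornerMap n))

lemma isProbabilityMeasure_dirichlet {n : ℕ} {a : Fin (n + 1) → ℝ} (ha : ∀ i, 0 < a i) :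
    IsProbabilityMeasure (dirichlet a) := by
  constructor
  have hB := multiBeta_pos ha
  rw [← lintegral_one, lintegral_dirichlet a measurable_const]
  have hdiv : ∀ x : ℝ, ENNReal.ofReal (x / multiBeta a) =
      ENNReal.ofReal x * (ENNReal.ofReal (multiBeta a))⁻¹ := fun x => by
    rw [ENNReal.ofReal_div_of_pos hB, div_eq_mul_inv]
  simp only [mul_one, hdiv]
  have hm : Measurable fun z : Fin n → ℝ =>
      ENNReal.ofReal (∏ i, cornerMap (n + 1) z i ^ (a i - 1)) := by
    have h : ∀ i, Measurable fun z : Fin n → ℝ => cornerMap (n + 1) z i :=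
      fun i => (measurable_pi_apply i).comp (measurable_cornerMap n)
    fun_prop
  rw [lintegral_mul_const _ hm, ← lintegral_indicator (α := Fin n → ℝ)
    (measurableSet_cornerSimplex n)]
  refine (congrArg (· * _) ?_).trans
    (ENNReal.mul_inv_cancel (ENNReal.ofReal_pos.2 hB).ne' ENNReal.ofReal_ne_top)
  exact (congrArg (fun f : (Fin n → ℝ) → ENNReal => ∫⁻ z, f z) (simplexKer_one a)).symm.trans
    (lintegral_simplexKer_one ha)

/-- The hypothesis `0 < c` matters at `y = 0`, where it excludes that `c + p - 1 = 0` for some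
`p ≠ 0`. -/
lemma rpow_add_nat {y c : ℝ} (hy : 0 ≤ y) (hc : 0 < c) (p : ℕ) :
    y ^ (c - 1) * y ^ p = y ^ (c + p - 1) := by
  rcases hy.eq_or_lt with rfl | hy
  · rcases Nat.eq_zero_or_pos p with rfl | hp
    · simp
    · have h1 : (1 : ℝ) ≤ p := by exact_mod_cast hp
      rw [zero_pow hp.ne', mul_zero, Real.zero_rpow (by linarith)]
  · rw [← Real.rpow_natCast, ← Real.rpow_add hy]; congr 1; ring

lemma density_mul_pow {n : ℕ} {a : Fin (n + 1) → ℝ} (ha : ∀ i, 0 < a i) (p : Fin (n + 1) → ℕ)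
    {z : Fin n → ℝ} (hz : z ∈ cornerSimplex (n + 1)) :
    ENNReal.ofReal ((∏ i, cornerMap (n + 1) z i ^ (a i - 1)) / multiBeta a) *
      ∏ i, ENNReal.ofReal (cornerMap (n + 1) z i) ^ p i =
    ENNReal.ofReal (multiBeta (shiftBy a p) / multiBeta a) *
      ENNReal.ofReal ((∏ i, cornerMap (n + 1) z i ^ (shiftBy a p i - 1)) /
        multiBeta (shiftBy a p)) := by
  have ha' : ∀ i, 0 < shiftBy a p i := fun i => add_pos_of_pos_of_nonneg (ha i) (Nat.cast_nonneg _)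
  have hB := multiBeta_pos ha
  have hB' := multiBeta_pos ha'
  have h0 := fun i => cornerMap_nonneg hz i
  simp only [← ENNReal.ofReal_pow (h0 _)]
  rw [← ENNReal.ofReal_prod_of_nonneg fun i _ => pow_nonneg (h0 i) _,
    ← ENNReal.ofReal_mul
      (div_nonneg (Finset.prod_nonneg fun i _ => Real.rpow_nonneg (h0 i) _) hB.le),
    ← ENNReal.ofReal_mul (by positivity)]
  congr 1
  rw [div_mul_eq_mul_div, ← Finset.prod_mul_distrib, Finset.prod_congr rfl fun i _ =>
    rpow_add_nat (h0 i) (ha i) (p i)]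
  simp only [shiftBy] at hB' ⊢
  field_simp

lemma withDensity_dirichlet {n : ℕ} {a : Fin (n + 1) → ℝ} (ha : ∀ i, 0 < a i)
    (p : Fin (n + 1) → ℕ) :
    (dirichlet a).withDensity (fun y => ∏ i, ENNReal.ofReal (y i) ^ p i) =
      ENNReal.ofReal (multiBeta (shiftBy a p) / multiBeta a) • dirichlet (shiftBy a p) := by
  have hm : Measurable fun y : Fin (n + 1) → ℝ => ∏ i, ENNReal.ofReal (y i) ^ p i := by fun_prop
  refine Measure.ext_of_lintegral _ fun g hg => ?_
  have hgm : Measurable fun z : Fin n → ℝ => ENNReal.ofReal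
      ((∏ i, cornerMap (n + 1) z i ^ (shiftBy a p i - 1)) / multiBeta (shiftBy a p)) *
        g (cornerMap (n + 1) z) :=
    (measurable_density _).mul (hg.comp (measurable_cornerMap n))
  rw [lintegral_smul_measure, lintegral_withDensity_eq_lintegral_mul _ hm hg,
    lintegral_dirichlet a (hm.mul hg), lintegral_dirichlet _ hg, smul_eq_mul,
    ← lintegral_const_mul (α := Fin n → ℝ) _ hgm]
  refine setLIntegral_congr_fun (measurableSet_cornerSimplex n) fun z hz => ?_
  dsimp only [Pi.mul_apply]
  rw [← mul_assoc, density_mul_pow ha p hz, mul_assoc]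

/-- There is a sample of length `|p|` in which every `i` occurs exactly `p_i` times. -/
lemma exists_counts {k : ℕ} (p : Fin k → ℕ) :
    ∃ w : Fin (∑ i, p i) → Fin k, ∀ i, (Finset.univ.filter fun j => w j = i).card = p i := by
  refine ⟨fun j => (finSigmaFinEquiv.symm j).1, fun i => ?_⟩
  rw [← Fintype.card_subtype]
  rw [Fintype.card_congr (finSigmaFinEquiv.symm.subtypeEquiv
      (q := fun x => x.1 = i) fun _ => Iff.rfl),
    Fintype.card_congr (Equiv.sigmaSubtype i)]
  simp

lemma prod_sample {k r : ℕ} {p : Fin k → ℕ} {w : Fin r → Fin k}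
    (hw : ∀ i, (Finset.univ.filter fun j => w j = i).card = p i) (f : Fin k → ENNReal) :
    ∏ j, f (w j) = ∏ i, f i ^ p i := by
  rw [← Finset.prod_fiberwise_of_maps_to (g := w) (t := Finset.univ) fun _ _ => Finset.mem_univ _]
  refine Finset.prod_congr rfl fun i _ => ?_
  rw [← hw i, ← Finset.prod_const]
  exact Finset.prod_congr rfl fun j hj => by rw [(Finset.mem_filter.1 hj).2]

/-- Conditioning on the counts weights the prior with the likelihood `∏ y_i^{p_i}`; the number of
samples with these counts cancels in the normalization. -/
lemma posterior_eq {k : ℕ} (μ : Measure (Fin k → ℝ)) (p : Fin k → ℕ) :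
    posterior μ p = ((μ.withDensity fun y => ∏ i, ENNReal.ofReal (y i) ^ p i) Set.univ)⁻¹ •
      μ.withDensity fun y => ∏ i, ENNReal.ofReal (y i) ^ p i := by
  classical
  set S : Set ((Fin k → ℝ) × (Fin (∑ i, p i) → Fin k)) :=
    {x | ∀ i, (Finset.univ.filter fun j => x.2 j = i).card = p i} with hS
  set W : Finset (Fin (∑ i, p i) → Fin k) :=
    Finset.univ.filter fun w => ∀ i, (Finset.univ.filter fun j => w j = i).card = p i with hW
  set ν := μ.withDensity fun y => ∏ i, ENNReal.ofReal (y i) ^ p i with hν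
  have hSm : MeasurableSet S := measurable_snd
    (Set.Finite.measurableSet (Set.toFinite
      {w : Fin (∑ i, p i) → Fin k | ∀ i, (Finset.univ.filter fun j => w j = i).card = p i}))
  have hmap : ∀ A, MeasurableSet A →
      sampleLaw μ (∑ i, p i) (S ∩ Prod.fst ⁻¹' A) = W.card * ν A := fun A hA => by
    have hmA : MeasurableSet (S ∩ Prod.fst ⁻¹' A) := hSm.inter (measurable_fst hA)
    rw [sampleLaw, Measure.coe_finsetSum, Finset.sum_apply, ← nsmul_eq_mul, ← Finset.sum_const,
      hW, Finset.sum_filter]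
    refine Finset.sum_congr rfl fun w _ => ?_
    rw [Measure.map_apply measurable_prodMk_right hmA]
    split_ifs with hw
    · have e : (fun y : Fin k → ℝ => (y, w)) ⁻¹' (S ∩ Prod.fst ⁻¹' A) = A := by
        ext y; simp [hS, hw]
      rw [e, hν]
      simp only [prod_sample hw fun i => ENNReal.ofReal _]
    · have e : (fun y : Fin k → ℝ => (y, w)) ⁻¹' (S ∩ Prod.fst ⁻¹' A) = ∅ := by
        ext y; simp [hS, hw]
      rw [e, measure_empty]
  have hWne : (W.card : ENNReal) ≠ 0 := by
    obtain ⟨w, hw⟩ := exists_counts p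
    exact_mod_cast (Finset.card_pos.2 ⟨w, by simp [hW, hw]⟩).ne'
  ext A hA
  have hSu : sampleLaw μ (∑ i, p i) S = W.card * ν Set.univ := by
    simpa using hmap _ MeasurableSet.univ
  rw [posterior, Measure.map_apply measurable_fst hA, ProbabilityTheory.cond_apply hSm, hmap A hA,
    hSu, Measure.smul_apply, smul_eq_mul, ENNReal.mul_inv (Or.inl hWne)
    (Or.inl (ENNReal.natCast_ne_top _)), mul_mul_mul_comm, ENNReal.inv_mul_cancel hWne
    (ENNReal.natCast_ne_top _), one_mul]

/-- The Dirichlet distributions are conjugate: the posterior of `Dir_a` given `p` is `Dir_{a+p}`. -/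
lemma posterior_dirichlet {n : ℕ} {a : Fin (n + 1) → ℝ} (ha : ∀ i, 0 < a i)
    (p : Fin (n + 1) → ℕ) : posterior (dirichlet a) p = dirichlet (shiftBy a p) := by
  have ha' : ∀ i, 0 < shiftBy a p i := fun i => add_pos_of_pos_of_nonneg (ha i) (Nat.cast_nonneg _)
  have := isProbabilityMeasure_dirichlet ha'
  have hc : ENNReal.ofReal (multiBeta (shiftBy a p) / multiBeta a) ≠ 0 :=
    (ENNReal.ofReal_pos.2 (div_pos (multiBeta_pos ha') (multiBeta_pos ha))).ne'
  rw [posterior_eq, withDensity_dirichlet ha, Measure.smul_apply, measure_univ, smul_eq_mul,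
    mul_one, smul_smul, ENNReal.inv_mul_cancel hc ENNReal.ofReal_ne_top, one_smul]

/-! ### The Fourier transform of a Dirichlet distribution -/

lemma gamma_add_nat {x : ℝ} (hx : 0 < x) (n : ℕ) :
    Real.Gamma (x + n) = (ascPochhammer ℝ n).eval x * Real.Gamma x := by
  induction n with
  | zero => simp
  | succ n ih =>
    rw [ascPochhammer_succ_eval, Nat.cast_succ, ← add_assoc, Real.Gamma_add_one (by positivity), ih]
    ring

lemma poch_ofReal (x : ℝ) (n : ℕ) :
    (ascPochhammer ℂ n).eval (x : ℂ) = (((ascPochhammer ℝ n).eval x : ℝ) : ℂ) := by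
  induction n with
  | zero => simp
  | succ n ih => rw [ascPochhammer_succ_eval, ascPochhammer_succ_eval, ih]; push_cast; rfl

lemma ae_dirichlet {n : ℕ} (a : Fin (n + 1) → ℝ) :
    ∀ᵐ y ∂dirichlet a, ∀ i, 0 ≤ y i ∧ y i ≤ 1 := by
  have hm : MeasurableSet {y : Fin (n + 1) → ℝ | ∀ i, 0 ≤ y i ∧ y i ≤ 1} := by
    have : {y : Fin (n + 1) → ℝ | ∀ i, 0 ≤ y i ∧ y i ≤ 1} = Set.univ.pi fun _ => Set.Icc 0 1 := by
      ext y; simp [Pi.le_def, forall_and]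
    rw [this]
    exact MeasurableSet.univ_pi fun _ => measurableSet_Icc
  rw [dirichlet, ae_map_iff (measurable_cornerMap n).aemeasurable hm]
  refine (withDensity_absolutelyContinuous _ _).ae_le ?_
  filter_upwards [ae_restrict_mem (measurableSet_cornerSimplex n)] with z hz i
  refine ⟨cornerMap_nonneg hz i, ?_⟩
  rw [← sum_cornerMap z]
  exact Finset.single_le_sum (fun j _ => cornerMap_nonneg hz j) (Finset.mem_univ i)

lemma integral_moment {n : ℕ} {a : Fin (n + 1) → ℝ} (ha : ∀ i, 0 < a i) (m : Fin (n + 1) → ℕ) :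
    ∫ y, ∏ i, y i ^ m i ∂dirichlet a = multiBeta (shiftBy a m) / multiBeta a := by
  have ha' : ∀ i, 0 < shiftBy a m i := fun i => add_pos_of_pos_of_nonneg (ha i) (Nat.cast_nonneg _)
  have := isProbabilityMeasure_dirichlet ha'
  rw [integral_eq_lintegral_of_nonneg_ae]
  · have h : ∫⁻ y, ENNReal.ofReal (∏ i, y i ^ m i) ∂dirichlet a =
        ∫⁻ y, ∏ i, ENNReal.ofReal (y i) ^ m i ∂dirichlet a := by
      refine lintegral_congr_ae ?_
      filter_upwards [ae_dirichlet a] with y hy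
      rw [ENNReal.ofReal_prod_of_nonneg fun i _ => pow_nonneg (hy i).1 _]
      simp only [ENNReal.ofReal_pow (hy _).1]
    rw [h, ← setLIntegral_univ, ← withDensity_apply _ MeasurableSet.univ, withDensity_dirichlet ha,
      Measure.smul_apply, measure_univ, smul_eq_mul, mul_one, ENNReal.toReal_ofReal]
    exact (div_pos (multiBeta_pos ha') (multiBeta_pos ha)).le
  · filter_upwards [ae_dirichlet a] with y hy
    exact Finset.prod_nonneg fun i _ => pow_nonneg (hy i).1 _
  · exact (by fun_prop : Measurable fun y : Fin (n + 1) → ℝ => ∏ i, y i ^ m i).aestronglyMeasurable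

lemma moment_eq_poch {n : ℕ} {a : Fin (n + 1) → ℝ} (ha : ∀ i, 0 < a i) (m : Fin (n + 1) → ℕ) :
    multiBeta (shiftBy a m) / multiBeta a =
      (∏ i, (ascPochhammer ℝ (m i)).eval (a i)) / (ascPochhammer ℝ (∑ i, m i)).eval (∑ i, a i) := by
  have hs : 0 < ∑ i, a i := Finset.sum_pos (fun i _ => ha i) Finset.univ_nonempty
  have hG := (Real.Gamma_pos_of_pos hs).ne'
  have hP := (Finset.prod_pos fun i (_ : i ∈ Finset.univ) => Real.Gamma_pos_of_pos (ha i)).ne'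
  have hQ := (ascPochhammer_pos (∑ i, m i) _ hs).ne'
  have e : ∑ i, shiftBy a m i = ∑ i, a i + (∑ i, m i : ℕ) := by
    simp [shiftBy, Finset.sum_add_distrib]
  rw [multiBeta, multiBeta, e, gamma_add_nat hs]
  simp only [shiftBy, gamma_add_nat (ha _), Finset.prod_mul_distrib]
  field_simp

/-- The product of absolutely convergent series, as a sum over multi-indices. -/
lemma hasSum_prod_pi {k : ℕ} (f : Fin k → ℕ → ℂ) (h : ∀ i, Summable fun n => ‖f i n‖) :
    HasSum (fun m : Fin k → ℕ => ∏ i, f i (m i)) (∏ i, ∑' n, f i n) := by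
  have hnorm : ∀ {k : ℕ} (f : Fin k → ℕ → ℂ), (∀ i, Summable fun n => ‖f i n‖) →
      Summable fun m : Fin k → ℕ => ‖∏ i, f i (m i)‖ := fun f h => by
    simp only [norm_prod]
    exact summable_prod_pi (fun i n => ‖f i n‖) (fun _ _ => norm_nonneg _) h
  induction k with
  | zero => simp [hasSum_unique]
  | succ k ih =>
    rw [← (Fin.consEquiv fun _ : Fin (k + 1) => ℕ).hasSum_iff, Fin.prod_univ_succ]
    have h1 : HasSum (fun m : Fin k → ℕ => ∏ i : Fin k, f i.succ (m i))
        (∏ i : Fin k, ∑' n, f i.succ n) := ih (fun i => f i.succ) fun i => h _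
    have h2 : HasSum (fun x : ℕ × (Fin k → ℕ) => f 0 x.1 * ∏ i : Fin k, f i.succ (x.2 i))
        ((∑' n, f 0 n) * ∏ i : Fin k, ∑' n, f i.succ n) := by
      have h3 : Summable fun x : ℕ × (Fin k → ℕ) => f 0 x.1 * ∏ i : Fin k, f i.succ (x.2 i) :=
        summable_mul_of_summable_norm (f := f 0) (g := fun m : Fin k → ℕ =>
          ∏ i : Fin k, f i.succ (m i)) (h 0) (hnorm (fun i => f i.succ) fun i => h _)
      have h4 : HasSum (f 0) (∑' n, f 0 n) := (h 0).of_norm.hasSum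
      exact HasSum.mul (f := f 0) (g := fun m : Fin k → ℕ => ∏ i : Fin k, f i.succ (m i)) h4 h1 h3
    have e : (fun m : Fin (k + 1) → ℕ => ∏ i, f i (m i)) ∘ (Fin.consEquiv fun _ => ℕ) =
        fun x : ℕ × (Fin k → ℕ) => f 0 x.1 * ∏ i : Fin k, f i.succ (x.2 i) :=
      funext fun x => by simp [Fin.prod_univ_succ, Fin.consEquiv]
    rw [e]
    exact h2

/-- Expanding the exponential, the Fourier transform of `Dir_a` is the Humbert function: the
moments of `Dir_a` are `(a)_m / (|a|)_{|m|}`. -/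
lemma charFT_dirichlet {n : ℕ} {a : Fin (n + 1) → ℝ} (ha : ∀ i, 0 < a i) (s : Fin (n + 1) → ℝ) :
    charFT (dirichlet a) s = humbertPhi (castVec a) fun i => Complex.I * (s i : ℂ) := by
  have := isProbabilityMeasure_dirichlet ha
  set F : (Fin (n + 1) → ℕ) → (Fin (n + 1) → ℝ) → ℂ := fun m y =>
    ∏ i, (Complex.I * (s i : ℂ) * y i) ^ m i / (m i).factorial with hF
  have hbound : ∀ m, ∀ᵐ y ∂dirichlet a, ‖F m y‖ ≤ ∏ i, |s i| ^ m i / (m i).factorial := fun m => by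
    filter_upwards [ae_dirichlet a] with y hy
    rw [hF, norm_prod]
    refine Finset.prod_le_prod (fun _ _ => norm_nonneg _) fun i _ => ?_
    rw [norm_div, norm_pow, norm_mul, norm_mul, Complex.norm_I, one_mul, Complex.norm_real,
      Complex.norm_real, Complex.norm_natCast, Real.norm_eq_abs, Real.norm_eq_abs,
      abs_of_nonneg (hy i).1]
    refine div_le_div_of_nonneg_right (pow_le_pow_left₀ (by have := (hy i).1; positivity) ?_ _)
      (by positivity)
    exact mul_le_of_le_one_right (abs_nonneg _) (hy i).2
  have hmeas : ∀ m, AEStronglyMeasurable (F m) (dirichlet a) := fun m => by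
    refine Measurable.aestronglyMeasurable ?_
    simp only [hF]
    fun_prop
  have hint : ∀ m, Integrable (F m) (dirichlet a) := fun m =>
    Integrable.of_bound (hmeas m) _ (hbound m)
  have hsum : Summable fun m => ∫ y, ‖F m y‖ ∂dirichlet a := by
    refine Summable.of_nonneg_of_le (fun m => integral_nonneg fun _ => norm_nonneg _) (fun m => ?_)
      (summable_prod_pi (fun i m => |s i| ^ m / m.factorial) (fun i m => by positivity)
        fun i => Real.summable_pow_div_factorial _)
    refine (integral_mono_ae (hint m).norm (integrable_const _) (hbound m)).trans ?_
    simp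
  have hexp : ∀ y : Fin (n + 1) → ℝ,
      Complex.exp (Complex.I * ((∑ i, s i * y i : ℝ) : ℂ)) = ∑' m, F m y := fun y => by
    have h := hasSum_prod_pi (fun i m => (Complex.I * (s i : ℂ) * y i) ^ m / (m.factorial : ℂ))
      fun i => NormedSpace.norm_expSeries_div_summable _
    rw [h.tsum_eq, Complex.ofReal_sum, Finset.mul_sum, Complex.exp_sum]
    refine Finset.prod_congr rfl fun i _ => ?_
    rw [Complex.exp_eq_exp_ℂ, NormedSpace.exp_eq_tsum_div]
    push_cast
    simp only [mul_assoc]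
  have hterm : ∀ m, ∫ y, F m y ∂dirichlet a =
      (∏ i, (ascPochhammer ℂ (m i)).eval (castVec a i) * (Complex.I * (s i : ℂ)) ^ m i /
        ((m i).factorial : ℂ)) / (ascPochhammer ℂ (∑ i, m i)).eval (∑ i, castVec a i) := fun m => by
    have e : ∀ y, F m y = (∏ i, (Complex.I * (s i : ℂ)) ^ m i / (m i).factorial) *
        ((∏ i, y i ^ m i : ℝ) : ℂ) := fun y => by
      rw [hF, Complex.ofReal_prod, ← Finset.prod_mul_distrib]
      refine Finset.prod_congr rfl fun i _ => ?_
      rw [mul_pow, Complex.ofReal_pow]; ring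
    simp only [e]
    rw [integral_const_mul, integral_complex_ofReal, integral_moment ha, moment_eq_poch ha,
      sum_castVec, poch_ofReal, Complex.ofReal_div, Complex.ofReal_prod, ← mul_div_assoc,
      ← Finset.prod_mul_distrib]
    congr 1
    refine Finset.prod_congr rfl fun i _ => ?_
    rw [poch_ofReal]; ring
  rw [charFT, humbertPhi]
  simp only [hexp]
  rw [← integral_tsum_of_summable_integral_norm hint hsum]
  exact tsum_congr hterm

/-! ### The representation on the functions `f_a` -/

section HumbertRep

variable {k : ℕ} {α : Fin k → ℝ}

lemma fVec_val {a : Fin k → ℝ} (h : a ∈ posLattice α) :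
    (fVec (humbertBasis (posLattice α)) a).val = humbertFun a := by
  rw [fVec_of_mem _ h, humbertBasis_val]

lemma eq_fVec {a : Fin k → ℝ} (h : a ∈ posLattice α) {F : OSpan (posLattice α)}
    (hF : F.val = humbertFun a) : F = fVec (humbertBasis (posLattice α)) a :=
  Subtype.ext (hF.trans (fVec_val h).symm)

lemma eq_zero_of_mem_OSpan {A : Set (Fin k → ℝ)} {F : Pt k → ℂ} (hF : F ∈ OSpan A) {x : Pt k}
    (hx : x ∉ humbertDom k) : F x = 0 := by
  induction hF using Submodule.span_induction with
  | mem _ h =>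
    obtain ⟨a, -, rfl⟩ := h
    exact humbertFun_of_notMem a hx
  | zero => rfl
  | add F G _ _ hF hG => rw [Pi.add_apply, hF, hG, add_zero]
  | smul c F _ hF => rw [Pi.smul_apply, hF, smul_zero]

lemma smul_fVec_apply {a : Fin k → ℝ} (h : a ∈ posLattice α) (c : ℂ) (x : Pt k) :
    (c • fVec (humbertBasis (posLattice α)) a).val x = c * humbertFun a x := by
  rw [← fVec_val h]; rfl

/-- The representation `ρ` of `𝔩` on `O_{Λ⁺_α}`. -/
def humbertRep (hsum : ∑ i, α i = 1) :
    SL k →ₗ⁅ℂ⁆ Module.End ℂ (OSpan (posLattice α)) :=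
  matRep (humbertBasis (posLattice α)) hsum

lemma isHumbertRep_humbertRep (hsum : ∑ i, α i = 1) : IsHumbertRep α (humbertRep hsum) where
  raise i a ha F hF x hx := by
    have hm : a + rvec i ∈ posLattice α := by
      refine ⟨by simpa using lattice_add_sub ha.1 0 i.succ, ?_⟩
      rw [sum_add_rvec]; linarith [ha.2]
    rw [eq_fVec ha hF, raiseOp_humbertFun (one_le_sum hsum ha) i hx, ← smul_fVec_apply hm]
    exact congrArg (fun G : OSpan (posLattice α) => G.val x) (matRep_e0 _ hsum ha i)
  cartan i a ha F hF x hx := by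
    rw [eq_fVec ha hF, cartanOp_humbertFun a i hx, ← smul_fVec_apply ha]
    refine congrArg (fun G : OSpan (posLattice α) => G.val x)
      ((matRep_cartan (humbertBasis (posLattice α)) hsum ha (cartanH i)).trans ?_)
    rw [wt_cartanH]
    congr 1
    push_cast
    ring
  lower i a ha h1 F hF x hx := by
    have h2 := two_le_sum hsum ha h1
    have hm : a - rvec i ∈ posLattice α := by
      simpa using step_mem ha h2 i.succ 0
    rw [eq_fVec ha hF, lowerOp_humbertFun h2 i hx, ← smul_fVec_apply hm]
    refine congrArg (fun G : OSpan (posLattice α) => G.val x)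
      ((matAct_single (humbertBasis (posLattice α)) ha i.succ 0 1).trans ?_)
    simp
  lower_one i a ha h1 F hF := by
    rw [eq_fVec ha hF]
    refine (matAct_single (humbertBasis (posLattice α)) ha i.succ 0 1).trans ?_
    simp [h1]
  shift i j h a ha F hF x hx := by
    have hm : a + rvec i - rvec j ∈ posLattice α := by
      refine ⟨lattice_add_sub ha.1 j.succ i.succ, ?_⟩
      rw [sum_sub_rvec, sum_add_rvec]; linarith [ha.2]
    rw [eq_fVec ha hF, Pi.neg_apply, shiftOp_humbertFun (one_le_sum hsum ha) i j hx, ← neg_mul,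
      ← smul_fVec_apply hm]
    refine congrArg (fun G : OSpan (posLattice α) => G.val x)
      ((matAct_single (humbertBasis (posLattice α)) ha j.succ i.succ 1).trans ?_)
    simp only [hsign_succ, hcoord_succ, one_mul, mul_one]
    rfl

lemma IsHumbertRep.unique {ρ ρ' : SL k →ₗ⁅ℂ⁆ Module.End ℂ (OSpan (posLattice α))}
    (h : IsHumbertRep α ρ) (h' : IsHumbertRep α ρ') : ρ = ρ' := by
  have hdom : ∀ {F G : OSpan (posLattice α)}, Set.EqOn F.val G.val (humbertDom k) → F = G :=
    fun {F G} hFG => Subtype.ext (funext fun x => by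
      by_cases hx : x ∈ humbertDom k
      · exact hFG hx
      · rw [eq_zero_of_mem_OSpan F.2 hx, eq_zero_of_mem_OSpan G.2 hx])
  refine rep_ext (fun i => ?_) fun i => ?_
  · refine hom_ext_fVec (humbertBasis (posLattice α)) fun a ha => hdom fun x hx => ?_
    rw [h.raise i a ha _ (fVec_val ha) hx, h'.raise i a ha _ (fVec_val ha) hx]
  · refine hom_ext_fVec (humbertBasis (posLattice α)) fun a ha => ?_
    by_cases h1 : ∑ j, a j = 1
    · rw [h.lower_one i a ha h1 _ (fVec_val ha), h'.lower_one i a ha h1 _ (fVec_val ha)]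
    · refine hdom fun x hx => ?_
      rw [h.lower i a ha h1 _ (fVec_val ha) hx, h'.lower i a ha h1 _ (fVec_val ha) hx]

lemma OSpan_singleton (a : Fin k → ℝ) : OSpan {a} = Submodule.span ℂ {humbertFun a} := by
  rw [OSpan, Set.image_singleton]

lemma map_span_fVec {A : Set (Fin k → ℝ)} (hA : A ⊆ posLattice α) :
    (Submodule.span ℂ (fVec (humbertBasis (posLattice α)) '' A)).map
      (OSpan (posLattice α)).subtype = OSpan A := by
  rw [Submodule.map_span, ← Set.image_comp]
  exact congrArg (Submodule.span ℂ) (Set.image_congr fun a ha => fVec_val (hA ha))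

lemma mem_OSpan_iff {A : Set (Fin k → ℝ)} (hA : A ⊆ posLattice α) (F : OSpan (posLattice α)) :
    F.val ∈ OSpan A ↔ F ∈ Submodule.span ℂ (fVec (humbertBasis (posLattice α)) '' A) := by
  rw [← map_span_fVec hA]
  exact ⟨fun ⟨G, hG, h⟩ => (Subtype.ext h : G = F) ▸ hG, fun h => ⟨F, h, rfl⟩⟩

lemma preserves_of_forall {A : Set (Fin k → ℝ)} (hA : A ⊆ posLattice α)
    {T : Module.End ℂ (OSpan (posLattice α))}
    (h : ∀ v ∈ Submodule.span ℂ (fVec (humbertBasis (posLattice α)) '' A),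
      T v ∈ Submodule.span ℂ (fVec (humbertBasis (posLattice α)) '' A)) :
    Preserves T (OSpan A) := fun F hF =>
  (mem_OSpan_iff hA _).2 (h F ((mem_OSpan_iff hA F).1 hF))

lemma wtSpace_humbertRep (hsum : ∑ i, α i = 1) {a : Fin k → ℝ} (ha : a ∈ posLattice α) :
    (wtSpace (humbertRep hsum) (wt a)).map (OSpan (posLattice α)).subtype = OSpan {a} := by
  have h := map_span_fVec (α := α) (A := {a}) (by simpa using ha)
  rw [Set.image_singleton] at h
  exact (congrArg (Submodule.map _) (wtSpace_wt _ hsum ha)).trans h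

lemma imageUnder_OSpan {a : Fin k → ℝ} (ha : a ∈ posLattice α)
    (T : Module.End ℂ (OSpan (posLattice α))) :
    imageUnder T (OSpan {a}) =
      Submodule.span ℂ {(T (fVec (humbertBasis (posLattice α)) a)).val} := by
  have h1 : (OSpan {a}).comap (OSpan (posLattice α)).subtype =
      Submodule.span ℂ {fVec (humbertBasis (posLattice α)) a} := by
    refine Submodule.ext fun F => ?_
    have h := mem_OSpan_iff (α := α) (A := {a}) (by simpa using ha) F
    rwa [Set.image_singleton] at h
  rw [imageUnder, h1, Submodule.map_span, Submodule.map_span, Set.image_singleton,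
    Set.image_singleton]
  rfl

lemma exists_rep_radPlus (hpos : ∀ i, 0 < α i) (hsum : ∑ i, α i = 1) (p : Fin k → ℕ) :
    ∃ v : UniversalEnvelopingAlgebra ℂ (radPlus k),
      (∀ v', (∀ F : OSpan (posLattice α), F.val = humbertFun α →
        (envAct (humbertRep hsum) (radPlus k) v' F).val = humbertFun (shiftBy α p)) ↔ v' = v) ∧
      (∀ v', imageUnder (envAct (humbertRep hsum) (radPlus k) v') (OSpan {α}) =
        OSpan {shiftBy α p} ↔ ∃ c : ℂ, c ≠ 0 ∧ v' = c • v) := by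
  have hα := posLattice_self hsum
  have hp := shiftBy_mem_posLattice hsum p
  obtain ⟨v, hv⟩ := envAct_radPlus_surj (humbertBasis (posLattice α)) hpos hsum p
  have hinj := fun v w => envAct_radPlus_injective (humbertBasis (posLattice α)) hpos hsum
    (v := v) (w := w)
  refine ⟨v, fun v' => ⟨fun h => hinj _ _ ?_, ?_⟩, fun v' => ?_⟩
  · exact (eq_fVec hp (h _ (fVec_val hα))).trans hv.symm
  · rintro rfl F hF
    rw [eq_fVec hα hF, ← fVec_val hp]
    exact congrArg Subtype.val hv
  · rw [imageUnder_OSpan hα, OSpan_singleton, eq_comm,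
      Submodule.span_singleton_eq_span_singleton]
    constructor
    · rintro ⟨z, hz⟩
      refine ⟨z, z.ne_zero, hinj _ _ ?_⟩
      rw [map_smul]
      refine Subtype.ext (hz.symm.trans ?_)
      rw [← fVec_val hp, ← hv]
      rfl
    · rintro ⟨c, hc, rfl⟩
      refine ⟨Units.mk0 c hc, ?_⟩
      rw [map_smul, ← fVec_val hp, ← hv]
      rfl

lemma evalAt_humbertFun {a : Fin k → ℝ} (s : Fin k → ℝ) :
    evalAt (humbertFun a) s = humbertPhi (castVec a) fun i => Complex.I * (s i : ℂ) := by
  rw [evalAt, humbertFun_apply _ ⟨fun _ => Complex.one_mem_slitPlane, Complex.one_mem_slitPlane⟩,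
    powFactor]
  simp

lemma bijOn_evalAt (a : Fin k → ℝ) :
    Set.BijOn evalAt (OSpan {a} : Set (Pt k → ℂ))
      (Submodule.span ℂ {evalAt (humbertFun a)} : Set ((Fin k → ℝ) → ℂ)) := by
  have hne : evalAt (humbertFun a) 0 = 1 := by
    rw [evalAt_humbertFun, ← humbertPhi_zero (castVec a)]
    simp [Pi.zero_def]
  rw [OSpan_singleton]
  refine ⟨?_, ?_, ?_⟩
  · intro F hF
    obtain ⟨c, rfl⟩ := Submodule.mem_span_singleton.1 hF
    exact Submodule.mem_span_singleton.2 ⟨c, rfl⟩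
  · intro F hF G hG h
    obtain ⟨c, rfl⟩ := Submodule.mem_span_singleton.1 hF
    obtain ⟨d, rfl⟩ := Submodule.mem_span_singleton.1 hG
    have h0 : c * evalAt (humbertFun a) 0 = d * evalAt (humbertFun a) 0 := congrFun h 0
    rw [hne, mul_one, mul_one] at h0
    rw [h0]
  · intro f hf
    obtain ⟨c, rfl⟩ := Submodule.mem_span_singleton.1 hf
    exact ⟨c • humbertFun a, Submodule.mem_span_singleton.2 ⟨c, rfl⟩, rfl⟩

lemma evalAt_eq_charFT (hpos : ∀ i, 0 < α i) (hsum : ∑ i, α i = 1) (p : Fin k → ℕ) :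
    evalAt (humbertFun (shiftBy α p)) = charFT (posterior (dirichlet α) p) := by
  obtain _ | n := k
  · simp at hsum
  · funext s
    rw [posterior_dirichlet hpos, charFT_dirichlet (a := shiftBy α p)
      (fun i => add_pos_of_pos_of_nonneg (hpos i) (Nat.cast_nonneg _)), evalAt_humbertFun]

end HumbertRep

end DirichletHumbert

end

theorem theorem1p2 (k : ℕ) (α : Fin k → ℝ) (hpos : ∀ i, 0 < α i) (hsum : ∑ i, α i = 1) :
    -- the functions `f_a` are linearly independent and the operators define a representation of `𝔩`
    LinearIndependent ℂ (fun a : posLattice α => humbertFun a.val) ∧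
    (∃ ρ : SL k →ₗ⁅ℂ⁆ Module.End ℂ (OSpan (posLattice α)),
      IsHumbertRep α ρ ∧ (∀ ρ', IsHumbertRep α ρ' → ρ' = ρ) ∧
      -- the dynamical symmetry algebra is `sl_{k+1}`, over `ℂ` and over `ℝ`
      Function.Injective ρ ∧
      LieSubalgebra.lieSpan ℂ (Module.End ℂ (OSpan (posLattice α)))
        (Set.range (fun i => ρ (e0 i)) ∪ Set.range (fun i => ρ (f0 i))) = ρ.range ∧
      Nonempty (LieSubalgebra.lieSpan ℝ (Module.End ℂ (OSpan (posLattice α)))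
        (Set.range (fun i => ρ (e0 i)) ∪ Set.range (fun i => ρ (f0 i))) ≃ₗ⁅ℝ⁆
          LieAlgebra.SpecialLinear.sl (Fin (k + 1)) ℝ) ∧
      -- (i)
      IsWeightModule ρ ∧
      (∀ a ∈ posLattice α, (wtSpace ρ (wt a)).map (OSpan (posLattice α)).subtype = OSpan {a}) ∧
      (∃! R : UniversalEnvelopingAlgebra ℂ (SL k) →ₐ[ℂ] Module.End ℂ (OSpan (posLattice α)),
        ∀ x, R (UniversalEnvelopingAlgebra.ι ℂ x) = ρ x) ∧
      -- (ii)
      (∀ l : ℕ, 0 < l → ∀ v : UniversalEnvelopingAlgebra ℂ (subF k),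
        Preserves (envAct ρ (subF k) v) (OSpan (layer α l))) ∧
      octant α = Set.range (shiftBy α) ∧
      (∀ (v : UniversalEnvelopingAlgebra ℂ (cartan k))
        (w : UniversalEnvelopingAlgebra ℂ (radPlus k)),
        Preserves (envAct ρ (cartan k) v) (OSpan (octant α)) ∧
        Preserves (envAct ρ (radPlus k) w) (OSpan (octant α)) ∧
        Preserves (envAct ρ (cartan k) v + envAct ρ (radPlus k) w) (OSpan (octant α))) ∧
      -- (iii)
      (∀ p : Fin k → ℕ,
        evalAt (humbertFun (shiftBy α p)) = charFT (posterior (dirichlet α) p) ∧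
        Set.BijOn evalAt (OSpan {shiftBy α p} : Set (Pt k → ℂ))
          (Submodule.span ℂ {charFT (posterior (dirichlet α) p)} : Set ((Fin k → ℝ) → ℂ)) ∧
        ∃ v : UniversalEnvelopingAlgebra ℂ (radPlus k),
          (∀ v', (∀ F : OSpan (posLattice α), F.val = humbertFun α →
            (envAct ρ (radPlus k) v' F).val = humbertFun (shiftBy α p)) ↔ v' = v) ∧
          (∀ v', imageUnder (envAct ρ (radPlus k) v') (OSpan {α}) = OSpan {shiftBy α p} ↔
            ∃ c : ℂ, c ≠ 0 ∧ v' = c • v))) ∧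
    -- (iv)
    (∃ G : Subgroup (Module.Dual ℂ (cartan k) ≃ₗ[ℂ] Module.Dual ℂ (cartan k)),
      (∀ G', (G' ≤ weylGroup k ∧ Nonempty (G' ≃* Equiv.Perm (Fin k)) ∧
        ∀ w ∈ G', w '' Set.range rootPlus = Set.range rootPlus) ↔ G' = G) ∧
      Set.InjOn (wt (k := k)) (stdSimplex ℝ (Fin k)) ∧
      ∃ φ : Equiv.Perm (Fin k) ≃* G,
        (∀ π j, (φ π).val (rootPlus j) = rootPlus (π j)) ∧
        (∀ π, ∀ a ∈ stdSimplex ℝ (Fin k), (φ π).val (wt a) = wt (fun i => a (π.symm i)))) := by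
  refine ⟨linearIndependent_humbertFun.comp _ Subtype.val_injective, ⟨humbertRep hsum,
    isHumbertRep_humbertRep hsum, fun ρ' h => h.unique (isHumbertRep_humbertRep hsum),
    matRep_injective _ hpos hsum, lieSpan_eq_range _, ?_, isWeightModule_matRep _ hsum,
    fun a ha => wtSpace_humbertRep hsum ha, ?_, ?_, octant_eq_range hpos hsum, ?_, fun p =>
    ⟨evalAt_eq_charFT hpos hsum p, ?_, exists_rep_radPlus hpos hsum p⟩⟩, existsUnique_subgroup⟩
  · rw [lieSpan_real_eq_range]
    exact ⟨(LieEquiv.ofInjective _ (realRep_injective (matRep_injective _ hpos hsum))).symm⟩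
  · refine ⟨UniversalEnvelopingAlgebra.lift ℂ (humbertRep hsum),
      fun x => UniversalEnvelopingAlgebra.lift_ι_apply ℂ _ x, fun R hR => ?_⟩
    exact (UniversalEnvelopingAlgebra.lift_unique (A := Module.End ℂ (OSpan (posLattice α))) ℂ
      (humbertRep hsum) R).1 (funext fun x => hR x)
  · intro l _ v
    exact preserves_of_forall (fun a ha => ha.1) (envAct_subF_mem _ hsum l v)
  · intro v w
    have hv : Preserves (envAct (humbertRep hsum) (cartan k) v) (OSpan (octant α)) :=
      preserves_of_forall (fun a ha => ha.1) (envAct_cartan_mem _ hsum v)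
    have hw : Preserves (envAct (humbertRep hsum) (radPlus k) w) (OSpan (octant α)) :=
      preserves_of_forall (fun a ha => ha.1) (envAct_radPlus_mem _ hsum w)
    exact ⟨hv, hw, fun F hF => Submodule.add_mem _ (hv F hF) (hw F hF)⟩
  · rw [← evalAt_eq_charFT hpos hsum p]
    exact bijOn_evalAt _
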